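/- **Theorem 2.** Let $M\in\mathbb R$ and consider on $\mathbb R^{1+1}$, with coordinates $(t,x)=(x^0,x^1)$ and metric $\mathrm{diag}(1,-1)$, the Maxwell–Dirac system $$(-i\gamma^\mu\partial_\mu+M)\psi=A_\mu\gamma^\mu\psi,\qquad \square A_\mu=-\overline\psi\gamma_\mu\psi,\qquad \square=\partial_t^2-\partial_x^2,\quad \overline\psi=\psi^*\gamma^0,$$ $$\gamma^0=\begin{pmatrix}0&1\\1&0\end{pmatrix},\qquad \gamma^1=\begin{pmatrix}0&-1\\1&0\end{pmatrix},$$ for a spinor $\psi$ with values in $\mathbb C^2$ and real potentials $A_0,A_1$, with initial conditions $\psi(0)=\psi_0$, $A_\mu(0)=a_\mu$, $\partial_tA_\mu(0)=b_\mu$. A *charge solution* is a solution in the sense of distributions on some $I\times\mathbb R$, $I\ni0$ an open interval, such that $t\mapsto\psi(t)$ is continuous into $L^2(\mathbb R;\mathbb C^2)$ with $\|\psi(t)\|_{L^2}=\|\psi(0)\|_{L^2}$ for $t\in I$, and such that the potentials $A_\mu$ are continuous functions on $I\times\mathbb R$ for which the distributional initial velocity $\partial_tA_\mu(0)$ exists.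 A *local limit solution* with data $(\psi_0,a_\mu,b_\mu)$ is a triple of distributions $(\psi,A_0,A_1)$ on an open neighbourhood $\Omega$ of the origin in $\mathbb R^{1+1}$ which is a limit in the sense of distributions on $\Omega$ of charge solutions defined on $\Omega$, the data being taken in (at least) one of two senses: the initial data of the approximating charge solutions converge to $(\psi_0,a_\mu,b_\mu)$ in the sense of distributions on $\{x:(0,x)\in\Omega\}$, or $\psi$, $A_\mu$, $\partial_tA_\mu$ have the distributional values $\psi_0$, $a_\mu$, $b_\mu$ at $t=0$. The Cauchy problem is called *ill posed* in a space $X_0$ of data if for some data in $X_0$ there is no local limit solution. (i) For all linear subspaces $D_0,D_1$ of $\mathcal D'(\mathbb R)$, the Cauchy problem is ill posed for data $$(\psi_0,a_\mu,b_\mu)\in H^s(\mathbb R;\mathbb C^2)\times D_0\times D_1\quad (s<0)$$ and for data $$(\psi_0,a_\mu,b_\mu)\in L^p(\mathbb R;\mathbb C^2)\times D_0\times D_1\quad (1\le p<2).$$ (ii) In fact $$\psi_0(x)=\chi_{[-1,1]}(x)\,|x|^{-1/2}\begin{pmatrix}1\\1\end{pmatrix}$$ belongs to $H^s$ for all $s<0$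 and to $L^p$ for all $1\le p<2$, and with this $\psi_0$ and $a_\mu=b_\mu=0$ for $\mu=0,1$ there is no local limit solution. (iii) There are $\delta>0$ and $C$, depending only on $M$, such that for $0<\varepsilon<1$ every charge solution with data $\psi_{0,\varepsilon}(x)=\chi_{[-1,1]}(x)(\varepsilon+|x|)^{-1/2}(1,1)^{\mathsf T}$, $a_\mu=b_\mu=0$, satisfies, with $A_{-,\varepsilon}=A_0-A_1$, $$\frac{t+x}{4}\log\frac1\varepsilon-C\;\le\;-A_{-,\varepsilon}(t,x)\;\le\;C\Big(1+\log\frac1\varepsilon\Big)\qquad\text{for } t\in I,\ |x|<t<\delta .$$ -/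

import Mathlib

open MeasureTheory Filter Topology TopologicalSpace
open scoped Distributions LineDeriv SchwartzMap ContDiff ENNReal

namespace MaxwellDirac

noncomputable section

/-! ### The Maxwell–Dirac system on `ℝ^{1+1}`; points are `(t, x) : ℝ × ℝ` -/

/-- The space `ℂ²` of spinors, with its hermitian norm. -/
abbrev Spinor : Type := EuclideanSpace ℂ (Fin 2)

/-- The Dirac matrices `γ⁰`, `γ¹`. -/
def γ : Fin 2 → Matrix (Fin 2) (Fin 2) ℂ :=
  ![!![0, 1; 1, 0], !![0, -1; 1, 0]]

/-- The diagonal entries of the Minkowski metric `diag(1, -1)`. -/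
def g : Fin 2 → ℝ := ![1, -1]

/-- The coordinate directions: `e 0` is the direction of `t`, `e 1` that of `x`. -/
def e : Fin 2 → ℝ × ℝ := ![(1, 0), (0, 1)]

/-- The action of a `2 × 2` matrix on a spinor. -/
def act (B : Matrix (Fin 2) (Fin 2) ℂ) (v : Spinor) : Spinor :=
  WithLp.toLp 2 (B.mulVec v.ofLp)

/-- The current `ψ̄ γ_μ ψ = ψ^* γ⁰ γ_μ ψ`, with lowered index `γ_μ = g_{μμ} γ^μ`. (Each `γ⁰ γ^μ` is
hermitian, so that the quadratic form is real.) -/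
def current (μ : Fin 2) (v : Spinor) : ℝ :=
  g μ * (inner ℂ v (act (γ 0 * γ μ) v)).re

/-- The slab `I × ℝ` of space-time over a time interval `I`. -/
def slab (I : Opens ℝ) : Opens (ℝ × ℝ) where
  carrier := (I : Set ℝ) ×ˢ Set.univ
  is_open' := I.isOpen.prod isOpen_univ

/-- The Dirac equation `(-i γ^μ ∂_μ + M) ψ = A_μ γ^μ ψ`, in the sense of distributions on `I × ℝ`. -/
def SolvesDirac (M : ℝ) (I : Opens ℝ) (ψ : ℝ → Lp Spinor 2 (volume : Measure ℝ))
    (A : Fin 2 → ℝ → ℝ → ℝ) : Prop :=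
  ∀ θ : 𝓓(slab I, ℝ),
    ∫ t, ∫ x, (Complex.I • ∑ μ, (∂_{e μ} θ) (t, x) • act (γ μ) (ψ t x)
        + (M * θ (t, x)) • ψ t x)
      = ∫ t, ∫ x, ∑ μ, (θ (t, x) * A μ t x) • act (γ μ) (ψ t x)

/-- The wave equations `□ A_μ = - ψ̄ γ_μ ψ`, `□ = ∂_t² - ∂_x²`, in the sense of distributions
on `I × ℝ`. -/
def SolvesWave (I : Opens ℝ) (ψ : ℝ → Lp Spinor 2 (volume : Measure ℝ))
    (A : Fin 2 → ℝ → ℝ → ℝ) : Prop :=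
  ∀ (μ : Fin 2) (θ : 𝓓(slab I, ℝ)),
    ∫ t, ∫ x, ((∂_{e 0} (∂_{e 0} θ)) (t, x) - (∂_{e 1} (∂_{e 1} θ)) (t, x)) * A μ t x
      = - ∫ t, ∫ x, θ (t, x) * current μ (ψ t x)

/-- `(ψ, A)` is a charge (class) solution of the Maxwell–Dirac system with mass `M` on `I × ℝ`, where
`I` is an open interval containing `0`, and `∂_t A_μ(0) = b_μ`: the map `t ↦ ψ(t)` is continuous
into `L²` and conserves the charge, and the real potentials `A_μ` are continuous functions.
Nothing more is required of the potentials; in particular, solutions such that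
`(ψ, A_μ, ∂_t A_μ)` is continuous in time into `L² × Y × L¹`, where `Y` consists of the bounded
absolutely continuous functions with integrable derivative, are included. -/
structure IsChargeSolution (M : ℝ) (I : Opens ℝ) (ψ : ℝ → Lp Spinor 2 (volume : Measure ℝ))
    (A : Fin 2 → ℝ → ℝ → ℝ) (b : Fin 2 → 𝓓'((⊤ : Opens ℝ), ℝ)) : Prop where
  zero_mem : (0 : ℝ) ∈ I
  ordConnected : (I : Set ℝ).OrdConnected
  continuous_spinor : ContinuousOn ψ I
  charge : ∀ t ∈ I, ‖ψ t‖ = ‖ψ 0‖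
  continuous_potential : ∀ μ, ContinuousOn (fun z : ℝ × ℝ ↦ A μ z.1 z.2) (slab I)
  dirac : SolvesDirac M I ψ A
  wave : SolvesWave I ψ A
  velocity : ∀ (μ : Fin 2) (φ : 𝓓((⊤ : Opens ℝ), ℝ)),
    HasDerivAt (fun t ↦ ∫ x, φ x * A μ t x) (b μ φ) 0

/-! ### Cauchy data and local solutions that are limits of charge solutions -/

/-- Cauchy data `ψ(0) = ψ₀`, `A_μ(0) = a_μ`, `∂_t A_μ(0) = b_μ`, in the sense of distributions. -/
structure CauchyData where
  ψ₀ : 𝓓'((⊤ : Opens ℝ), Spinor)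
  a : Fin 2 → 𝓓'((⊤ : Opens ℝ), ℝ)
  b : Fin 2 → 𝓓'((⊤ : Opens ℝ), ℝ)

/-- The points `x` such that `(0, x) ∈ Ω`. -/
def initialSlice (Ω : Opens (ℝ × ℝ)) : Set ℝ := {x | ((0 : ℝ), x) ∈ Ω}

/-- The distribution `T` on `Ω` has the value `T₀` at `t = 0`: if `τ_η(t) = η⁻¹ τ(t / η)` is an
approximate identity in time, then `⟨T, τ_η ⊗ φ⟩ → ⟨T₀, φ⟩` as `η → 0+`. This holds whenever `T` is a
continuous function of time near `t = 0`, with values in distributions, that equals `T₀` at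
`t = 0`. -/
def HasInitialValue {F : Type} [NormedAddCommGroup F] [NormedSpace ℝ F] {Ω : Opens (ℝ × ℝ)}
    (T : 𝓓'(Ω, F)) (T₀ : 𝓓'((⊤ : Opens ℝ), F)) : Prop :=
  ∀ (φ τ : 𝓓((⊤ : Opens ℝ), ℝ)) (η : ℕ → ℝ) (θ : ℕ → 𝓓(Ω, ℝ)),
    tsupport φ ⊆ initialSlice Ω → ∫ t, τ t = 1 →
    (∀ n, 0 < η n) → Tendsto η atTop (𝓝 0) →
    (∀ n t x, θ n (t, x) = (η n)⁻¹ * τ (t / η n) * φ x) →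
    Tendsto (fun n ↦ T (θ n)) atTop (𝓝 (T₀ φ))

/-- The distributions `(Ψ, 𝒜)` on the open set `Ω` attain the Cauchy data `d` at `t = 0`. -/
def AttainsData (d : CauchyData) {Ω : Opens (ℝ × ℝ)} (Ψ : 𝓓'(Ω, Spinor))
    (𝒜 : Fin 2 → 𝓓'(Ω, ℝ)) : Prop :=
  HasInitialValue Ψ d.ψ₀ ∧ ∀ μ, HasInitialValue (𝒜 μ) (d.a μ) ∧
    HasInitialValue (∂_{e 0} (𝒜 μ)) (d.b μ)

/-- The initial data of the family of charge solutions `(ψ i, A i)`, with `∂_t A i (0) = b i`,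
converge to `d` in the sense of distributions on the initial slice of `Ω`. -/
def DataConverge {ι : Type} (l : Filter ι) (d : CauchyData) (Ω : Opens (ℝ × ℝ))
    (ψ : ι → ℝ → Lp Spinor 2 (volume : Measure ℝ)) (A : ι → Fin 2 → ℝ → ℝ → ℝ)
    (b : ι → Fin 2 → 𝓓'((⊤ : Opens ℝ), ℝ)) : Prop :=
  ∀ φ : 𝓓((⊤ : Opens ℝ), ℝ), tsupport φ ⊆ initialSlice Ω →
    Tendsto (fun i ↦ ∫ x, φ x • ψ i 0 x) l (𝓝 (d.ψ₀ φ)) ∧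
    ∀ μ, Tendsto (fun i ↦ ∫ x, φ x * A i μ 0 x) l (𝓝 (d.a μ φ)) ∧
      Tendsto (fun i ↦ b i μ φ) l (𝓝 (d.b μ φ))

/-- The charge solutions `(ψ i, A i)` converge to `(Ψ, 𝒜)` in the sense of distributions on `Ω`. -/
def ConvergesTo {ι : Type} (l : Filter ι) {Ω : Opens (ℝ × ℝ)}
    (ψ : ι → ℝ → Lp Spinor 2 (volume : Measure ℝ)) (A : ι → Fin 2 → ℝ → ℝ → ℝ)
    (Ψ : 𝓓'(Ω, Spinor)) (𝒜 : Fin 2 → 𝓓'(Ω, ℝ)) : Prop :=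
  ∀ θ : 𝓓(Ω, ℝ),
    Tendsto (fun i ↦ ∫ t, ∫ x, θ (t, x) • ψ i t x) l (𝓝 (Ψ θ)) ∧
    ∀ μ, Tendsto (fun i ↦ ∫ t, ∫ x, θ (t, x) * A i μ t x) l (𝓝 (𝒜 μ θ))

/-- `(Ψ, 𝒜)` is a solution on `Ω` of the Cauchy problem with data `d` which is a distributional limit
of charge solutions. The limit may be taken along any filter, so that sequences and families with a
parameter `ε → 0` are included. The initial condition may hold in either of two senses: the data of
the charge solutions converge to `d` as distributions, or the limit attains `d` at `t = 0`. -/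
def IsLimitSolution (M : ℝ) (d : CauchyData) (Ω : Opens (ℝ × ℝ)) (Ψ : 𝓓'(Ω, Spinor))
    (𝒜 : Fin 2 → 𝓓'(Ω, ℝ)) : Prop :=
  ∃ (ι : Type) (l : Filter ι) (I : ι → Opens ℝ)
    (ψ : ι → ℝ → Lp Spinor 2 (volume : Measure ℝ)) (A : ι → Fin 2 → ℝ → ℝ → ℝ)
    (b : ι → Fin 2 → 𝓓'((⊤ : Opens ℝ), ℝ)),
    l.NeBot ∧ (∀ i, IsChargeSolution M (I i) (ψ i) (A i) (b i)) ∧ (∀ i, Ω ≤ slab (I i)) ∧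
    ConvergesTo l ψ A Ψ 𝒜 ∧ (DataConverge l d Ω ψ A b ∨ AttainsData d Ψ 𝒜)

/-- The Cauchy problem with data `d` has a local solution near the origin of `ℝ^{1+1}` which is a
distributional limit of charge solutions. -/
def HasLocalLimitSolution (M : ℝ) (d : CauchyData) : Prop :=
  ∃ (Ω : Opens (ℝ × ℝ)) (Ψ : 𝓓'(Ω, Spinor)) (𝒜 : Fin 2 → 𝓓'(Ω, ℝ)),
    ((0 : ℝ), (0 : ℝ)) ∈ Ω ∧ IsLimitSolution M d Ω Ψ 𝒜

/-- Ill-posedness by non-existence in a space `X` of data: for some data in `X` there is no local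
solution, not even one that is a mere limit of charge solutions in the sense of distributions. (No
topology on `X` is involved; uniqueness and continuous dependence are not at issue.) -/
def IsIllPosed (M : ℝ) (X : Set CauchyData) : Prop :=
  ∃ d ∈ X, ¬ HasLocalLimitSolution M d

/-! ### Data spaces -/

/-- The distribution on `ℝ` given by a locally integrable function. -/
def regular (f : ℝ → Spinor) : 𝓓'((⊤ : Opens ℝ), Spinor) :=
  (TestFunction.integralAgainstBilinCLM (ContinuousLinearMap.lsmul ℝ ℝ) volume f :
    𝓓((⊤ : Opens ℝ), ℝ) →L[ℝ] Spinor)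

/-- A real test function on `ℝ`, as a complex Schwartz function. -/
def toSchwartz (φ : 𝓓((⊤ : Opens ℝ), ℝ)) : 𝓢(ℝ, ℂ) :=
  HasCompactSupport.toSchwartzMap (f := fun x ↦ (φ x : ℂ))
    (φ.hasCompactSupport.comp_left Complex.ofReal_zero)
    (Complex.ofRealCLM.contDiff.comp φ.contDiff)

/-- The Sobolev space `H^s(ℝ; ℂ²)`, as a set of distributions. -/
def Hs (s : ℝ) : Set 𝓓'((⊤ : Opens ℝ), Spinor) :=
  {T | ∃ f : 𝓢'(ℝ, Spinor), TemperedDistribution.MemSobolev s 2 f ∧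
    ∀ φ, T φ = f (toSchwartz φ)}

/-- The Lebesgue space `L^p(ℝ; ℂ²)`, `1 ≤ p ≤ ∞`, as a set of distributions. -/
def LpSpinor (p : ℝ≥0∞) : Set 𝓓'((⊤ : Opens ℝ), Spinor) :=
  {T | ∃ f : ℝ → Spinor, MemLp f p volume ∧ T = regular f}

/-- The data space `S × D₀ × D₁`: `ψ₀ ∈ S`, `a_μ ∈ D₀` and `b_μ ∈ D₁` for `μ = 0, 1`. -/
def dataSpace (S : Set 𝓓'((⊤ : Opens ℝ), Spinor)) (D₀ D₁ : Submodule ℝ 𝓓'((⊤ : Opens ℝ), ℝ)) :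
    Set CauchyData :=
  {d | d.ψ₀ ∈ S ∧ ∀ μ, d.a μ ∈ D₀ ∧ d.b μ ∈ D₁}

/-! ### The explicit data -/

/-- The spinor `χ_{[-1,1]}(x) (ε + |x|)^{-1/2} (1, 1)ᵀ`. -/
def spinorData (ε : ℝ) (x : ℝ) : Spinor :=
  (Set.Icc (-1 : ℝ) 1).indicator (fun x ↦ ((ε + |x|) ^ (-(1 / 2) : ℝ) : ℝ) • !₂[(1 : ℂ), 1]) x

/-- The data `ψ₀ = χ_{[-1,1]} |x|^{-1/2} (1, 1)ᵀ`, `a_μ = b_μ = 0`. -/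
def badData : CauchyData where
  ψ₀ := regular (spinorData 0)
  a := 0
  b := 0

end

end MaxwellDirac

namespace MaxwellDirac

noncomputable section

/-! ### The singular datum belongs to `L^p` for `p < 2` and to `H^s` for `s < 0` -/

/-! The wave equation for `A 0` is linear in the potential and has the charge density `‖ψ‖ ^ 2` as
its source. So if `A 0` converges merely as a distribution, the charge densities of the
approximating solutions, tested against a fixed nonnegative function, converge and are eventually
bounded (`IsChargeSolution.integral_norm_sq_eq`).

This space-time bound becomes a bound at each time because the two components of the spinor travel
with velocities `1` and `-1`. Real potentials only rotate their phases; only the mass exchanges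
charge between them. The energy of one component in a window moving with it therefore changes by at
most `|M|` times the space-time charge (`IsChargeSolution.abs_energy_sub_le`), and averaging in time
gives `IsChargeSolution.local_charge_le`. By Cauchy–Schwarz, the spinors at all small times are
uniformly bounded as `L²` functionals near the origin. The bound survives the limit in either sense
of the initial condition (`HasLocalLimitSolution.exists_norm_sq_le`): limit solutions have initial
spinors that are square integrable near the origin.

The function `|x|^{-1/2}` is not, although it is in `L^p` for `p < 2`, and its `L¹` modulus of
continuity `√h` makes its Fourier transform decay like `|ξ|^{-1/2}`, which places it in `H^s` for `s
< 0`. The potentials of the datum are zero and hence lie in every subspace.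

For the logarithmic bounds, the source of `A 0 - A 1` involves only the right-moving component. By
d'Alembert's formula with zero data, `-(A 0 - A 1)` at `(t, x)` is the integral of that component's
density over the backward cone; `IsChargeSolution.integral_deriv_mul_eq` is the mollified version,
as the potentials are only continuous. The conserved charge, `4 log (1 + 1/ε)`, bounds this above.
For the lower bound, the energy concentrated at the origin moves along the ray `x = t`, which stays
in the cone up to time `(t + x) / 2`, and for small `t` the mass term can remove only a fraction of
it. -/

/-- The function `χ_{(0,1]} x^{-1/2}`. -/
def halfSingularity (x : ℝ) : ℝ := (Set.Ioc (0 : ℝ) 1).indicator (fun x ↦ x ^ (-(1 / 2) : ℝ)) x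

theorem halfSingularity_nonneg (x : ℝ) : 0 ≤ halfSingularity x :=
  Set.indicator_nonneg (fun _ hx ↦ Real.rpow_nonneg hx.1.le _) x

/-- Splitting at the singularity leaves pieces that are monotone on a half-line, which is what makes
translation differences computable. -/
theorem spinorData_zero_eq (x : ℝ) :
    spinorData 0 x = (halfSingularity x + halfSingularity (-x)) • !₂[(1 : ℂ), 1] := by
  unfold spinorData halfSingularity
  rcases lt_trichotomy x 0 with h | h | h
  · have h1 : x ∉ Set.Ioc (0 : ℝ) 1 := fun h' ↦ absurd h'.1 (by linarith)
    rw [Set.indicator_of_notMem h1, zero_add]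
    by_cases h2 : -1 ≤ x
    · rw [Set.indicator_of_mem (show x ∈ Set.Icc (-1 : ℝ) 1 from ⟨h2, by linarith⟩),
        Set.indicator_of_mem (show -x ∈ Set.Ioc (0 : ℝ) 1 from ⟨by linarith, by linarith⟩),
        abs_of_neg h, zero_add]
    · rw [Set.indicator_of_notMem (fun h' : x ∈ Set.Icc (-1 : ℝ) 1 ↦ h2 h'.1),
        Set.indicator_of_notMem (fun h' : -x ∈ Set.Ioc (0 : ℝ) 1 ↦ h2 (by linarith [h'.2])),
        zero_smul]
  · subst h
    -- At the origin both sides vanish, because `0 ^ (-(1/2))` has the default value `0`.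
    rw [Set.indicator_of_mem (by simp)]
    simp [Real.zero_rpow]
  · have h1 : -x ∉ Set.Ioc (0 : ℝ) 1 := fun h' ↦ absurd h'.1 (by linarith)
    rw [Set.indicator_of_notMem h1, add_zero]
    by_cases h2 : x ≤ 1
    · rw [Set.indicator_of_mem (show x ∈ Set.Icc (-1 : ℝ) 1 from ⟨by linarith, h2⟩),
        Set.indicator_of_mem (show x ∈ Set.Ioc (0 : ℝ) 1 from ⟨h, h2⟩), abs_of_pos h, zero_add]
    · rw [Set.indicator_of_notMem (fun h' : x ∈ Set.Icc (-1 : ℝ) 1 ↦ h2 h'.2),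
        Set.indicator_of_notMem (fun h' : x ∈ Set.Ioc (0 : ℝ) 1 ↦ h2 h'.2), zero_smul]

theorem memLp_halfSingularity {p : ℝ≥0∞} (hp : 1 ≤ p) (hp' : p < 2) :
    MemLp halfSingularity p volume := by
  have h0 : p ≠ 0 := (one_pos.trans_le hp).ne'
  have htop : p ≠ ⊤ := (hp'.trans (by norm_num)).ne
  have hlt : p.toReal < 2 := by
    simpa using (ENNReal.toReal_lt_toReal htop (by norm_num)).2 hp'
  have : MemLp (fun x : ℝ ↦ x ^ (-(1 / 2) : ℝ)) p (volume.restrict (Set.Ioc 0 1)) := by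
    rw [← integrable_norm_rpow_iff (Measurable.pow_const measurable_id' _).aestronglyMeasurable
      h0 htop]
    have h1 : IntegrableOn (fun x : ℝ ↦ x ^ (-(1 / 2) * p.toReal)) (Set.Ioc 0 1) :=
      (intervalIntegrable_iff_integrableOn_Ioc_of_le zero_le_one).1
        (intervalIntegral.intervalIntegrable_rpow' (by linarith))
    refine (integrableOn_congr_fun (fun x hx ↦ ?_) measurableSet_Ioc).1 h1
    rw [Real.norm_of_nonneg (Real.rpow_nonneg hx.1.le _), Real.rpow_mul hx.1.le]
  exact (memLp_indicator_iff_restrict measurableSet_Ioc).2 this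

theorem integrable_halfSingularity : Integrable halfSingularity :=
  memLp_one_iff_integrable.1 (memLp_halfSingularity le_rfl (by norm_num))

theorem memLp_spinorData_zero {p : ℝ≥0∞} (hp : 1 ≤ p) (hp' : p < 2) :
    MemLp (spinorData 0) p volume := by
  have h := memLp_halfSingularity hp hp'
  have h' : MemLp (fun x ↦ halfSingularity (-x)) p volume :=
    h.comp_measurePreserving (Measure.measurePreserving_neg volume)
  have : MemLp (fun x ↦ (halfSingularity x + halfSingularity (-x)) • !₂[(1 : ℂ), 1]) p volume :=
    (ContinuousLinearMap.toSpanSingleton ℝ (!₂[(1 : ℂ), 1] : Spinor)).comp_memLp' (h.add h')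
  exact this.congr_norm (by
    rw [funext spinorData_zero_eq]; exact this.1) (ae_of_all _ fun x ↦ by rw [spinorData_zero_eq])

theorem integrable_spinorData_zero : Integrable (spinorData 0) :=
  memLp_one_iff_integrable.1 (memLp_spinorData_zero le_rfl (by norm_num))

/-- The function decreases on `(0, ∞)`, so the difference is nonnegative except where `x ≤ 0`, and
there only the values with `x + h` in `(0, h]` matter. The signed difference integrates to zero by
translation invariance; what remains is twice the mass of `(0, h]`, namely `2 * (2 * √h)`. -/
theorem integral_abs_halfSingularity_sub_le {h : ℝ} (hh : 0 < h) :
    ∫ x, |halfSingularity x - halfSingularity (x + h)| ≤ 4 * √h := by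
  have hk := integrable_halfSingularity
  have hk' : Integrable (fun x ↦ halfSingularity (x + h)) := hk.comp_add_right h
  set m : ℝ → ℝ := (Set.Ioc 0 h).indicator halfSingularity with hm
  have hmi : Integrable m := hk.indicator measurableSet_Ioc
  have key : ∀ x, |halfSingularity x - halfSingularity (x + h)|
      ≤ halfSingularity x - halfSingularity (x + h) + 2 * m (x + h) := by
    intro x
    have h0 := halfSingularity_nonneg x
    have h1 := halfSingularity_nonneg (x + h)
    rcases le_or_gt x 0 with hx | hx
    · have hx0 : halfSingularity x = 0 :=
        Set.indicator_of_notMem (fun h' ↦ absurd h'.1 (by linarith)) _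
      have : m (x + h) = halfSingularity (x + h) := by
        by_cases hxh : 0 < x + h
        · exact Set.indicator_of_mem (s := Set.Ioc 0 h) ⟨hxh, by linarith⟩ _
        · have h2 : halfSingularity (x + h) = 0 :=
            Set.indicator_of_notMem (fun h' ↦ absurd h'.1 (by linarith)) _
          rw [h2]
          exact Set.indicator_of_notMem (fun h' ↦ absurd h'.1 (by linarith)) _
      rw [this, hx0, zero_sub, abs_neg, abs_of_nonneg h1]
      linarith
    · have h2 : m (x + h) = 0 := Set.indicator_of_notMem (fun h' ↦ absurd h'.2 (by linarith)) _
      have h3 : halfSingularity (x + h) ≤ halfSingularity x := by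
        by_cases hxh : x + h ≤ 1
        · unfold halfSingularity
          rw [Set.indicator_of_mem (show x + h ∈ Set.Ioc (0 : ℝ) 1 from ⟨by linarith, hxh⟩),
            Set.indicator_of_mem (show x ∈ Set.Ioc (0 : ℝ) 1 from ⟨hx, by linarith⟩)]
          exact Real.rpow_le_rpow_of_nonpos hx (by linarith) (by norm_num)
        · have : halfSingularity (x + h) = 0 :=
            Set.indicator_of_notMem (fun h' ↦ absurd h'.2 (by linarith)) _
          rw [this]; exact h0
      rw [h2, abs_of_nonneg (by linarith)]
      linarith
  have hm' : Integrable (fun x ↦ m (x + h)) := hmi.comp_add_right h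
  calc ∫ x, |halfSingularity x - halfSingularity (x + h)|
      ≤ ∫ x, (halfSingularity x - halfSingularity (x + h) + 2 * m (x + h)) :=
        integral_mono (hk.sub hk').abs ((hk.sub hk').add (hm'.const_mul 2)) key
    _ = 2 * ∫ x, m x := by
        rw [integral_add (f := fun x ↦ halfSingularity x - halfSingularity (x + h)) (hk.sub hk')
            (hm'.const_mul 2), integral_sub hk hk',
          integral_add_right_eq_self halfSingularity h, sub_self, zero_add, integral_const_mul,
          integral_add_right_eq_self m h]
    _ ≤ 2 * ∫ x in (0 : ℝ)..h, x ^ (-(1 / 2) : ℝ) := by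
        gcongr
        rw [hm, integral_indicator measurableSet_Ioc, intervalIntegral.integral_of_le hh.le]
        refine setIntegral_mono_on hk.integrableOn ?_ measurableSet_Ioc fun x hx ↦ ?_
        · exact (intervalIntegrable_iff_integrableOn_Ioc_of_le hh.le).1
            (intervalIntegral.intervalIntegrable_rpow' (by norm_num))
        · exact Set.indicator_le_self' (fun _ _ ↦ Real.rpow_nonneg hx.1.le _) x
    _ = 4 * √h := by
        rw [integral_rpow (Or.inl (by norm_num)), Real.sqrt_eq_rpow]
        norm_num
        ring

theorem integral_norm_spinorData_zero_sub_le (h : ℝ) :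
    ∫ x, ‖spinorData 0 x - spinorData 0 (x + h)‖ ≤ 8 * √|h| * ‖(!₂[(1 : ℂ), 1] : Spinor)‖ := by
  have hk := integrable_halfSingularity
  have hk' (a : ℝ) : Integrable (fun x ↦ halfSingularity (x + a)) := hk.comp_add_right a
  have hi (a : ℝ) : Integrable (fun x ↦ |halfSingularity x - halfSingularity (x + a)|) :=
    (hk.sub (hk' a)).abs
  have hj (a : ℝ) : Integrable (fun x ↦ |halfSingularity (-x) - halfSingularity (-x + a)|) :=
    (hi a).comp_neg
  have hshift : ∀ a : ℝ, ∫ x, |halfSingularity x - halfSingularity (x + a)| ≤ 4 * √|a| := by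
    intro a
    rcases lt_trichotomy a 0 with ha | ha | ha
    · rw [← integral_add_right_eq_self _ (-a), abs_of_neg ha]
      refine le_of_eq_of_le (integral_congr_ae (ae_of_all _ fun x ↦ ?_))
        (integral_abs_halfSingularity_sub_le (neg_pos.2 ha))
      simp only
      rw [abs_sub_comm, neg_add_cancel_right]
    · simp [ha]
    · rw [abs_of_pos ha]
      exact integral_abs_halfSingularity_sub_le ha
  have key : ∀ x, ‖spinorData 0 x - spinorData 0 (x + h)‖
      ≤ (|halfSingularity x - halfSingularity (x + h)|
        + |halfSingularity (-x) - halfSingularity (-x + -h)|) * ‖(!₂[(1 : ℂ), 1] : Spinor)‖ := by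
    intro x
    rw [spinorData_zero_eq, spinorData_zero_eq, ← sub_smul, norm_smul, Real.norm_eq_abs, neg_add]
    gcongr
    exact (congrArg _ (by ring)).trans_le (abs_add_le _ _)
  calc _ ≤ ∫ x, (|halfSingularity x - halfSingularity (x + h)|
        + |halfSingularity (-x) - halfSingularity (-x + -h)|) * ‖(!₂[(1 : ℂ), 1] : Spinor)‖ :=
        integral_mono (integrable_spinorData_zero.sub
          (integrable_spinorData_zero.comp_add_right h)).norm
          (((hi h).add (hj (-h))).mul_const _) key
    _ ≤ (4 * √|h| + 4 * √|h|) * ‖(!₂[(1 : ℂ), 1] : Spinor)‖ := by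
        rw [integral_mul_const, integral_add (hi h) (hj (-h)),
          integral_neg_eq_self (fun x ↦ |halfSingularity x - halfSingularity (x + -h)|)]
        gcongr
        · exact hshift h
        · simpa using hshift (-h)
    _ = _ := by ring

/-! ### Fourier decay of the singular datum -/

theorem one_le_two_mul_rpow {r : ℝ} (h0 : 0 ≤ r) (h1 : r ≤ 1) :
    1 ≤ 2 * (1 + r ^ 2) ^ (-(1 / 4) : ℝ) := by
  have h2 : (2 : ℝ) ^ (-(1 / 4) : ℝ) ≤ (1 + r ^ 2) ^ (-(1 / 4) : ℝ) :=
    Real.rpow_le_rpow_of_nonpos (by positivity) (by nlinarith) (by norm_num)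
  have h3 : (2 : ℝ) ^ (-1 : ℝ) ≤ (2 : ℝ) ^ (-(1 / 4) : ℝ) :=
    Real.rpow_le_rpow_of_exponent_le (by norm_num) (by norm_num)
  rw [Real.rpow_neg_one] at h3
  linarith

theorem sqrt_one_div_le_two_mul_rpow {r : ℝ} (h1 : 1 < r) :
    √(1 / (2 * r)) ≤ 2 * (1 + r ^ 2) ^ (-(1 / 4) : ℝ) := by
  have h0 : 0 < r := by linarith
  have h4 : ((2 * r) ^ 2) ^ (-(1 / 4) : ℝ) ≤ (1 + r ^ 2) ^ (-(1 / 4) : ℝ) :=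
    Real.rpow_le_rpow_of_nonpos (by positivity) (by nlinarith) (by norm_num)
  have h5 : ((2 * r) ^ 2) ^ (-(1 / 4) : ℝ) = √(1 / (2 * r)) := by
    rw [one_div (2 * r), Real.sqrt_inv, Real.sqrt_eq_rpow, ← Real.rpow_neg (by positivity),
      ← Real.rpow_natCast, ← Real.rpow_mul (by positivity)]
    norm_num
  have : (0 : ℝ) ≤ (1 + r ^ 2) ^ (-(1 / 4) : ℝ) := by positivity
  linarith

-- Translation by half a period of the character reverses its sign, so the transform is half the
-- integral of the character against `f - f (· + h)` with `|h| = 1 / (2 |ξ|)`. The `L¹` modulus of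
-- continuity then gives the decay `|ξ|^{-1/2}`; for `|ξ| ≤ 1` the `L¹` norm suffices.
open FourierTransform in
theorem norm_fourier_spinorData_zero_le (ξ : ℝ) :
    ‖𝓕 (spinorData 0) ξ‖ ≤ (2 * ((∫ x, ‖spinorData 0 x‖) + 4 * ‖(!₂[(1 : ℂ), 1] : Spinor)‖))
      * (1 + ‖ξ‖ ^ 2) ^ (-(1 / 4) : ℝ) := by
  set n : ℝ := ‖(!₂[(1 : ℂ), 1] : Spinor)‖
  set N : ℝ := ∫ x, ‖spinorData 0 x‖
  have hN : 0 ≤ N := integral_nonneg fun _ ↦ norm_nonneg _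
  have hn : 0 ≤ n := norm_nonneg _
  have hpos : (0 : ℝ) < (1 + ‖ξ‖ ^ 2) ^ (-(1 / 4) : ℝ) := by positivity
  rcases le_or_gt ‖ξ‖ 1 with hξ | hξ
  · have h1 : ‖𝓕 (spinorData 0) ξ‖ ≤ N := by
      rw [Real.fourier_eq]
      refine (norm_integral_le_integral_norm _).trans_eq ?_
      simp only [Circle.norm_smul, N]
    have h2 := mul_le_mul_of_nonneg_left (one_le_two_mul_rpow (norm_nonneg ξ) hξ) hN
    have h3 := mul_nonneg hn hpos.le
    linarith
  · have hξ0 : ξ ≠ 0 := by rintro rfl; simp at hξ; linarith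
    have h1 : ‖𝓕 (spinorData 0) ξ‖ ≤ 1 / 2 * (8 * √|1 / (2 * ‖ξ‖ ^ 2) * ξ| * n) := by
      rw [Real.fourier_eq,
        fourierIntegral_eq_half_sub_half_period_translate hξ0 integrable_spinorData_zero, norm_smul]
      have h12 : ‖(1 / 2 : ℂ)‖ = 1 / 2 := by simp
      rw [h12]
      refine mul_le_mul_of_nonneg_left ((norm_integral_le_integral_norm _).trans ?_) (by norm_num)
      simp only [Circle.norm_smul]
      exact integral_norm_spinorData_zero_sub_le _
    have h2 : |1 / (2 * ‖ξ‖ ^ 2) * ξ| = 1 / (2 * ‖ξ‖) := by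
      rw [abs_mul, abs_of_nonneg (by positivity : (0 : ℝ) ≤ 1 / (2 * ‖ξ‖ ^ 2)), ← Real.norm_eq_abs]
      have : ‖ξ‖ ≠ 0 := by positivity
      field_simp
    rw [h2] at h1
    have h3 := mul_le_mul_of_nonneg_right (sqrt_one_div_le_two_mul_rpow hξ) hn
    have h4 := mul_nonneg hN hpos.le
    linarith

/-! ### Membership of the datum in the spaces of distributions -/

theorem regular_apply {f : ℝ → Spinor} (hf : LocallyIntegrable f) (φ : 𝓓((⊤ : Opens ℝ), ℝ)) :
    regular f φ = ∫ x, φ x • f x :=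
  TestFunction.integralAgainstBilinCLM_eq_integral (hf.locallyIntegrableOn _)

theorem badData_mem_LpSpinor {p : ℝ≥0∞} (hp : 1 ≤ p) (hp' : p < 2) :
    badData.ψ₀ ∈ LpSpinor p :=
  ⟨spinorData 0, memLp_spinorData_zero hp hp', rfl⟩

open FourierTransform in
theorem badData_mem_Hs {s : ℝ} (hs : s < 0) : badData.ψ₀ ∈ Hs s := by
  have hint := integrable_spinorData_zero
  have hL1 : MemLp (spinorData 0) 1 volume := memLp_one_iff_integrable.2 hint
  refine ⟨Lp.toTemperedDistribution hL1.toLp, ?_, fun φ ↦ ?_⟩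
  · rw [TemperedDistribution.memSobolev_iff_exists_smulLeftCLM_fourier]
    set m : ℝ → ℂ := fun x ↦ ((1 + ‖x‖ ^ 2) ^ (s / 2) : ℝ) with hm
    have hmg : m.HasTemperateGrowth := by fun_prop
    have hcont : Continuous (𝓕 (spinorData 0)) :=
      VectorFourier.fourierIntegral_continuous Real.continuous_fourierChar
        continuous_inner hint
    set K : ℝ := 2 * ((∫ x, ‖spinorData 0 x‖) + 4 * ‖(!₂[(1 : ℂ), 1] : Spinor)‖)
    have hmem : MemLp (fun ξ ↦ m ξ • 𝓕 (spinorData 0) ξ) 2 volume := by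
      have hc : Continuous (fun ξ ↦ m ξ • 𝓕 (spinorData 0) ξ) := hmg.1.continuous.smul hcont
      rw [memLp_two_iff_integrable_sq_norm hc.aestronglyMeasurable]
      -- The square of the weight `(1 + ξ²)^(s/2)` times the decay `(1 + ξ²)^(-1/4)` is of order
      -- `|ξ|^(2s - 1)` at infinity, integrable on the line exactly because `s < 0`.
      have hdom : Integrable (fun ξ : ℝ ↦ K ^ 2 * (1 + ‖ξ‖ ^ 2) ^ (-(1 - 2 * s) / 2)) :=
        (integrable_rpow_neg_one_add_norm_sq (by simp; linarith)).const_mul _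
      refine hdom.mono' (hc.norm.pow 2).aestronglyMeasurable (ae_of_all _ fun ξ ↦ ?_)
      have hp : (0 : ℝ) < 1 + ‖ξ‖ ^ 2 := by positivity
      rw [Real.norm_of_nonneg (by positivity), norm_smul]
      have h1 : ‖m ξ‖ = (1 + ‖ξ‖ ^ 2) ^ (s / 2) := by
        rw [hm, Complex.norm_real, Real.norm_of_nonneg (by positivity)]
      have h2 : (1 + ‖ξ‖ ^ 2) ^ (-(1 - 2 * s) / 2)
          = ((1 + ‖ξ‖ ^ 2) ^ (s / 2) * (1 + ‖ξ‖ ^ 2) ^ (-(1 / 4) : ℝ)) ^ 2 := by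
        rw [← Real.rpow_add hp, ← Real.rpow_mul_natCast hp.le]
        congr 1; push_cast; ring
      rw [h1, h2, ← mul_pow]
      refine pow_le_pow_left₀ (by positivity) ?_ 2
      calc _ ≤ (1 + ‖ξ‖ ^ 2) ^ (s / 2) * (K * (1 + ‖ξ‖ ^ 2) ^ (-(1 / 4) : ℝ)) := by
            gcongr; exact norm_fourier_spinorData_zero_le ξ
        _ = _ := by ring
    refine ⟨hmem.toLp, ?_⟩
    ext1 φ
    rw [TemperedDistribution.smulLeftCLM_apply_apply, TemperedDistribution.fourier_apply,
      Lp.toTemperedDistribution_apply, Lp.toTemperedDistribution_apply]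
    have e1 : ∫ x, 𝓕 (SchwartzMap.smulLeftCLM ℂ m φ) x • (hL1.toLp : ℝ → Spinor) x
        = ∫ x, 𝓕 (SchwartzMap.smulLeftCLM ℂ m φ : ℝ → ℂ) x • spinorData 0 x := by
      refine integral_congr_ae ?_
      filter_upwards [hL1.coeFn_toLp] with x hx
      rw [hx, SchwartzMap.fourier_coe]
    have e2 : ∫ x, φ x • (hmem.toLp : ℝ → Spinor) x
        = ∫ x, SchwartzMap.smulLeftCLM ℂ m φ x • 𝓕 (spinorData 0) x := by
      refine integral_congr_ae ?_
      filter_upwards [hmem.coeFn_toLp] with x hx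
      rw [hx, SchwartzMap.smulLeftCLM_apply_apply hmg, smul_smul, smul_eq_mul, mul_comm]
    rw [e1, e2]
    simpa using! (VectorFourier.integral_fourierIntegral_smul_eq_flip (L := innerₗ ℝ)
      Real.continuous_fourierChar continuous_inner
      (SchwartzMap.smulLeftCLM ℂ m φ).integrable hint)
  · rw [Lp.toTemperedDistribution_apply]
    change regular (spinorData 0) φ = _
    rw [regular_apply hint.locallyIntegrable]
    refine integral_congr_ae ?_
    filter_upwards [hL1.coeFn_toLp] with x hx
    rw [hx]
    exact (Complex.coe_smul (φ x) _).symm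

end

end MaxwellDirac

namespace MaxwellDirac

noncomputable section

/-! ### Weak derivatives of continuous functions of one variable -/

variable {E : Type*} [NormedAddCommGroup E] [NormedSpace ℝ E]

/-- `η` is a smooth function with compact support in `U`. -/
structure IsTest (U : Set ℝ) (η : ℝ → ℝ) : Prop where
  contDiff : ContDiff ℝ ∞ η
  hasCompactSupport : HasCompactSupport η
  tsupport_subset : tsupport η ⊆ U

namespace IsTest

variable {U : Set ℝ} {η ζ : ℝ → ℝ}

protected theorem deriv (h : IsTest U η) : IsTest U (deriv η) :=
  ⟨(contDiff_infty_iff_deriv.1 h.contDiff).2, h.hasCompactSupport.deriv,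
    (tsupport_deriv_subset).trans h.tsupport_subset⟩

protected theorem sub (h : IsTest U η) (h' : IsTest U ζ) : IsTest U (η - ζ) :=
  ⟨h.contDiff.sub h'.contDiff, h.hasCompactSupport.sub h'.hasCompactSupport,
    (tsupport_sub η ζ).trans (Set.union_subset h.tsupport_subset h'.tsupport_subset)⟩

theorem const_smul (h : IsTest U η) (c : ℝ) : IsTest U (c • η) :=
  ⟨h.contDiff.const_smul c, h.hasCompactSupport.smul_left (f := fun _ ↦ c),
    (tsupport_smul_subset_right (fun _ ↦ c) η).trans h.tsupport_subset⟩

theorem eq_zero (h : IsTest U η) {t : ℝ} (ht : t ∉ U) : η t = 0 :=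
  image_eq_zero_of_notMem_tsupport fun h' ↦ ht (h.tsupport_subset h')

theorem integrable (h : IsTest U η) : Integrable η :=
  h.contDiff.continuous.integrable_of_hasCompactSupport h.hasCompactSupport

protected theorem hasDerivAt (h : IsTest U η) (t : ℝ) : HasDerivAt η (_root_.deriv η t) t :=
  ((h.contDiff.differentiable (by simp)) t).hasDerivAt

/-- A test function times a function continuous on `U` is continuous. -/
theorem continuous_smul (h : IsTest U η) (hU : IsOpen U) {f : ℝ → E} (hf : ContinuousOn f U) :
    Continuous fun t ↦ η t • f t :=
  (h.contDiff.continuous.continuousOn.smul hf).continuous_of_tsupport_subset hU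
    ((tsupport_smul_subset_left η f).trans h.tsupport_subset)

theorem integrable_smul (h : IsTest U η) (hU : IsOpen U) {f : ℝ → E} (hf : ContinuousOn f U) :
    Integrable fun t ↦ η t • f t :=
  (h.continuous_smul hU hf).integrable_of_hasCompactSupport
    (h.hasCompactSupport.smul_right (f' := f))

theorem integrable_const_smul_smul (h : IsTest U η) (hU : IsOpen U) {f : ℝ → E}
    (hf : ContinuousOn f U) (c : ℝ) : Integrable fun t ↦ c • η t • f t :=
  (h.integrable_smul hU hf).smul c

end IsTest

theorem exists_Icc_subset_of_isCompact {U K : Set ℝ} (hU : IsOpen U) (hc : U.OrdConnected)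
    (hne : U.Nonempty) (hK : IsCompact K) (hKU : K ⊆ U) :
    ∃ a b, a < b ∧ Set.Icc a b ⊆ U ∧ K ⊆ Set.Ioo a b := by
  obtain ⟨c, hcU⟩ := hne
  -- The extra point keeps the infimum and supremum meaningful when `K` is empty.
  set K' := insert c K
  have hK' : IsCompact K' := hK.insert c
  have hK'U : K' ⊆ U := Set.insert_subset hcU hKU
  have hne' : K'.Nonempty := ⟨c, Set.mem_insert c K⟩
  obtain ⟨a, haU, ha⟩ : ∃ a ∈ U, a < sInf K' := by
    have := (hU.mem_nhds (hK'U (hK'.sInf_mem hne')))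
    obtain ⟨ε, hε, hball⟩ := Metric.mem_nhds_iff.1 this
    exact ⟨sInf K' - ε / 2, hball (by
      rw [Metric.mem_ball, Real.dist_eq, sub_sub_cancel_left, abs_neg, abs_of_pos (by linarith)]
      linarith), by linarith⟩
  obtain ⟨b, hbU, hb⟩ : ∃ b ∈ U, sSup K' < b := by
    have := (hU.mem_nhds (hK'U (hK'.sSup_mem hne')))
    obtain ⟨ε, hε, hball⟩ := Metric.mem_nhds_iff.1 this
    exact ⟨sSup K' + ε / 2, hball (by
      rw [Metric.mem_ball, Real.dist_eq, add_sub_cancel_left, abs_of_pos (by linarith)]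
      linarith), by linarith⟩
  have hsub : K' ⊆ Set.Ioo a b := fun x hx ↦
    ⟨ha.trans_le (csInf_le hK'.bddBelow hx), (le_csSup hK'.bddAbove hx).trans_lt hb⟩
  have hcab := hsub (Set.mem_insert c K)
  exact ⟨a, b, hcab.1.trans hcab.2, hc.out haU hbU, (Set.subset_insert c K).trans hsub⟩

variable {U : Set ℝ}

/-- The primitive starting to the left of the support vanishes again to its right because the total
integral is zero; connectedness of `U` keeps the interval between inside `U`. -/
theorem IsTest.exists_deriv_eq (hU : IsOpen U) (hc : U.OrdConnected) (hne : U.Nonempty)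
    {ζ : ℝ → ℝ} (hζ : IsTest U ζ) (h0 : ∫ t, ζ t = 0) :
    ∃ η, IsTest U η ∧ deriv η = ζ := by
  obtain ⟨a, b, hab, hsub, hK⟩ :=
    exists_Icc_subset_of_isCompact hU hc hne hζ.hasCompactSupport hζ.tsupport_subset
  have hz : ∀ t, t ∉ Set.Ioo a b → ζ t = 0 := fun t ht ↦
    image_eq_zero_of_notMem_tsupport fun h ↦ ht (hK h)
  set η : ℝ → ℝ := fun t ↦ ∫ s in a..t, ζ s
  have hd : ∀ t, HasDerivAt η (ζ t) t := fun t ↦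
    intervalIntegral.integral_hasDerivAt_right (hζ.contDiff.continuous.intervalIntegrable _ _)
      hζ.contDiff.continuous.stronglyMeasurable.stronglyMeasurableAtFilter
      hζ.contDiff.continuous.continuousAt
  have hde : deriv η = ζ := funext fun t ↦ (hd t).deriv
  have hη0 : ∀ t, t ∉ Set.Icc a b → η t = 0 := by
    intro t ht
    rcases lt_or_ge t a with h | h
    · have : ∀ s ∈ Set.uIcc a t, ζ s = 0 := fun s hs ↦ by
        rw [Set.uIcc_of_ge h.le] at hs
        exact hz s fun h' ↦ absurd h'.1 (by linarith [hs.2])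
      rw [show η t = ∫ s in a..t, ζ s from rfl,
        intervalIntegral.integral_congr (g := fun _ ↦ (0 : ℝ)) this]
      simp
    · have hbt : b < t := by
        by_contra! h'
        exact ht ⟨h, h'⟩
      rw [← h0]
      refine intervalIntegral.integral_eq_integral_of_support_subset fun s hs ↦ ?_
      have : s ∈ Set.Ioo a b := by
        by_contra h'
        exact hs (hz s h')
      exact ⟨this.1, this.2.le.trans hbt.le⟩
  have hts : tsupport η ⊆ Set.Icc a b :=
    closure_minimal (fun t ht ↦ by
      by_contra h
      exact ht (hη0 t h)) isClosed_Icc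
  refine ⟨η, ⟨?_, ?_, hts.trans hsub⟩, hde⟩
  · rw [contDiff_infty_iff_deriv, hde]
    exact ⟨fun t ↦ (hd t).differentiableAt, hζ.contDiff⟩
  · exact HasCompactSupport.of_support_subset_isCompact isCompact_Icc
      ((subset_tsupport η).trans hts)

theorem exists_isTest_integral_eq_one (hU : IsOpen U) (hne : U.Nonempty) :
    ∃ φ, IsTest U φ ∧ (∀ t, 0 ≤ φ t) ∧ ∫ t, φ t = 1 := by
  obtain ⟨c, hcU⟩ := hne
  obtain ⟨ε, hε, hball⟩ := Metric.isOpen_iff.1 hU c hcU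
  let f : ContDiffBump c := ⟨ε / 4, ε / 2, by positivity, by linarith⟩
  refine ⟨f.normed volume, ⟨f.contDiff_normed, f.hasCompactSupport_normed, ?_⟩,
    f.nonneg_normed, f.integral_normed⟩
  rw [f.tsupport_normed_eq]
  exact (Metric.closedBall_subset_ball (by simp only [f]; linarith)).trans hball

theorem integral_deriv_smul_eq_neg (hU : IsOpen U) (hc : U.OrdConnected) (hne : U.Nonempty)
    [CompleteSpace E] {G g : ℝ → E} (hg : ContinuousOn g U)
    (hG : ∀ t ∈ U, HasDerivAt G (g t) t) {η : ℝ → ℝ} (hη : IsTest U η) :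
    ∫ t, deriv η t • G t = -∫ t, η t • g t := by
  obtain ⟨a, b, hab, hsub, hK⟩ :=
    exists_Icc_subset_of_isCompact hU hc hne hη.hasCompactSupport hη.tsupport_subset
  have hz : ∀ t, t ∉ Set.Ioo a b → η t = 0 := fun t ht ↦
    image_eq_zero_of_notMem_tsupport fun h ↦ ht (hK h)
  have hz' : ∀ t, t ∉ Set.Ioo a b → deriv η t = 0 := fun t ht ↦
    image_eq_zero_of_notMem_tsupport fun h ↦ ht (hK (tsupport_deriv_subset h))
  have hs : ∀ (ζ : ℝ → ℝ) (f : ℝ → E), (∀ t, t ∉ Set.Ioo a b → ζ t = 0) →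
      ∫ t in a..b, ζ t • f t = ∫ t, ζ t • f t := fun ζ f hζ ↦ by
    refine intervalIntegral.integral_eq_integral_of_support_subset fun s hs ↦ ?_
    have : s ∈ Set.Ioo a b := by
      by_contra h'
      exact hs (by simp [hζ s h'])
    exact ⟨this.1, this.2.le⟩
  have h := intervalIntegral.integral_smul_deriv_eq_deriv_smul (a := a) (b := b) (u := η)
    (v := G) (u' := deriv η) (v' := g) (fun t _ ↦ hη.hasDerivAt t)
    (fun t ht ↦ hG t (hsub (by rwa [Set.uIcc_of_le hab.le] at ht)))
    (hη.deriv.contDiff.continuous.intervalIntegrable _ _)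
    ((hg.mono hsub).intervalIntegrable_of_Icc hab.le)
  rw [hz a (by simp), hz b (by simp), hs _ _ hz, hs _ _ hz'] at h
  rw [h]; simp

/-- **du Bois-Reymond**: a continuous function on an interval with vanishing weak derivative is
constant. -/
theorem eq_of_integral_deriv_smul_eq_zero (hU : IsOpen U) (hc : U.OrdConnected)
    [CompleteSpace E] {h : ℝ → E} (hh : ContinuousOn h U)
    (H : ∀ η, IsTest U η → ∫ t, deriv η t • h t = 0) {s t : ℝ} (hs : s ∈ U) (ht : t ∈ U) :
    h s = h t := by
  have hne : U.Nonempty := ⟨s, hs⟩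
  obtain ⟨φ, hφ, -, hφ1⟩ := exists_isTest_integral_eq_one hU hne
  set c := ∫ t, φ t • h t
  have hcont : ContinuousOn (fun t ↦ h t - c) U := hh.sub continuousOn_const
  have hae : ∀ᵐ t, t ∈ U → h t - c = 0 := by
    refine hU.ae_eq_zero_of_integral_contDiff_smul_eq_zero
      (hcont.locallyIntegrableOn hU.measurableSet) fun ζ h1 h2 h3 ↦ ?_
    have hζ : IsTest U ζ := ⟨h1, h2, h3⟩
    -- Removing the multiple of `φ` that carries the mean of `ζ` leaves a derivative of a test
    -- function, on which the hypothesis can be used; the multiple of `φ` accounts for the constant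
    -- `c`.
    obtain ⟨η, hη, hd⟩ := (hζ.sub (hφ.const_smul (∫ t, ζ t))).exists_deriv_eq hU hc hne (by
      simp only [Pi.sub_apply, Pi.smul_apply, smul_eq_mul]
      rw [integral_sub hζ.integrable (hφ.integrable.const_mul _), integral_const_mul, hφ1]
      ring)
    have h4 := H η hη
    rw [hd] at h4
    simp only [Pi.sub_apply, Pi.smul_apply, smul_eq_mul, sub_smul, mul_smul] at h4
    rw [integral_sub (hζ.integrable_smul hU hh) (hφ.integrable_const_smul_smul hU hh _),
      integral_smul] at h4
    simp only [smul_sub]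
    rw [integral_sub (hζ.integrable_smul hU hh) (hζ.integrable_smul hU continuousOn_const),
      integral_smul_const]
    exact h4
  have heq : Set.EqOn (fun t ↦ h t - c) (fun _ ↦ 0) U :=
    Measure.eqOn_open_of_ae_eq (μ := volume) ((ae_restrict_iff' hU.measurableSet).2 hae) hU hcont
      continuousOn_const
  exact (sub_eq_zero.1 (heq hs)).trans (sub_eq_zero.1 (heq ht)).symm

theorem hasDerivAt_integral_of_continuousOn (hU : IsOpen U) (hc : U.OrdConnected)
    [CompleteSpace E] {g : ℝ → E} (hg : ContinuousOn g U) {s t : ℝ} (hs : s ∈ U) (ht : t ∈ U) :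
    HasDerivAt (fun t ↦ ∫ τ in s..t, g τ) (g t) t :=
  intervalIntegral.integral_hasDerivAt_right
    ((hg.mono (hc.uIcc_subset hs ht)).intervalIntegrable)
    (hg.stronglyMeasurableAtFilter hU t ht) (hg.continuousAt (hU.mem_nhds ht))

theorem continuousOn_integral_of_continuousOn (hU : IsOpen U) (hc : U.OrdConnected)
    [CompleteSpace E] {g : ℝ → E} (hg : ContinuousOn g U) {s : ℝ} (hs : s ∈ U) :
    ContinuousOn (fun t ↦ ∫ τ in s..t, g τ) U := fun _ ht ↦
  (hasDerivAt_integral_of_continuousOn hU hc hg hs ht).continuousAt.continuousWithinAt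

/-- Subtracting a primitive of `g` reduces this to du Bois-Reymond. It is the passage from
distributional equations in time to integrated ones. -/
theorem sub_eq_integral_of_weak_deriv (hU : IsOpen U) (hc : U.OrdConnected)
    [CompleteSpace E] {h g : ℝ → E} (hh : ContinuousOn h U) (hg : ContinuousOn g U)
    (H : ∀ η, IsTest U η → ∫ t, deriv η t • h t = -∫ t, η t • g t) {s t : ℝ} (hs : s ∈ U)
    (ht : t ∈ U) : h t - h s = ∫ τ in s..t, g τ := by
  have hG := continuousOn_integral_of_continuousOn hU hc hg hs
  have := eq_of_integral_deriv_smul_eq_zero hU hc (hh.sub hG) (fun η hη ↦ by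
    simp only [Pi.sub_apply, smul_sub]
    rw [integral_sub (hη.deriv.integrable_smul hU hh) (hη.deriv.integrable_smul hU hG), H η hη,
      integral_deriv_smul_eq_neg hU hc ⟨s, hs⟩ hg
        (fun t ht ↦ hasDerivAt_integral_of_continuousOn hU hc hg hs ht) hη, sub_self]) hs ht
  simp only [Pi.sub_apply, intervalIntegral.integral_same, sub_zero] at this
  rw [this]; abel

/-- A continuous function on an interval with vanishing second weak derivative is affine. -/
theorem exists_affine_of_integral_deriv_deriv_smul_eq_zero (hU : IsOpen U) (hc : U.OrdConnected)
    [CompleteSpace E] {h : ℝ → E} (hh : ContinuousOn h U)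
    (H : ∀ η, IsTest U η → ∫ t, deriv (deriv η) t • h t = 0) (hne : U.Nonempty) :
    ∃ c : E, ∀ s ∈ U, ∀ t ∈ U, h t - h s = (t - s) • c := by
  obtain ⟨φ, hφ, -, hφ1⟩ := exists_isTest_integral_eq_one hU hne
  -- The slope is the weak derivative of `h` tested against a function of integral one.
  refine ⟨-∫ t, deriv φ t • h t, fun s hs t ht ↦ ?_⟩
  rw [sub_eq_integral_of_weak_deriv hU hc hh
    (continuousOn_const (c := -∫ t, deriv φ t • h t)) (fun ζ hζ ↦ ?_) hs ht,
    intervalIntegral.integral_const]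
  obtain ⟨η, hη, hd⟩ := (hζ.sub (hφ.const_smul (∫ t, ζ t))).exists_deriv_eq hU hc hne (by
    simp only [Pi.sub_apply, Pi.smul_apply, smul_eq_mul]
    rw [integral_sub hζ.integrable (hφ.integrable.const_mul _), integral_const_mul, hφ1]
    ring)
  have h4 := H η hη
  have h5 : deriv (ζ - (∫ t, ζ t) • φ) = deriv ζ - (∫ t, ζ t) • deriv φ := funext fun t ↦
    ((hζ.hasDerivAt t).sub ((hφ.hasDerivAt t).const_smul _)).deriv
  rw [hd, h5] at h4
  simp only [Pi.sub_apply, Pi.smul_apply, smul_eq_mul, sub_smul, mul_smul] at h4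
  rw [integral_sub (hζ.deriv.integrable_smul hU hh) (hφ.deriv.integrable_const_smul_smul hU hh _),
    integral_smul, sub_eq_zero] at h4
  rw [h4, integral_smul_const, smul_neg, neg_neg]

/-- The solution of `p'' = 2 r' + q` in the weak sense. -/
theorem exists_of_weak_second_deriv (hU : IsOpen U) (hc : U.OrdConnected) [CompleteSpace E]
    {p r q : ℝ → E} (hp : ContinuousOn p U) (hr : ContinuousOn r U) (hq : ContinuousOn q U)
    (H : ∀ η, IsTest U η → (∫ t, deriv (deriv η) t • p t) + (2 : ℝ) • ∫ t, deriv η t • r t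
      = ∫ t, η t • q t) {s : ℝ} (hs : s ∈ U) :
    ∃ c : E, ∀ t ∈ U, HasDerivAt p (c + (2 : ℝ) • r t + ∫ τ in s..t, q τ) t := by
  have hm := continuousOn_integral_of_continuousOn hU hc hq hs
  have hk : ContinuousOn (fun t ↦ (2 : ℝ) • r t + ∫ τ in s..t, q τ) U :=
    (hr.const_smul (2 : ℝ)).add hm
  have hn := continuousOn_integral_of_continuousOn hU hc hk hs
  -- The double primitive is a particular solution, so `p` differs from it by an affine function,
  -- whose slope is the constant sought.
  obtain ⟨c, hcc⟩ := exists_affine_of_integral_deriv_deriv_smul_eq_zero hU hc (hp.sub hn)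
    (fun η hη ↦ by
      simp only [Pi.sub_apply, smul_sub]
      rw [integral_sub (hη.deriv.deriv.integrable_smul hU hp)
        (hη.deriv.deriv.integrable_smul hU hn),
        integral_deriv_smul_eq_neg hU hc ⟨s, hs⟩ hk
        (fun t ht ↦ hasDerivAt_integral_of_continuousOn hU hc hk hs ht) hη.deriv]
      simp only [smul_add]
      have h2 : ∀ t, deriv η t • (2 : ℝ) • r t = (2 : ℝ) • deriv η t • r t := fun t ↦
        smul_comm _ _ _
      simp only [h2]
      rw [integral_add (hη.deriv.integrable_const_smul_smul hU hr _)
        (hη.deriv.integrable_smul hU hm), integral_smul,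
        integral_deriv_smul_eq_neg hU hc ⟨s, hs⟩ hq
        (fun t ht ↦ hasDerivAt_integral_of_continuousOn hU hc hq hs ht) hη, ← H η hη]
      abel) ⟨s, hs⟩
  refine ⟨c, fun t ht ↦ ?_⟩
  have h1 : HasDerivAt (fun t ↦ p s + (t - s) • c
      + ∫ τ in s..t, ((2 : ℝ) • r τ + ∫ τ' in s..τ, q τ'))
      (c + (2 : ℝ) • r t + ∫ τ in s..t, q τ) t := by
    have h2 := ((((hasDerivAt_id t).sub_const s).smul_const c).const_add (p s)).add
      (hasDerivAt_integral_of_continuousOn hU hc hk hs ht)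
    rw [one_smul, ← add_assoc] at h2
    exact h2
  refine h1.congr_of_eventuallyEq ?_
  filter_upwards [hU.mem_nhds ht] with τ hτ
  have h3 := hcc s hs τ hτ
  simp only [Pi.sub_apply, intervalIntegral.integral_same, sub_zero] at h3
  rw [← h3]; abel

end

end MaxwellDirac

namespace MaxwellDirac

noncomputable section

/-! ### Multiplication of square integrable functions by continuous kernels -/

variable {E : Type*} [NormedAddCommGroup E] [NormedSpace ℝ E]

/-- `κ` is continuous on `I × ℝ` and `κ t` vanishes outside a fixed compact set. -/
structure IsKernel (I : Set ℝ) (κ : ℝ → ℝ → ℝ) : Prop where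
  continuousOn : ContinuousOn (fun z : ℝ × ℝ ↦ κ z.1 z.2) (I ×ˢ Set.univ)
  exists_isCompact : ∃ K, IsCompact K ∧ ∀ t ∈ I, ∀ y, y ∉ K → κ t y = 0

namespace IsKernel

variable {I : Set ℝ} {κ κ' : ℝ → ℝ → ℝ} {w : ℝ → Lp E 2 (volume : Measure ℝ)} {t : ℝ}

theorem continuous (h : IsKernel I κ) (ht : t ∈ I) : Continuous (κ t) :=
  continuousOn_univ.1 (h.continuousOn.comp (f := fun y ↦ (t, y)) (by fun_prop)
    fun _ _ ↦ ⟨ht, trivial⟩)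

theorem hasCompactSupport (h : IsKernel I κ) (ht : t ∈ I) : HasCompactSupport (κ t) := by
  obtain ⟨K, hK, h0⟩ := h.exists_isCompact
  exact HasCompactSupport.intro hK (h0 t ht)

theorem memLp_top (h : IsKernel I κ) (ht : t ∈ I) : MemLp (κ t) ∞ volume :=
  (h.continuous ht).memLp_top_of_hasCompactSupport (h.hasCompactSupport ht) _

theorem mul_left (h : IsKernel I κ)
    (h' : ContinuousOn (fun z : ℝ × ℝ ↦ κ' z.1 z.2) (I ×ˢ Set.univ)) :
    IsKernel I fun t y ↦ κ' t y * κ t y := by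
  obtain ⟨K, hK, h0⟩ := h.exists_isCompact
  exact ⟨h'.mul h.continuousOn, K, hK, fun t ht y hy ↦ by rw [h0 t ht y hy, mul_zero]⟩

/-- The common compact support turns joint continuity into continuity in time for the supremum norm.
With the Hölder pairing of `L^∞` and `L²`, this makes products of kernels with spinors continuous
into `L²`. -/
theorem eventually_forall_norm_sub_lt (h : IsKernel I κ) (hI : IsOpen I) (ht : t ∈ I) {ε : ℝ}
    (hε : 0 < ε) : ∀ᶠ s in 𝓝 t, ∀ y, ‖κ s y - κ t y‖ < ε := by
  obtain ⟨K, hK, h0⟩ := h.exists_isCompact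
  have h1 : ∀ᶠ s in 𝓝 t, ∀ y ∈ K, ‖κ s y - κ t y‖ < ε := by
    refine hK.eventually_forall_of_forall_eventually fun y _ ↦ ?_
    have hc : ContinuousAt (fun z : ℝ × ℝ ↦ κ z.1 z.2) (t, y) :=
      h.continuousOn.continuousAt ((hI.prod isOpen_univ).mem_nhds ⟨ht, trivial⟩)
    have hc' : ContinuousAt (fun z : ℝ × ℝ ↦ κ t z.2) (t, y) :=
      ((h.continuous ht).comp continuous_snd).continuousAt
    have := (hc.sub hc').norm.eventually_lt_const (u := ε) (by simpa using hε)
    exact this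
  filter_upwards [h1, hI.mem_nhds ht] with s hs hsI y
  by_cases hy : y ∈ K
  · exact hs y hy
  · rw [h0 s hsI y hy, h0 t ht y hy]; simpa using hε

end IsKernel

open scoped Classical in
/-- The product of a kernel with a time dependent square integrable function. -/
def mulKernel (κ : ℝ → ℝ → ℝ) (w : ℝ → Lp E 2 (volume : Measure ℝ)) (t : ℝ) :
    Lp E 2 (volume : Measure ℝ) :=
  if h : MemLp (κ t) ∞ volume then (h.toLp : Lp ℝ ∞ (volume : Measure ℝ)) • w t else 0

namespace IsKernel

variable {I : Set ℝ} {κ κ' : ℝ → ℝ → ℝ} {w : ℝ → Lp E 2 (volume : Measure ℝ)} {t : ℝ}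

theorem coeFn_mulKernel (h : IsKernel I κ) (ht : t ∈ I) :
    mulKernel κ w t =ᵐ[volume] fun y ↦ κ t y • w t y := by
  have h' := h.memLp_top ht
  rw [mulKernel, dif_pos h']
  filter_upwards [Lp.coeFn_lpSMul (r := 2) h'.toLp (w t), h'.coeFn_toLp] with y h1 h2
  rw [h1, Pi.smul_apply', h2]

theorem continuousOn_toLp (h : IsKernel I κ) (hI : IsOpen I) :
    Continuous fun t : I ↦ (h.memLp_top t.2).toLp := by
  rw [continuous_iff_continuousAt]
  intro t
  rw [Metric.continuousAt_iff']
  intro ε hε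
  have h1 := h.eventually_forall_norm_sub_lt hI t.2 (half_pos hε)
  filter_upwards [continuous_subtype_val.continuousAt.eventually h1] with s hs
  rw [dist_eq_norm, ← MemLp.toLp_sub, Lp.norm_toLp, eLpNorm_exponent_top]
  refine lt_of_le_of_lt ?_ (half_lt_self hε)
  refine ENNReal.toReal_le_of_le_ofReal (half_pos hε).le ?_
  exact eLpNormEssSup_le_of_ae_bound (ae_of_all _ fun y ↦ (hs y).le)

theorem continuousOn_mulKernel (h : IsKernel I κ) (hI : IsOpen I) (hw : ContinuousOn w I) :
    ContinuousOn (mulKernel κ w) I := by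
  rw [continuousOn_iff_continuous_domRestrict]
  have : I.domRestrict (mulKernel κ w) = fun t : I ↦
      (ContinuousLinearMap.lsmul ℝ ℝ : ℝ →L[ℝ] E →L[ℝ] E).holderL volume ∞ 2 2
        (h.memLp_top t.2).toLp (w t) := funext fun t ↦ by
    rw [Set.domRestrict_apply, mulKernel, dif_pos (h.memLp_top t.2)]
    rfl
  rw [this]
  exact (((ContinuousLinearMap.lsmul ℝ ℝ).holderL volume ∞ 2 2).continuous.comp
    (h.continuousOn_toLp hI)).clm_apply (continuousOn_iff_continuous_domRestrict.1 hw)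

theorem integrable_smul (h : IsKernel I κ) (ht : t ∈ I) :
    Integrable fun y ↦ κ t y • w t y := by
  have h2 : MemLp (κ t) 2 volume :=
    (h.continuous ht).memLp_of_hasCompactSupport (h.hasCompactSupport ht)
  exact memLp_one_iff_integrable.1 ((Lp.memLp (w t)).smul h2)

theorem continuousOn_integral_smul [CompleteSpace E] (h : IsKernel I κ) (hI : IsOpen I)
    (hw : ContinuousOn w I) : ContinuousOn (fun t ↦ ∫ y, κ t y • w t y) I := by
  obtain ⟨K, hK, h0⟩ := h.exists_isCompact
  -- Integration over the line is not a bounded functional on `L²`; integration over `K` is, and the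
  -- integrand vanishes off `K`.
  let L : Lp E 2 (volume : Measure ℝ) →L[ℝ] E :=
    (ContinuousLinearMap.lsmul ℝ ℝ : ℝ →L[ℝ] E →L[ℝ] E).lpPairing volume 2 2
      (indicatorConstLp 2 hK.measurableSet hK.measure_lt_top.ne 1)
  refine (L.continuous.comp_continuousOn (h.continuousOn_mulKernel hI hw)).congr fun t ht ↦ ?_
  simp only [Function.comp_apply, L, ContinuousLinearMap.lpPairing_eq_integral]
  refine integral_congr_ae ?_
  filter_upwards [h.coeFn_mulKernel (w := w) ht, indicatorConstLp_coeFn (p := 2)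
    (hs := hK.measurableSet) (hμs := hK.measure_lt_top.ne) (c := (1 : ℝ))] with y h1 h2
  rw [h1, h2]
  by_cases hy : y ∈ K
  · simp [hy]
  · simp [hy, h0 t ht y hy]

end IsKernel

variable {F : Type*} [NormedAddCommGroup F] [InnerProductSpace ℝ F]

theorem norm_sq_eq_integral (f : Lp F 2 (volume : Measure ℝ)) : ‖f‖ ^ 2 = ∫ y, ‖f y‖ ^ 2 := by
  rw [← real_inner_self_eq_norm_sq, L2.inner_def]
  simp only [real_inner_self_eq_norm_sq]

namespace IsKernel

variable {I : Set ℝ} {κ : ℝ → ℝ → ℝ} {w : ℝ → Lp F 2 (volume : Measure ℝ)} {t : ℝ}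

theorem integrable_mul_norm_sq (h : IsKernel I κ) (ht : t ∈ I) :
    Integrable fun y ↦ κ t y * ‖w t y‖ ^ 2 := by
  obtain ⟨C, hC⟩ := (h.continuous ht).bounded_above_of_compact_support (h.hasCompactSupport ht)
  exact ((memLp_two_iff_integrable_sq_norm (Lp.memLp (w t)).1).1 (Lp.memLp (w t))).bdd_mul
    (h.continuous ht).aestronglyMeasurable (ae_of_all _ hC)

/-- The integral is the `L²` inner product of `w` with its product by the kernel, both continuous in
time. -/
theorem continuousOn_integral_mul_norm_sq (h : IsKernel I κ) (hI : IsOpen I)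
    (hw : ContinuousOn w I) : ContinuousOn (fun t ↦ ∫ y, κ t y * ‖w t y‖ ^ 2) I := by
  refine (hw.inner (𝕜 := ℝ) (h.continuousOn_mulKernel hI hw)).congr fun t ht ↦ ?_
  simp only [L2.inner_def]
  refine integral_congr_ae ?_
  filter_upwards [h.coeFn_mulKernel (w := w) ht] with y h1
  rw [h1, real_inner_smul_right, real_inner_self_eq_norm_sq]

end IsKernel

end

end MaxwellDirac

namespace MaxwellDirac

noncomputable section

/-! ### Test functions on space-time -/

/-- The test function given by a smooth function vanishing off a compact subset of `Ω`. -/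
def mkTest {Ω : Opens (ℝ × ℝ)} (f : ℝ × ℝ → ℝ) (hf : ContDiff ℝ ∞ f) {K : Set (ℝ × ℝ)}
    (hK : IsCompact K) (hKΩ : K ⊆ Ω) (h0 : ∀ z, z ∉ K → f z = 0) : 𝓓(Ω, ℝ) where
  toFun := f
  contDiff' := hf
  hasCompactSupport' := HasCompactSupport.intro hK h0
  tsupport_subset' := (closure_minimal (fun z hz ↦ by
    by_contra h
    exact hz (h0 z h)) hK.isClosed).trans hKΩ

theorem lineDeriv_zero_eq {Ω : Opens (ℝ × ℝ)} {θ : 𝓓(Ω, ℝ)} {t x d : ℝ}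
    (h : HasDerivAt (fun s ↦ θ (s, x)) d t) : (∂_{e 0} θ) (t, x) = d := by
  rw [TestFunction.lineDerivOp_eq_lineDerivCLM ℝ, TestFunction.lineDerivCLM_apply_of_le (by simp)]
  refine HasLineDerivAt.lineDeriv ?_
  have h' : HasDerivAt (fun s ↦ θ (s, x)) d (t + 0) := by simpa using h
  have := h'.comp_const_add t 0
  simpa [HasLineDerivAt, e] using this

theorem lineDeriv_one_eq {Ω : Opens (ℝ × ℝ)} {θ : 𝓓(Ω, ℝ)} {t x d : ℝ}
    (h : HasDerivAt (fun y ↦ θ (t, y)) d x) : (∂_{e 1} θ) (t, x) = d := by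
  rw [TestFunction.lineDerivOp_eq_lineDerivCLM ℝ, TestFunction.lineDerivCLM_apply_of_le (by simp)]
  refine HasLineDerivAt.lineDeriv ?_
  have h' : HasDerivAt (fun s ↦ θ (t, s)) d (x + 0) := by simpa using h
  have := h'.comp_const_add x 0
  simpa [HasLineDerivAt, e] using this

/-! ### The Dirac equation along characteristics -/

theorem isKernel_translate {U : Set ℝ} (hU : Bornology.IsBounded U) {f : ℝ → ℝ}
    (hf : Continuous f) (hc : HasCompactSupport f) (c : ℝ) :
    IsKernel U fun t x ↦ f (x - c * t) := by
  refine ⟨by fun_prop, ?_⟩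
  obtain ⟨R, hR⟩ := hU.exists_norm_le
  obtain ⟨S, hS⟩ := hc.isCompact.isBounded.exists_norm_le
  refine ⟨Metric.closedBall 0 (S + |c| * R), isCompact_closedBall _ _, fun t ht x hx ↦ ?_⟩
  refine image_eq_zero_of_notMem_tsupport fun h ↦ hx ?_
  rw [mem_closedBall_zero_iff]
  calc ‖x‖ = ‖(x - c * t) + c * t‖ := by rw [sub_add_cancel]
    _ ≤ ‖x - c * t‖ + ‖c * t‖ := norm_add_le _ _
    _ ≤ S + |c| * R := by
      rw [norm_mul, Real.norm_eq_abs c]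
      exact add_le_add (hS _ h) (mul_le_mul_of_nonneg_left (hR t ht) (abs_nonneg c))

/-- The action of a matrix on spinors, as a real continuous linear map. -/
def actCLM (B : Matrix (Fin 2) (Fin 2) ℂ) : Spinor →L[ℝ] Spinor :=
  (Matrix.toEuclideanCLM (𝕜 := ℂ) B).restrictScalars ℝ

theorem actCLM_apply (B : Matrix (Fin 2) (Fin 2) ℂ) (v : Spinor) : actCLM B v = act B v := rfl

/-- The component of a spinor, as a real continuous linear map. -/
def projCLM (k : Fin 2) : Spinor →L[ℝ] ℂ :=
  (EuclideanSpace.proj k : Spinor →L[ℂ] ℂ).restrictScalars ℝ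

theorem projCLM_apply (k : Fin 2) (v : Spinor) : projCLM k v = v k := rfl

/-- Multiplication of spinors by `i`, as a real continuous linear map. -/
def iCLM : Spinor →L[ℝ] Spinor := Complex.I • ContinuousLinearMap.id ℝ Spinor

theorem iCLM_apply (v : Spinor) : iCLM v = Complex.I • v := rfl

section

variable {M : ℝ} {I : Opens ℝ} {ψ : ℝ → Lp Spinor 2 (volume : Measure ℝ)}
  {A : Fin 2 → ℝ → ℝ → ℝ} {b : Fin 2 → 𝓓'((⊤ : Opens ℝ), ℝ)}

/-- The Dirac equation tested against `η(t) f(x - g_k t)` and projected to the component that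
propagates with velocity `g_k`. -/
theorem IsChargeSolution.weak_transport (hs : IsChargeSolution M I ψ A b) {U : Set ℝ}
    (hU : IsOpen U) (hb : Bornology.IsBounded U) (hUI : U ⊆ I) (k : Fin 2) {η f : ℝ → ℝ}
    (hη : IsTest U η) (hf : IsTest Set.univ f) :
    ∫ t, deriv η t • (∫ x, f (x - g k * t) • ψ t x) k
      = -∫ t, η t • (Complex.I * (∫ x, ((A 0 t x + g k * A 1 t x) * f (x - g k * t)) • ψ t x) k
        - Complex.I * M * (∫ x, f (x - g k * t) • ψ t x) (1 - k)) := by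
  have hψ : ContinuousOn ψ U := hs.continuous_spinor.mono hUI
  have hA : ∀ μ, ContinuousOn (fun z : ℝ × ℝ ↦ A μ z.1 z.2) (U ×ˢ Set.univ) := fun μ ↦
    (hs.continuous_potential μ).mono (Set.prod_mono hUI subset_rfl)
  have hG := isKernel_translate hb hf.contDiff.continuous hf.hasCompactSupport (g k)
  have hG' := isKernel_translate hb hf.deriv.contDiff.continuous hf.deriv.hasCompactSupport (g k)
  have hAG := fun μ ↦ hG.mul_left (hA μ)
  set K : Set (ℝ × ℝ) := (fun z : ℝ × ℝ ↦ (z.1, z.2 + g k * z.1)) '' (tsupport η ×ˢ tsupport f)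
  have hK : IsCompact K :=
    (hη.hasCompactSupport.isCompact.prod hf.hasCompactSupport.isCompact).image (by fun_prop)
  have hKI : K ⊆ slab I := by
    rintro _ ⟨z, hz, rfl⟩
    exact ⟨hUI (hη.tsupport_subset hz.1), trivial⟩
  let θ : 𝓓(slab I, ℝ) := mkTest (fun z ↦ η z.1 * f (z.2 - g k * z.1))
    ((hη.contDiff.comp contDiff_fst).mul (hf.contDiff.comp
      (contDiff_snd.sub (contDiff_const.mul contDiff_fst)))) hK hKI fun z hz ↦ by
    by_contra h
    refine hz ⟨(z.1, z.2 - g k * z.1), ⟨subset_tsupport η fun h' ↦ h ?_,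
      subset_tsupport f fun h' ↦ h ?_⟩, ?_⟩
    · simp only [h', zero_mul]
    · simp only [h', mul_zero]
    · ext <;> simp
  have hθ : ∀ t x, θ (t, x) = η t * f (x - g k * t) := fun _ _ ↦ rfl
  have hθ0 : ∀ t x, (∂_{e 0} θ) (t, x)
      = deriv η t * f (x - g k * t) - g k * η t * deriv f (x - g k * t) := fun t x ↦ by
    refine lineDeriv_zero_eq ?_
    have h1 : HasDerivAt (fun s ↦ x - g k * s) (-g k) t := by
      simpa using ((hasDerivAt_id t).const_mul (g k)).const_sub x
    have := (hη.hasDerivAt t).mul ((hf.hasDerivAt (x - g k * t)).comp t h1)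
    exact this.congr_deriv (by simp only [Function.comp_apply]; ring)
  have hθ1 : ∀ t x, (∂_{e 1} θ) (t, x) = η t * deriv f (x - g k * t) := fun t x ↦ by
    refine lineDeriv_one_eq ?_
    have h1 : HasDerivAt (fun y ↦ y - g k * t) 1 x := (hasDerivAt_id x).sub_const _
    exact (((hf.hasDerivAt (x - g k * t)).comp x h1).const_mul (η t)).congr_deriv (by ring)
  set P : ℝ → Spinor := fun t ↦ ∫ x, f (x - g k * t) • ψ t x
  set P' : ℝ → Spinor := fun t ↦ ∫ x, deriv f (x - g k * t) • ψ t x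
  set Q : Fin 2 → ℝ → Spinor := fun μ t ↦ ∫ x, (A μ t x * f (x - g k * t)) • ψ t x
  have hP : ContinuousOn P U := hG.continuousOn_integral_smul hU hψ
  have hP' : ContinuousOn P' U := hG'.continuousOn_integral_smul hU hψ
  have hQ : ∀ μ, ContinuousOn (Q μ) U := fun μ ↦ (hAG μ).continuousOn_integral_smul hU hψ
  set V₁ : ℝ → Spinor := fun t ↦ iCLM (actCLM (γ 0) (P t))
  set V₂ : ℝ → Spinor := fun t ↦
    iCLM (actCLM (γ 1) (P' t) - g k • actCLM (γ 0) (P' t)) + M • P t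
  set W : ℝ → Spinor := fun t ↦ actCLM (γ 0) (Q 0 t) + actCLM (γ 1) (Q 1 t)
  have hV₁ : ContinuousOn V₁ U := by fun_prop
  have hV₂ : ContinuousOn V₂ U := by fun_prop
  have hW : ContinuousOn W U := by
    have := hQ 0; have := hQ 1; fun_prop
  have hη0 : ∀ t ∉ U, η t = 0 := fun t ht ↦ hη.eq_zero ht
  have hη0' : ∀ t ∉ U, deriv η t = 0 := fun t ht ↦ hη.deriv.eq_zero ht
  have hleft : ∀ t, ∫ x, (Complex.I • ∑ μ, (∂_{e μ} θ) (t, x) • act (γ μ) (ψ t x)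
      + (M * θ (t, x)) • ψ t x) = deriv η t • V₁ t + η t • V₂ t := fun t ↦ by
    simp only [Fin.sum_univ_two, hθ, hθ0, hθ1, ← iCLM_apply, ← actCLM_apply]
    by_cases ht : t ∈ U
    · have i1 := hG.integrable_smul (w := ψ) ht
      have i2 := hG'.integrable_smul (w := ψ) ht
      have e1 : ∀ x, iCLM ((deriv η t * f (x - g k * t) - g k * η t * deriv f (x - g k * t)) •
            actCLM (γ 0) (ψ t x) + (η t * deriv f (x - g k * t)) • actCLM (γ 1) (ψ t x))
            + (M * (η t * f (x - g k * t))) • ψ t x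
          = (deriv η t • iCLM.comp (actCLM (γ 0)) + (η t * M) • ContinuousLinearMap.id ℝ Spinor)
              (f (x - g k * t) • ψ t x)
            + (η t • iCLM.comp (actCLM (γ 1) - g k • actCLM (γ 0)))
              (deriv f (x - g k * t) • ψ t x) := fun x ↦ by
        simp only [add_apply, smul_apply,
          ContinuousLinearMap.comp_apply, sub_apply, map_smul, map_add,
          map_sub, ContinuousLinearMap.id_apply]
        module
      simp only [e1]
      rw [integral_add (ContinuousLinearMap.integrable_comp _ i1)
        (ContinuousLinearMap.integrable_comp _ i2), ContinuousLinearMap.integral_comp_comm _ i1,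
        ContinuousLinearMap.integral_comp_comm _ i2]
      simp only [add_apply, smul_apply,
          ContinuousLinearMap.comp_apply, sub_apply, map_smul, map_sub,
          ContinuousLinearMap.id_apply, V₁, V₂]
      module
    · simp [hη0 t ht, hη0' t ht]
  have hright : ∀ t, ∫ x, ∑ μ, (θ (t, x) * A μ t x) • act (γ μ) (ψ t x) = η t • W t := fun t ↦ by
    simp only [Fin.sum_univ_two, hθ, ← actCLM_apply]
    by_cases ht : t ∈ U
    · have i := fun μ ↦ (hAG μ).integrable_smul (w := ψ) ht
      have e1 : ∀ x, (η t * f (x - g k * t) * A 0 t x) • actCLM (γ 0) (ψ t x)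
          + (η t * f (x - g k * t) * A 1 t x) • actCLM (γ 1) (ψ t x)
          = (η t • actCLM (γ 0)) ((A 0 t x * f (x - g k * t)) • ψ t x)
            + (η t • actCLM (γ 1)) ((A 1 t x * f (x - g k * t)) • ψ t x) := fun x ↦ by
        simp only [smul_apply, map_smul]
        module
      simp only [e1]
      rw [integral_add (ContinuousLinearMap.integrable_comp _ (i 0))
        (ContinuousLinearMap.integrable_comp _ (i 1)),
        ContinuousLinearMap.integral_comp_comm _ (i 0),
        ContinuousLinearMap.integral_comp_comm _ (i 1)]
      simp only [smul_apply, W]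
      module
    · simp [hη0 t ht]
  have hD := hs.dirac θ
  simp only [hleft, hright] at hD
  have j1 := hη.deriv.integrable_smul hU hV₁
  have j2 := hη.integrable_smul hU hV₂
  have j12 : Integrable (fun t ↦ deriv η t • V₁ t + η t • V₂ t) := j1.add j2
  have j3 := hη.integrable_smul hU hW
  -- `γ⁰` exchanges the components, so row `1 - k` of the equation governs component `k`. In that
  -- row `γ¹ - g_k γ⁰` vanishes, so the terms with `deriv f` disappear: this is transport with
  -- velocity `g k`. The potentials enter only as `A 0 + g k * A 1`.
  have hD' := congrArg (projCLM (1 - k)) hD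
  rw [← ContinuousLinearMap.integral_comp_comm _ j12,
    ← ContinuousLinearMap.integral_comp_comm _ j3] at hD'
  have hp : ∀ j, ContinuousOn (fun t ↦ P t j) U := fun j ↦
    (projCLM j).continuous.comp_continuousOn hP
  have hq : ContinuousOn (fun t ↦ (∫ x, ((A 0 t x + g k * A 1 t x) * f (x - g k * t)) • ψ t x) k)
      U := (projCLM k).continuous.comp_continuousOn
    ((hG.mul_left ((hA 0).add (continuousOn_const.mul (hA 1)))).continuousOn_integral_smul hU hψ)
  have hQQ : ∀ t ∈ U, ∫ x, ((A 0 t x + g k * A 1 t x) * f (x - g k * t)) • ψ t x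
      = Q 0 t + g k • Q 1 t := fun t ht ↦ by
    simp only [add_mul, add_smul, mul_assoc, mul_smul (g k)]
    have i1 : Integrable fun x ↦ g k • (A 1 t x * f (x - g k * t)) • ψ t x :=
      ((hAG 1).integrable_smul (w := ψ) ht).smul (g k)
    rw [integral_add ((hAG 0).integrable_smul ht) i1, integral_smul]
  have hl : ∀ t, projCLM (1 - k) (deriv η t • V₁ t + η t • V₂ t)
      = Complex.I * (deriv η t • P t k) + M * (η t • P t (1 - k)) := fun t ↦ by
    simp only [V₁, V₂, projCLM_apply, iCLM_apply, actCLM_apply]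
    fin_cases k <;>
    · simp [act, γ, g, dotProduct, Fin.sum_univ_two]
      ring
  have hr : ∀ t, projCLM (1 - k) (η t • W t)
      = η t • (∫ x, ((A 0 t x + g k * A 1 t x) * f (x - g k * t)) • ψ t x) k := fun t ↦ by
    by_cases ht : t ∈ U
    · rw [hQQ t ht]
      simp only [W, projCLM_apply, actCLM_apply]
      fin_cases k <;> simp [act, γ, g, dotProduct, Fin.sum_univ_two]
    · simp [hη0 t ht]
  simp only [hl, hr] at hD'
  have i1 := hη.deriv.integrable_smul hU (hp k)
  have i2 := hη.integrable_smul hU (hp (1 - k))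
  have i3 := hη.integrable_smul hU hq
  rw [integral_add (i1.const_mul _) (i2.const_mul _), integral_const_mul, integral_const_mul] at hD'
  have e3 : ∀ t, η t • (Complex.I * (∫ x, ((A 0 t x + g k * A 1 t x) * f (x - g k * t)) • ψ t x) k
        - Complex.I * M * P t (1 - k))
      = Complex.I * (η t • (∫ x, ((A 0 t x + g k * A 1 t x) * f (x - g k * t)) • ψ t x) k)
        - Complex.I * M * (η t • P t (1 - k)) := fun t ↦ by
    simp only [Complex.real_smul]; ring
  change ∫ t, deriv η t • P t k = -∫ t, η t • (_ - Complex.I * M * P t (1 - k))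
  rw [integral_congr_ae (ae_of_all _ e3), integral_sub (i3.const_mul _) (i2.const_mul _),
    integral_const_mul, integral_const_mul]
  linear_combination (-Complex.I) * hD' + (∫ t, deriv η t • P t k) * Complex.I_sq

end

end

end MaxwellDirac

namespace MaxwellDirac

noncomputable section

/-! ### The energy of a component along its characteristics -/

/-- The translation `y ↦ y + c`. -/
def shiftMap (c : ℝ) : C(ℝ, ℝ) := ⟨fun y ↦ y + c, by fun_prop⟩

/-- The component `j` of a spinor field in the frame moving with velocity `c`. -/
def moving (ψ : ℝ → Lp Spinor 2 (volume : Measure ℝ)) (c : ℝ) (j : Fin 2) (t : ℝ) :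
    Lp ℂ 2 (volume : Measure ℝ) :=
  Lp.compMeasurePreserving (shiftMap (c * t)) (measurePreserving_add_right volume (c * t))
    ((projCLM j).compLpL 2 volume (ψ t))

section

variable {ψ : ℝ → Lp Spinor 2 (volume : Measure ℝ)}

theorem coeFn_moving (c : ℝ) (j : Fin 2) (t : ℝ) :
    moving ψ c j t =ᵐ[volume] fun y ↦ ψ t (y + c * t) j := by
  have hm := measurePreserving_add_right (volume : Measure ℝ) (c * t)
  refine (Lp.coeFn_compMeasurePreserving ((projCLM j).compLpL 2 volume (ψ t))
    (f := shiftMap (c * t)) hm).trans ?_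
  exact hm.quasiMeasurePreserving.ae ((projCLM j).coeFn_compLpL (ψ t))

theorem continuousOn_moving {U : Set ℝ} (hψ : ContinuousOn ψ U) (c : ℝ) (j : Fin 2) :
    ContinuousOn (moving ψ c j) U := by
  refine ContinuousOn.compMeasurePreservingLp
    (((projCLM j).compLpL 2 volume).continuous.comp_continuousOn hψ) ?_ _ (by norm_num)
  refine Continuous.continuousOn ?_
  refine ContinuousMap.continuous_of_continuous_uncurry _ ?_
  change Continuous fun z : ℝ × ℝ ↦ z.2 + c * z.1
  fun_prop

theorem IsTest.mul {U : Set ℝ} {f φ : ℝ → ℝ} (hf : IsTest U f) (hφ : IsTest U φ) :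
    IsTest U (φ * f) :=
  ⟨hφ.contDiff.mul hf.contDiff, hf.hasCompactSupport.mul_left,
    (tsupport_mul_subset_right).trans hf.tsupport_subset⟩

/-- Integration against a continuous function with compact support, as a functional on `L²`. -/
def pairing (φ : ℝ → ℝ) (hφ : IsTest Set.univ φ) : Lp ℂ 2 (volume : Measure ℝ) →L[ℝ] ℂ :=
  (ContinuousLinearMap.lsmul ℝ ℝ : ℝ →L[ℝ] ℂ →L[ℝ] ℂ).lpPairing volume 2 2
    (hφ.contDiff.continuous.memLp_of_hasCompactSupport hφ.hasCompactSupport :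
      MemLp φ 2 volume).toLp

theorem pairing_apply {φ : ℝ → ℝ} (hφ : IsTest Set.univ φ) (w : Lp ℂ 2 (volume : Measure ℝ)) :
    pairing φ hφ w = ∫ y, φ y • w y := by
  rw [pairing, ContinuousLinearMap.lpPairing_eq_integral]
  refine integral_congr_ae ?_
  filter_upwards [MemLp.coeFn_toLp (hφ.contDiff.continuous.memLp_of_hasCompactSupport
    hφ.hasCompactSupport : MemLp φ 2 volume)] with y hy
  rw [hy, ContinuousLinearMap.lsmul_apply]

theorem eq_zero_of_pairing_eq_zero {w : Lp ℂ 2 (volume : Measure ℝ)}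
    (h : ∀ φ hφ, pairing φ hφ w = 0) : w = 0 := by
  rw [Lp.eq_zero_iff_ae_eq_zero]
  refine ae_eq_zero_of_integral_contDiff_smul_eq_zero
    ((Lp.memLp w).locallyIntegrable (by norm_num)) fun φ h1 h2 ↦ ?_
  have hφ : IsTest Set.univ φ := ⟨h1, h2, Set.subset_univ _⟩
  rw [← pairing_apply hφ, h]

theorem pairing_mulKernel_moving {U : Set ℝ} {κ : ℝ → ℝ → ℝ} (hκ : IsKernel U κ) {φ : ℝ → ℝ}
    (hφ : IsTest Set.univ φ) (c : ℝ) (j : Fin 2) {t : ℝ} (ht : t ∈ U) :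
    pairing φ hφ (mulKernel κ (moving ψ c j) t)
      = (∫ x, (φ (x - c * t) * κ t (x - c * t)) • ψ t x) j := by
  have h2 : MemLp (fun x ↦ φ (x - c * t) * κ t (x - c * t)) 2 volume :=
    Continuous.memLp_of_hasCompactSupport
      ((hφ.contDiff.continuous.comp (by fun_prop)).mul ((hκ.continuous ht).comp (by fun_prop)))
      (hφ.hasCompactSupport.comp_homeomorph (Homeomorph.subRight (c * t))).mul_right
  have hi : Integrable fun x ↦ (φ (x - c * t) * κ t (x - c * t)) • ψ t x :=
    memLp_one_iff_integrable.1 ((Lp.memLp (ψ t)).smul h2)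
  rw [pairing_apply, ← projCLM_apply, ← ContinuousLinearMap.integral_comp_comm _ hi,
    ← integral_add_right_eq_self
      (fun x ↦ projCLM j ((φ (x - c * t) * κ t (x - c * t)) • ψ t x)) (c * t)]
  refine integral_congr_ae ?_
  filter_upwards [hκ.coeFn_mulKernel (w := moving ψ c j) ht, coeFn_moving (ψ := ψ) c j t]
    with y h1 h2
  rw [h1, h2, map_smul, projCLM_apply, add_sub_cancel_right, mul_smul]

end

/-! ### Strong differentiability in the moving frame -/

section

variable {M : ℝ} {I : Opens ℝ} {ψ : ℝ → Lp Spinor 2 (volume : Measure ℝ)}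
  {A : Fin 2 → ℝ → ℝ → ℝ} {b : Fin 2 → 𝓓'((⊤ : Opens ℝ), ℝ)}

theorem isKernel_const (U : Set ℝ) {f : ℝ → ℝ} (hf : IsTest Set.univ f) :
    IsKernel U fun _ y ↦ f y :=
  ⟨(hf.contDiff.continuous.comp continuous_snd).continuousOn, tsupport f,
    hf.hasCompactSupport, fun _ _ _ hy ↦ image_eq_zero_of_notMem_tsupport hy⟩

/-- The derivative of the component `k`, cut off by `f`, in the frame moving with it. -/
def movingDeriv (M : ℝ) (ψ : ℝ → Lp Spinor 2 (volume : Measure ℝ)) (A : Fin 2 → ℝ → ℝ → ℝ)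
    (k : Fin 2) (f : ℝ → ℝ) (t : ℝ) : Lp ℂ 2 (volume : Measure ℝ) :=
  Complex.I • mulKernel
      (fun t y ↦ (A 0 t (y + g k * t) + g k * A 1 t (y + g k * t)) * f y) (moving ψ (g k) k) t
    - (Complex.I * M) • mulKernel (fun _ y ↦ f y) (moving ψ (g k) (1 - k)) t

theorem IsChargeSolution.isKernel_potential (hs : IsChargeSolution M I ψ A b) {U : Set ℝ}
    (hUI : U ⊆ I) (k : Fin 2) {f : ℝ → ℝ} (hf : IsTest Set.univ f) :
    IsKernel U fun t y ↦ (A 0 t (y + g k * t) + g k * A 1 t (y + g k * t)) * f y := by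
  have hA : ∀ μ, ContinuousOn (fun z : ℝ × ℝ ↦ A μ z.1 (z.2 + g k * z.1)) (U ×ˢ Set.univ) :=
    fun μ ↦ (hs.continuous_potential μ).comp
      (f := fun z : ℝ × ℝ ↦ (z.1, z.2 + g k * z.1)) (by fun_prop)
      fun z hz ↦ ⟨hUI hz.1, trivial⟩
  exact (isKernel_const U hf).mul_left ((hA 0).add (continuousOn_const.mul (hA 1)))

theorem IsChargeSolution.continuousOn_movingDeriv (hs : IsChargeSolution M I ψ A b) {U : Set ℝ}
    (hU : IsOpen U) (hUI : U ⊆ I) (k : Fin 2) {f : ℝ → ℝ} (hf : IsTest Set.univ f) :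
    ContinuousOn (movingDeriv M ψ A k f) U := by
  have hψ : ContinuousOn ψ U := hs.continuous_spinor.mono hUI
  exact (((hs.isKernel_potential hUI k hf).continuousOn_mulKernel hU
    (continuousOn_moving hψ _ _)).const_smul Complex.I).sub
    (((isKernel_const U hf).continuousOn_mulKernel hU (continuousOn_moving hψ _ _)).const_smul
      (Complex.I * (M : ℂ)))

theorem pairing_const_smul {φ : ℝ → ℝ} (hφ : IsTest Set.univ φ) (c : ℂ)
    (w : Lp ℂ 2 (volume : Measure ℝ)) : pairing φ hφ (c • w) = c * pairing φ hφ w := by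
  rw [pairing_apply, pairing_apply, ← integral_const_mul]
  refine integral_congr_ae ?_
  filter_upwards [Lp.coeFn_smul c w] with y hy
  rw [hy, Pi.smul_apply, smul_eq_mul, mul_smul_comm]

/-- In the moving frame no spatial derivative remains, so the equation is an ordinary differential
equation in `L²` with continuous right-hand side. Each pairing with a test function satisfies its
integrated form by `weak_transport`, and pairings separate points of `L²`. -/
theorem IsChargeSolution.hasDerivAt_mulKernel_moving (hs : IsChargeSolution M I ψ A b)
    {U : Set ℝ} (hU : IsOpen U) (hb : Bornology.IsBounded U) (hc : U.OrdConnected) (hUI : U ⊆ I)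
    (k : Fin 2) {f : ℝ → ℝ} (hf : IsTest Set.univ f) {t : ℝ} (ht : t ∈ U) :
    HasDerivAt (mulKernel (fun _ y ↦ f y) (moving ψ (g k) k)) (movingDeriv M ψ A k f t) t := by
  have hψ : ContinuousOn ψ U := hs.continuous_spinor.mono hUI
  have hκ := isKernel_const U hf
  have hF := hs.continuousOn_movingDeriv hU hUI k hf
  have hh : ContinuousOn (mulKernel (fun _ y ↦ f y) (moving ψ (g k) k)) U :=
    hκ.continuousOn_mulKernel hU (continuousOn_moving hψ _ _)
  have key : ∀ s ∈ U, mulKernel (fun _ y ↦ f y) (moving ψ (g k) k) s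
      = mulKernel (fun _ y ↦ f y) (moving ψ (g k) k) t
        + ∫ τ in t..s, movingDeriv M ψ A k f τ := by
    intro s hsU
    rw [← sub_eq_iff_eq_add', ← sub_eq_zero]
    refine eq_zero_of_pairing_eq_zero fun φ hφ ↦ ?_
    rw [map_sub, map_sub, ← ContinuousLinearMap.intervalIntegral_comp_comm _
      ((hF.mono (hc.uIcc_subset ht hsU)).intervalIntegrable), sub_eq_zero]
    refine sub_eq_integral_of_weak_deriv hU hc
      (h := fun t ↦ pairing φ hφ (mulKernel (fun _ y ↦ f y) (moving ψ (g k) k) t))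
      (g := fun t ↦ pairing φ hφ (movingDeriv M ψ A k f t))
      ((pairing φ hφ).continuous.comp_continuousOn hh)
      ((pairing φ hφ).continuous.comp_continuousOn hF) (fun η hη ↦ ?_) ht hsU
    have h := hs.weak_transport hU hb hUI k hη (hf.mul hφ)
    have e1 : ∀ t, deriv η t • pairing φ hφ (mulKernel (fun _ y ↦ f y) (moving ψ (g k) k) t)
        = deriv η t • (∫ x, (φ * f) (x - g k * t) • ψ t x) k := fun t ↦ by
      by_cases htU : t ∈ U
      · rw [pairing_mulKernel_moving hκ hφ _ _ htU]; rfl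
      · rw [hη.deriv.eq_zero htU, zero_smul, zero_smul]
    have e2 : ∀ t, η t • pairing φ hφ (movingDeriv M ψ A k f t)
        = η t • (Complex.I *
            (∫ x, ((A 0 t x + g k * A 1 t x) * (φ * f) (x - g k * t)) • ψ t x) k
          - Complex.I * M * (∫ x, (φ * f) (x - g k * t) • ψ t x) (1 - k)) := fun t ↦ by
      by_cases htU : t ∈ U
      · rw [movingDeriv, map_sub, pairing_const_smul, pairing_const_smul,
          pairing_mulKernel_moving hκ hφ _ _ htU,
          pairing_mulKernel_moving (hs.isKernel_potential hUI k hf) hφ _ _ htU]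
        simp only [sub_add_cancel, Pi.mul_apply, mul_left_comm (φ _)]
      · rw [hη.eq_zero htU, zero_smul, zero_smul]
    simp only [e1, e2]
    exact h
  have hd := (hasDerivAt_integral_of_continuousOn hU hc hF ht ht).const_add
    (mulKernel (fun _ y ↦ f y) (moving ψ (g k) k) t)
  refine hd.congr_of_eventuallyEq ?_
  filter_upwards [hU.mem_nhds ht] with s hsU using key s hsU

theorem norm_sq_mulKernel_moving {U : Set ℝ} {f : ℝ → ℝ} (hf : IsTest Set.univ f) (c : ℝ)
    (j : Fin 2) {t : ℝ} (ht : t ∈ U) :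
    ‖mulKernel (fun _ y ↦ f y) (moving ψ c j) t‖ ^ 2
      = ∫ x, f (x - c * t) ^ 2 * ‖ψ t x j‖ ^ 2 := by
  rw [norm_sq_eq_integral,
    ← integral_add_right_eq_self (fun x ↦ f (x - c * t) ^ 2 * ‖ψ t x j‖ ^ 2) (c * t)]
  refine integral_congr_ae ?_
  filter_upwards [(isKernel_const U hf).coeFn_mulKernel (w := moving ψ c j) ht,
    coeFn_moving (ψ := ψ) c j t] with y h1 h2
  rw [h1, h2, norm_smul, mul_pow, add_sub_cancel_right, Real.norm_eq_abs, sq_abs]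

/-- The potential term is `i` times a real multiple of the component itself and is orthogonal to it
over the reals, so no bound on the potentials is needed. The mass term is controlled by `2 |u| |v| ≤
|u|² + |v|²`. -/
theorem abs_inner_movingDeriv_le (hs : IsChargeSolution M I ψ A b) {U : Set ℝ} (hUI : U ⊆ I)
    (k : Fin 2) {f : ℝ → ℝ} (hf : IsTest Set.univ f) {t : ℝ} (ht : t ∈ U) :
    |2 * inner ℝ (mulKernel (fun _ y ↦ f y) (moving ψ (g k) k) t) (movingDeriv M ψ A k f t)|
      ≤ |M| * ∫ x, f (x - g k * t) ^ 2 * ‖ψ t x‖ ^ 2 := by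
  have hκ := isKernel_const U hf
  have hκ' := hs.isKernel_potential hUI k hf
  rw [L2.inner_def, ← integral_const_mul, ← integral_const_mul,
    ← integral_add_right_eq_self (fun x ↦ |M| * (f (x - g k * t) ^ 2 * ‖ψ t x‖ ^ 2)) (g k * t)]
  have hint : Integrable fun x ↦ f (x + g k * t - g k * t) ^ 2 * ‖ψ t (x + g k * t)‖ ^ 2 := by
    obtain ⟨C, hC⟩ := hf.contDiff.continuous.bounded_above_of_compact_support hf.hasCompactSupport
    have h1 := ((memLp_two_iff_integrable_sq_norm (Lp.memLp (ψ t)).1).1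
      (Lp.memLp (ψ t))).comp_add_right (g k * t)
    refine h1.bdd_mul (c := C ^ 2) ?_ (ae_of_all _ fun x ↦ ?_)
    · exact Continuous.aestronglyMeasurable
        ((hf.contDiff.continuous.comp (by fun_prop)).pow 2)
    · rw [norm_pow]
      exact pow_le_pow_left₀ (norm_nonneg _) (hC _) 2
  rw [← Real.norm_eq_abs]
  refine norm_integral_le_of_norm_le (hint.const_mul _) ?_
  rw [movingDeriv]
  filter_upwards [hκ.coeFn_mulKernel (w := moving ψ (g k) k) ht,
    hκ.coeFn_mulKernel (w := moving ψ (g k) (1 - k)) ht,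
    hκ'.coeFn_mulKernel (w := moving ψ (g k) k) ht,
    coeFn_moving (ψ := ψ) (g k) k t, coeFn_moving (ψ := ψ) (g k) (1 - k) t,
    Lp.coeFn_sub (Complex.I • mulKernel
      (fun t y ↦ (A 0 t (y + g k * t) + g k * A 1 t (y + g k * t)) * f y) (moving ψ (g k) k) t)
      ((Complex.I * M) • mulKernel (fun _ y ↦ f y) (moving ψ (g k) (1 - k)) t),
    Lp.coeFn_smul Complex.I (mulKernel
      (fun t y ↦ (A 0 t (y + g k * t) + g k * A 1 t (y + g k * t)) * f y) (moving ψ (g k) k) t),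
    Lp.coeFn_smul (Complex.I * M) (mulKernel (fun _ y ↦ f y) (moving ψ (g k) (1 - k)) t)]
    with y h1 h2 h3 h4 h5 h6 h7 h8
  rw [h6, Pi.sub_apply, h7, h8, Pi.smul_apply, Pi.smul_apply, h1, h2, h3, h4, h5,
    add_sub_cancel_right]
  set u := ψ t (y + g k * t) k
  set v := ψ t (y + g k * t) (1 - k)
  have hn : ‖ψ t (y + g k * t)‖ ^ 2 = ‖u‖ ^ 2 + ‖v‖ ^ 2 := by
    rw [EuclideanSpace.norm_sq_eq, Fin.sum_univ_two]
    simp only [u, v]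
    fin_cases k <;> simp [add_comm]
  have hin : 2 * inner ℝ (f y • u) (Complex.I •
      (((A 0 t (y + g k * t) + g k * A 1 t (y + g k * t)) * f y) • u)
      - (Complex.I * M) • f y • v) = M * f y ^ 2 * (2 * (u.re * v.im - u.im * v.re)) := by
    simp [Complex.inner]
    ring
  rw [hin, hn, norm_mul, norm_mul, Real.norm_eq_abs M, norm_pow, Real.norm_eq_abs (f y), sq_abs,
    mul_assoc]
  have hb : ‖2 * (u.re * v.im - u.im * v.re)‖ ≤ ‖u‖ ^ 2 + ‖v‖ ^ 2 := by
    rw [Real.norm_eq_abs, ← Complex.normSq_eq_norm_sq, ← Complex.normSq_eq_norm_sq,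
      Complex.normSq_apply, Complex.normSq_apply, abs_le]
    constructor <;> nlinarith [sq_nonneg (u.re - v.im), sq_nonneg (u.im + v.re),
      sq_nonneg (u.re + v.im), sq_nonneg (u.im - v.re)]
  gcongr

/-- The change in time of the energy of the component `k` along its characteristics. -/
theorem IsChargeSolution.abs_energy_sub_le (hs : IsChargeSolution M I ψ A b) (k : Fin 2)
    {f : ℝ → ℝ} (hf : IsTest Set.univ f) {s t : ℝ} (hst : s ≤ t) (hsI : s ∈ I) (htI : t ∈ I) :
    |(∫ x, f (x - g k * t) ^ 2 * ‖ψ t x k‖ ^ 2) - ∫ x, f (x - g k * s) ^ 2 * ‖ψ s x k‖ ^ 2|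
      ≤ |M| * ∫ τ in s..t, ∫ x, f (x - g k * τ) ^ 2 * ‖ψ τ x‖ ^ 2 := by
  obtain ⟨c, d, hcd, hsub, hmem⟩ := exists_Icc_subset_of_isCompact I.isOpen hs.ordConnected
    ⟨s, hsI⟩ isCompact_Icc (hs.ordConnected.out hsI htI)
  have hUI : Set.Ioo c d ⊆ I := Set.Ioo_subset_Icc_self.trans hsub
  -- A bounded time interval is needed for the translated cutoffs to have a common compact support.
  set U := Set.Ioo c d
  have hU : IsOpen U := isOpen_Ioo
  have hUb : Bornology.IsBounded U := Metric.isBounded_Ioo c d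
  have hUc : U.OrdConnected := Set.ordConnected_Ioo
  have hsU : s ∈ U := hmem (Set.left_mem_Icc.2 hst)
  have htU : t ∈ U := hmem (Set.right_mem_Icc.2 hst)
  have hψ : ContinuousOn ψ U := hs.continuous_spinor.mono hUI
  have hu : Set.uIcc s t ⊆ U := hUc.uIcc_subset hsU htU
  set h := mulKernel (fun _ y ↦ f y) (moving ψ (g k) k)
  have hd : ∀ τ ∈ U, HasDerivAt (fun τ ↦ ‖h τ‖ ^ 2)
      (2 * inner ℝ (h τ) (movingDeriv M ψ A k f τ)) τ := fun τ hτ ↦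
    (hs.hasDerivAt_mulKernel_moving hU hUb hUc hUI k hf hτ).norm_sq
  have hcont : ContinuousOn (fun τ ↦ 2 * inner ℝ (h τ) (movingDeriv M ψ A k f τ)) U :=
    continuousOn_const.mul (((isKernel_const U hf).continuousOn_mulKernel hU
      (continuousOn_moving hψ _ _)).inner (hs.continuousOn_movingDeriv hU hUI k hf))
  have hkern : IsKernel U fun t x ↦ f (x - g k * t) ^ 2 := by
    have := isKernel_translate hUb hf.contDiff.continuous hf.hasCompactSupport (g k)
    simpa only [pow_two] using this.mul_left this.continuousOn
  have hbd : ContinuousOn (fun τ ↦ ∫ x, f (x - g k * τ) ^ 2 * ‖ψ τ x‖ ^ 2) U :=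
    hkern.continuousOn_integral_mul_norm_sq hU hψ
  rw [← norm_sq_mulKernel_moving hf _ _ htU, ← norm_sq_mulKernel_moving hf _ _ hsU,
    ← intervalIntegral.integral_eq_sub_of_hasDerivAt (fun τ hτ ↦ hd τ (hu hτ))
      (hcont.mono hu).intervalIntegrable, ← intervalIntegral.integral_const_mul,
    ← Real.norm_eq_abs]
  refine intervalIntegral.norm_integral_le_of_norm_le hst (ae_of_all _ fun τ hτ ↦ ?_)
    ((hbd.mono hu).intervalIntegrable.const_mul _)
  exact abs_inner_movingDeriv_le hs hUI k hf
    (hu (Set.uIcc_of_le hst ▸ Set.Ioc_subset_Icc_self hτ))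

end

end

end MaxwellDirac

namespace MaxwellDirac

noncomputable section

/-! ### The wave equations in terms of the components of the spinor -/

theorem current_zero (v : Spinor) : current 0 v = ‖v‖ ^ 2 := by
  rw [EuclideanSpace.norm_sq_eq, Fin.sum_univ_two, ← Complex.normSq_eq_norm_sq,
    ← Complex.normSq_eq_norm_sq, Complex.normSq_apply, Complex.normSq_apply]
  simp [current, act, γ, g, PiLp.inner_apply, Fin.sum_univ_two, Matrix.vecHead, Matrix.vecTail]

/-- Since `γ⁰ γ¹ = diag(1, -1)`, the left-moving component cancels. Thus `A 0 - A 1` is driven by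
the right-moving component alone. -/
theorem current_sub_current (v : Spinor) : current 0 v - current 1 v = 2 * ‖v 0‖ ^ 2 := by
  rw [← Complex.normSq_eq_norm_sq, Complex.normSq_apply]
  simp [current, act, γ, g, PiLp.inner_apply, Fin.sum_univ_two, Matrix.vecHead, Matrix.vecTail]
  ring

theorem lineDerivOp_apply {Ω : Opens (ℝ × ℝ)} (θ : 𝓓(Ω, ℝ)) (v z : ℝ × ℝ) :
    (∂_{v} θ) z = lineDeriv ℝ θ z v := by
  rw [TestFunction.lineDerivOp_eq_lineDerivCLM ℝ, TestFunction.lineDerivCLM_apply_of_le (by simp)]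

/-- The restriction of the domain of a test function. -/
def extendTest {Ω Ω' : Opens (ℝ × ℝ)} (h : Ω ≤ Ω') (θ : 𝓓(Ω, ℝ)) : 𝓓(Ω', ℝ) :=
  ⟨θ, θ.contDiff, θ.hasCompactSupport, θ.tsupport_subset.trans h⟩

theorem coe_extendTest {Ω Ω' : Opens (ℝ × ℝ)} (h : Ω ≤ Ω') (θ : 𝓓(Ω, ℝ)) :
    (extendTest h θ : ℝ × ℝ → ℝ) = θ := rfl

section

variable {M : ℝ} {I : Opens ℝ} {ψ : ℝ → Lp Spinor 2 (volume : Measure ℝ)}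
  {A : Fin 2 → ℝ → ℝ → ℝ} {b : Fin 2 → 𝓓'((⊤ : Opens ℝ), ℝ)}

/-- A quantity quadratic in the spinor is expressed linearly through `A 0`, so that distributional
convergence of the potential controls the charge. -/
theorem IsChargeSolution.integral_norm_sq_eq (hs : IsChargeSolution M I ψ A b)
    {Ω : Opens (ℝ × ℝ)} (hΩ : Ω ≤ slab I) (θ : 𝓓(Ω, ℝ)) :
    ∫ t, ∫ x, θ (t, x) * ‖ψ t x‖ ^ 2
      = -∫ t, ∫ x, (∂_{e 0} (∂_{e 0} θ) - ∂_{e 1} (∂_{e 1} θ)) (t, x) * A 0 t x := by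
  have h := hs.wave 0 (extendTest hΩ θ)
  have hd : ∀ v z : ℝ × ℝ, (∂_{v} (∂_{v} (extendTest hΩ θ))) z = (∂_{v} (∂_{v} θ)) z := fun v z ↦ by
    have h1 : ((∂_{v} (extendTest hΩ θ) : 𝓓(slab I, ℝ)) : ℝ × ℝ → ℝ) = (∂_{v} θ : 𝓓(Ω, ℝ)) := by
      ext z
      rw [lineDerivOp_apply, lineDerivOp_apply, coe_extendTest]
    rw [lineDerivOp_apply, lineDerivOp_apply, h1]
  simp only [hd, coe_extendTest, current_zero] at h
  rw [eq_neg_iff_add_eq_zero, ← eq_neg_iff_add_eq_zero.1 h, add_comm]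
  rfl

end

/-! ### Local bounds for the charge -/

/-- Cauchy–Schwarz for a test function supported in `[-r, r]`. -/
theorem norm_integral_smul_sq_le {r : ℝ} {φ : ℝ → ℝ} (hφ : IsTest Set.univ φ)
    (hr : ∀ x, x ∉ Set.Icc (-r) r → φ x = 0) (w : Lp Spinor 2 (volume : Measure ℝ)) :
    ‖∫ x, φ x • w x‖ ^ 2 ≤ (∫ x, φ x ^ 2) * ∫ x in Set.Icc (-r) r, ‖w x‖ ^ 2 := by
  have h1 : MemLp (fun x ↦ |φ x|) 2 volume :=
    (hφ.contDiff.continuous.memLp_of_hasCompactSupport hφ.hasCompactSupport).norm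
  have h2 : MemLp ((Set.Icc (-r) r).indicator fun x ↦ ‖w x‖) 2 volume :=
    (Lp.memLp w).norm.indicator measurableSet_Icc
  have h3 := integral_mul_le_Lp_mul_Lq_of_nonneg (μ := volume) (p := 2) (q := 2)
    Real.HolderConjugate.two_two (ae_of_all _ fun x ↦ abs_nonneg (φ x))
    (ae_of_all _ fun x ↦ Set.indicator_nonneg (fun x _ ↦ norm_nonneg (w x)) x)
    (by simpa using h1) (by simpa using h2)
  have h4 : ‖∫ x, φ x • w x‖ ≤ ∫ x, |φ x| * (Set.Icc (-r) r).indicator (fun x ↦ ‖w x‖) x := by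
    refine (norm_integral_le_integral_norm _).trans_eq (integral_congr_ae (ae_of_all _ fun x ↦ ?_))
    simp only [norm_smul, Real.norm_eq_abs]
    by_cases hx : x ∈ Set.Icc (-r) r
    · rw [Set.indicator_of_mem hx]
    · rw [Set.indicator_of_notMem hx, hr x hx]; simp
  have e2 : ∫ x, (Set.Icc (-r) r).indicator (fun x ↦ ‖w x‖) x ^ (2 : ℝ)
      = ∫ x in Set.Icc (-r) r, ‖w x‖ ^ 2 := by
    rw [← integral_indicator measurableSet_Icc]
    refine integral_congr_ae (ae_of_all _ fun x ↦ ?_)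
    by_cases hx : x ∈ Set.Icc (-r) r
    · simp [hx]
    · simp [hx]
  have e1 : ∫ x, |φ x| ^ (2 : ℝ) = ∫ x, φ x ^ 2 :=
    integral_congr_ae (ae_of_all _ fun x ↦ by simp)
  rw [e1, e2, ← Real.sqrt_eq_rpow, ← Real.sqrt_eq_rpow] at h3
  have p1 : 0 ≤ ∫ x, φ x ^ 2 := integral_nonneg fun _ ↦ sq_nonneg _
  have p2 : 0 ≤ ∫ x in Set.Icc (-r) r, ‖w x‖ ^ 2 := integral_nonneg fun _ ↦ sq_nonneg _
  calc _ ≤ (√(∫ x, φ x ^ 2) * √(∫ x in Set.Icc (-r) r, ‖w x‖ ^ 2)) ^ 2 :=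
        pow_le_pow_left₀ (norm_nonneg _) (h4.trans h3) 2
    _ = _ := by rw [mul_pow, Real.sq_sqrt p1, Real.sq_sqrt p2]

/-- A smooth function with values in `[0, 1]`, equal to `1` on `[-a, a]` and to `0` outside
`[-c, c]`. -/
theorem exists_cutoff {a c : ℝ} (ha : 0 < a) (hac : a < c) : ∃ f : ℝ → ℝ, IsTest Set.univ f ∧
    (∀ x, 0 ≤ f x) ∧ (∀ x, f x ≤ 1) ∧ (∀ x, |x| ≤ a → f x = 1) ∧
    (tsupport f ⊆ Set.Icc (-c) c) := by
  let f : ContDiffBump (0 : ℝ) := ⟨a, c, ha, hac⟩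
  refine ⟨f, ⟨f.contDiff, f.hasCompactSupport, Set.subset_univ _⟩, fun _ ↦ f.nonneg,
    fun _ ↦ f.le_one, fun x hx ↦ f.one_of_mem_closedBall ?_, ?_⟩
  · simpa using hx
  · rw [f.tsupport_eq, Real.closedBall_eq_Icc]; simp [f]

theorem eq_zero_of_tsupport_subset {f : ℝ → ℝ} {s : Set ℝ} (h : tsupport f ⊆ s) {x : ℝ}
    (hx : x ∉ s) : f x = 0 := image_eq_zero_of_notMem_tsupport fun h' ↦ hx (h h')

section

variable {M : ℝ} {I : Opens ℝ} {ψ : ℝ → Lp Spinor 2 (volume : Measure ℝ)}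
  {A : Fin 2 → ℝ → ℝ → ℝ} {b : Fin 2 → 𝓓'((⊤ : Opens ℝ), ℝ)}

theorem integrable_norm_sq (w : Lp Spinor 2 (volume : Measure ℝ)) :
    Integrable fun x ↦ ‖w x‖ ^ 2 :=
  (memLp_two_iff_integrable_sq_norm (Lp.memLp w).1).1 (Lp.memLp w)

theorem integrable_norm_sq_apply (w : Lp Spinor 2 (volume : Measure ℝ)) (k : Fin 2) :
    Integrable fun x ↦ ‖w x k‖ ^ 2 :=
  have h : MemLp (fun x ↦ w x k) 2 volume := (projCLM k).comp_memLp' (Lp.memLp w)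
  (memLp_two_iff_integrable_sq_norm h.1).1 h

theorem IsTest.integrable_mul_of_le_one {f : ℝ → ℝ} (hf : Continuous f) (h0 : ∀ x, 0 ≤ f x)
    (h1 : ∀ x, f x ≤ 1) {v : ℝ → ℝ} (hv : Integrable v) : Integrable fun x ↦ f x * v x :=
  hv.bdd_mul (c := 1) hf.aestronglyMeasurable
    (ae_of_all _ fun x ↦ by rw [Real.norm_of_nonneg (h0 x)]; exact h1 x)

/-- The local charge is bounded by a space-time average of the charge density. -/
theorem IsChargeSolution.local_charge_le (hs : IsChargeSolution M I ψ A b) {r : ℝ} (hr : 0 < r)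
    (hI : Set.Icc (-(2 * r)) (2 * r) ⊆ I) {η ζ : ℝ → ℝ} (hη : IsTest Set.univ η)
    (hζ : IsTest Set.univ ζ) (hη0 : ∀ t, 0 ≤ η t) (hη1 : ∀ t, |t| ≤ r → η t = 1)
    (hηs : tsupport η ⊆ Set.Icc (-(2 * r)) (2 * r)) (hζ0 : ∀ x, 0 ≤ ζ x)
    (hζ1 : ∀ x, |x| ≤ 4 * r → ζ x = 1) {t : ℝ} (ht : |t| ≤ r) :
    ∫ x in Set.Icc (-r) r, ‖ψ t x‖ ^ 2
      ≤ (1 / r + 2 * |M|) * ∫ t, ∫ x, (η t * ζ x) * ‖ψ t x‖ ^ 2 := by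
  set S : ℝ → ℝ := fun t ↦ ∫ x, ζ x * ‖ψ t x‖ ^ 2
  set N : ℝ := ∫ t, ∫ x, (η t * ζ x) * ‖ψ t x‖ ^ 2 with hN
  have hNS : N = ∫ t, η t • S t := by
    rw [hN]
    congr 1; ext t
    simp only [mul_assoc]
    rw [integral_const_mul, smul_eq_mul]
  have hScont : ContinuousOn S I :=
    (isKernel_const (I : Set ℝ) hζ).continuousOn_integral_mul_norm_sq I.isOpen hs.continuous_spinor
  have hS0 : ∀ t, 0 ≤ S t := fun t ↦
    integral_nonneg fun x ↦ mul_nonneg (hζ0 x) (sq_nonneg _)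
  have hIr : Set.Icc (-r) r ⊆ I := (Set.Icc_subset_Icc (by linarith) (by linarith)).trans hI
  have hSint : ∀ s t, s ∈ Set.Icc (-r) r → t ∈ Set.Icc (-r) r → IntervalIntegrable S volume s t :=
    fun s t h1 h2 ↦ (hScont.mono ((Set.ordConnected_Icc.uIcc_subset h1 h2).trans hIr))
      |>.intervalIntegrable
  have hmem : ∀ {s : ℝ}, |s| ≤ r ↔ s ∈ Set.Icc (-r) r := fun {s} ↦ abs_le
  have hint : Integrable fun t ↦ η t • S t :=
    (⟨hη.contDiff, hη.hasCompactSupport, hηs.trans hI⟩ : IsTest I η).integrable_smul I.isOpen hScont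
  have hSN : ∫ t in (-r)..r, S t ≤ N := by
    rw [hNS, intervalIntegral.integral_of_le (by linarith)]
    calc ∫ t in Set.Ioc (-r) r, S t = ∫ t in Set.Ioc (-r) r, η t • S t :=
          setIntegral_congr_fun measurableSet_Ioc fun t ht ↦ by
            simp only [hη1 t (hmem.2 (Set.Ioc_subset_Icc_self ht)), one_smul]
      _ ≤ _ := setIntegral_le_integral hint
          (ae_of_all _ fun t ↦ mul_nonneg (hη0 t) (hS0 t))
  -- During times `|τ| ≤ r` the window moves by at most `r`: it still equals `1` on `[-r, r]`, and
  -- its support stays in `[-4r, 4r]`, where `ζ = 1`.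
  obtain ⟨f, hf, hf0, hf1, hfa, hfs⟩ := exists_cutoff (a := 2 * r) (c := 3 * r) (by linarith)
    (by linarith)
  have hgk : ∀ k, |g k| = 1 := fun k ↦ by fin_cases k <;> simp [g]
  have hfc : ∀ (k : Fin 2) (τ : ℝ), Continuous fun x ↦ f (x - g k * τ) ^ 2 := fun k τ ↦
    (hf.contDiff.continuous.comp (by fun_prop)).pow 2
  have hfi : ∀ (k : Fin 2) (τ : ℝ) {v : ℝ → ℝ}, Integrable v →
      Integrable fun x ↦ f (x - g k * τ) ^ 2 * v x := fun k τ v hv ↦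
    IsTest.integrable_mul_of_le_one (hfc k τ) (fun _ ↦ sq_nonneg _)
      (fun x ↦ pow_le_one₀ (hf0 _) (hf1 _)) hv
  have hζi : ∀ τ, Integrable fun x ↦ ζ x * ‖ψ τ x‖ ^ 2 := fun τ ↦
    (isKernel_const Set.univ hζ).integrable_mul_norm_sq (w := ψ) (t := τ) trivial
  have hfζ : ∀ (k : Fin 2) (τ : ℝ), |τ| ≤ r → ∀ x, f (x - g k * τ) ^ 2 ≤ ζ x := by
    intro k τ hτ x
    by_cases hx : |x| ≤ 4 * r
    · rw [hζ1 x hx]; exact pow_le_one₀ (hf0 _) (hf1 _)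
    · rw [eq_zero_of_tsupport_subset hfs]
      · simpa using hζ0 x
      · intro h
        apply hx
        have h1 : |x - g k * τ| ≤ 3 * r := abs_le.2 h
        have h2 : |g k * τ| ≤ r := by rw [abs_mul, hgk, one_mul]; exact hτ
        calc |x| = |(x - g k * τ) + g k * τ| := by rw [sub_add_cancel]
          _ ≤ _ := abs_add_le _ _
          _ ≤ 4 * r := by linarith
  set E : Fin 2 → ℝ → ℝ := fun k τ ↦ ∫ x, f (x - g k * τ) ^ 2 * ‖ψ τ x k‖ ^ 2
  have hES : ∀ k τ, |τ| ≤ r → E k τ ≤ S τ := by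
    intro k τ hτ
    refine integral_mono (hfi k τ (integrable_norm_sq_apply (ψ τ) k)) (hζi τ) fun x ↦ ?_
    refine mul_le_mul (hfζ k τ hτ x) ?_ (sq_nonneg _) (hζ0 x)
    exact pow_le_pow_left₀ (norm_nonneg _) (PiLp.norm_apply_le _ k) 2
  have hdiff : ∀ k s t, s ∈ Set.Icc (-r) r → t ∈ Set.Icc (-r) r → s ≤ t →
      |E k t - E k s| ≤ |M| * N := by
    intro k s t hs' ht' hst
    refine (hs.abs_energy_sub_le k hf hst (hIr hs') (hIr ht')).trans ?_
    refine mul_le_mul_of_nonneg_left (le_trans ?_ hSN) (abs_nonneg M)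
    calc _ ≤ ∫ τ in s..t, S τ := by
          rw [intervalIntegral.integral_of_le hst, intervalIntegral.integral_of_le hst]
          refine integral_mono_of_nonneg (ae_of_all _ fun τ ↦ integral_nonneg fun x ↦
            mul_nonneg (sq_nonneg _) (sq_nonneg _)) (hSint s t hs' ht').1 ?_
          refine (ae_restrict_iff' measurableSet_Ioc).2 (ae_of_all _ fun τ hτ ↦ ?_)
          have hτr : |τ| ≤ r := hmem.2 ⟨hs'.1.trans hτ.1.le, hτ.2.trans ht'.2⟩
          exact integral_mono (hfi k τ (integrable_norm_sq (ψ τ))) (hζi τ) fun x ↦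
            mul_le_mul_of_nonneg_right (hfζ k τ hτr x) (sq_nonneg _)
      _ ≤ ∫ τ in (-r)..r, S τ := intervalIntegral.integral_mono_interval hs'.1 hst ht'.2
          (ae_of_all _ fun τ ↦ hS0 τ) (hSint _ _ (by simp [hr.le]) (by simp [hr.le]))
  have hEb : ∀ k, E k t ≤ (1 / (2 * r) + |M|) * N := by
    intro k
    -- The energy at time `t` is compared with that at every other time `s`; integrating over `s` in
    -- an interval of length `2 * r` produces the factor `1 / (2 * r)`.
    have hle : ∀ s ∈ Set.Icc (-r) r, E k t - |M| * N ≤ S s := by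
      intro s hs'
      have h1 := hES k s (hmem.2 hs')
      rcases le_total s t with h | h
      · have := (abs_le.1 (hdiff k s t hs' (hmem.1 ht) h)).2
        linarith
      · have := (abs_le.1 (hdiff k t s (hmem.1 ht) hs' h)).1
        linarith
    have h2 := intervalIntegral.integral_mono_on (a := -r) (b := r) (by linarith)
      (by simp) (hSint _ _ (by simp [hr.le]) (by simp [hr.le])) hle
    rw [intervalIntegral.integral_const, smul_eq_mul] at h2
    have h3 : (r - -r) * (E k t - |M| * N) ≤ N := h2.trans hSN
    have h4 : E k t - |M| * N ≤ N / (2 * r) := by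
      rw [le_div_iff₀ (by linarith)]; linarith
    have h5 : (1 / (2 * r) + |M|) * N = N / (2 * r) + |M| * N := by ring
    rw [h5]; linarith
  have hmain : ∫ x in Set.Icc (-r) r, ‖ψ t x‖ ^ 2 ≤ E 0 t + E 1 t := by
    rw [← integral_add (hfi 0 t (integrable_norm_sq_apply (ψ t) 0))
      (hfi 1 t (integrable_norm_sq_apply (ψ t) 1)), ← integral_indicator measurableSet_Icc]
    refine integral_mono ((integrable_norm_sq (ψ t)).indicator measurableSet_Icc)
      ((hfi 0 t (integrable_norm_sq_apply (ψ t) 0)).add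
        (hfi 1 t (integrable_norm_sq_apply (ψ t) 1))) fun x ↦ ?_
    by_cases hx : x ∈ Set.Icc (-r) r
    · have h1 : ∀ k, f (x - g k * t) = 1 := fun k ↦ hfa _ (by
        have h2 : |g k * t| ≤ r := by rw [abs_mul, hgk, one_mul]; exact ht
        have h3 := abs_sub x (g k * t)
        have h4 := hmem.2 hx
        linarith)
      simp only [Set.indicator_of_mem hx, h1, one_pow, one_mul]
      rw [EuclideanSpace.norm_sq_eq, Fin.sum_univ_two]
    · rw [Set.indicator_of_notMem hx]
      exact add_nonneg (mul_nonneg (sq_nonneg _) (sq_nonneg _))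
        (mul_nonneg (sq_nonneg _) (sq_nonneg _))
  have h0 := hEb 0
  have h1 := hEb 1
  have h5 : (1 / r + 2 * |M|) * N = 2 * ((1 / (2 * r) + |M|) * N) := by
    field_simp
  rw [h5]; linarith

end

end

end MaxwellDirac

namespace MaxwellDirac

noncomputable section

/-! ### Data of limit solutions are locally square integrable -/

/-- The box is sized for the supports of the cutoffs in `local_charge_le`: `2 * r` in time, and `5 *
r` in space so that a cutoff can equal `1` on `[-4r, 4r]`. The bound `r ≤ 1` keeps `[-r, r]` inside
the support of the singular datum. -/
theorem exists_box_subset {Ω : Opens (ℝ × ℝ)} (h : ((0 : ℝ), (0 : ℝ)) ∈ Ω) :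
    ∃ r, 0 < r ∧ r ≤ 1 ∧
      Set.Icc (-(2 * r)) (2 * r) ×ˢ Set.Icc (-(5 * r)) (5 * r) ⊆ (Ω : Set (ℝ × ℝ)) := by
  obtain ⟨ε, hε, hball⟩ := Metric.isOpen_iff.1 Ω.isOpen _ h
  have hr : 0 < min (ε / 6) 1 := by positivity
  refine ⟨min (ε / 6) 1, hr, min_le_right _ _, fun z hz ↦ hball ?_⟩
  have h6 : min (ε / 6) 1 ≤ ε / 6 := min_le_left _ _
  rw [Metric.mem_ball, Prod.dist_eq, max_lt_iff, Real.dist_eq, Real.dist_eq, sub_zero, sub_zero,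
    abs_lt, abs_lt]
  obtain ⟨⟨h1, h2⟩, h3, h4⟩ := hz
  exact ⟨⟨by linarith, by linarith⟩, by linarith, by linarith⟩

theorem tsupport_test_subset {φ : ℝ → ℝ} {s : Set ℝ} (hs : IsClosed s)
    (h : ∀ x, x ∉ s → φ x = 0) : tsupport φ ⊆ s :=
  closure_minimal (fun x hx ↦ by
    by_contra h'
    exact hx (h x h')) hs

theorem isTest_of_testFunction (φ : 𝓓((⊤ : Opens ℝ), ℝ)) : IsTest Set.univ φ :=
  ⟨φ.contDiff, φ.hasCompactSupport, Set.subset_univ _⟩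

/-- The test function on `ℝ` with a given underlying function. -/
def IsTest.toTestFunction {f : ℝ → ℝ} (hf : IsTest Set.univ f) : 𝓓((⊤ : Opens ℝ), ℝ) :=
  ⟨f, hf.contDiff, hf.hasCompactSupport, Set.subset_univ _⟩

/-- A weighted time average with nonnegative weights of total mass one cannot exceed the pointwise
bound; `η ≤ 1` keeps the averaging times within `|t| ≤ r`. -/
theorem norm_integral_approx_le {r D η : ℝ} {τ φ : ℝ → ℝ}
    (hτ : IsTest Set.univ τ) (hτ0 : ∀ t, 0 ≤ τ t) (hτ1 : ∫ t, τ t = 1)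
    (hτs : tsupport τ ⊆ Set.Icc (-r) r) (hη : 0 < η) (hη1 : η ≤ 1)
    {ψ : ℝ → Lp Spinor 2 (volume : Measure ℝ)}
    (hD : ∀ t, |t| ≤ r → ‖∫ x, φ x • ψ t x‖ ≤ D) :
    ‖∫ t, ∫ x, (η⁻¹ * τ (t / η) * φ x) • ψ t x‖ ≤ D := by
  have hint : Integrable fun t ↦ τ (t / η) := hτ.integrable.comp_div hη.ne'
  have h1 : ∫ t, η⁻¹ * τ (t / η) * D = D := by
    rw [integral_mul_const, integral_const_mul, Measure.integral_comp_div, hτ1, abs_of_pos hη]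
    field_simp
    simp
  refine (norm_integral_le_of_norm_le ((hint.const_mul η⁻¹).mul_const D)
    (ae_of_all _ fun t ↦ ?_)).trans_eq h1
  simp only [mul_smul (η⁻¹ * τ (t / η))]
  rw [integral_smul, norm_smul, Real.norm_of_nonneg (mul_nonneg (by positivity) (hτ0 _))]
  by_cases ht : |t| ≤ r
  · exact mul_le_mul_of_nonneg_left (hD t ht) (mul_nonneg (by positivity) (hτ0 _))
  · rw [eq_zero_of_tsupport_subset hτs]
    · simp
    · intro h
      apply ht
      have h2 : |t / η| ≤ r := abs_le.2 h
      rw [abs_div, abs_of_pos hη, div_le_iff₀ hη] at h2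
      nlinarith [abs_nonneg (t / η), abs_le.2 h]

/-- The initial spinor of a local limit solution is square integrable near the origin. -/
theorem HasLocalLimitSolution.exists_norm_sq_le {M : ℝ} {d : CauchyData}
    (h : HasLocalLimitSolution M d) : ∃ r, 0 < r ∧ r ≤ 1 ∧ ∃ C, 0 ≤ C ∧
      ∀ φ : 𝓓((⊤ : Opens ℝ), ℝ), (∀ x, x ∉ Set.Icc (-r) r → φ x = 0) →
        ‖d.ψ₀ φ‖ ^ 2 ≤ C * ∫ x, φ x ^ 2 := by
  obtain ⟨Ω, Ψ, 𝒜, h0, ι, l, I, ψ, A, b, hl, hs, hΩ, hconv, hdata⟩ := h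
  obtain ⟨r, hr, hr1, hbox⟩ := exists_box_subset h0
  obtain ⟨η, hη, hη0, -, hη1, hηs⟩ := exists_cutoff (a := r) (c := 2 * r) hr (by linarith)
  obtain ⟨ζ, hζ, hζ0, -, hζ1, hζs⟩ := exists_cutoff (a := 4 * r) (c := 5 * r) (by linarith)
    (by linarith)
  let θ : 𝓓(Ω, ℝ) := mkTest (fun z ↦ η z.1 * ζ z.2)
    ((hη.contDiff.comp contDiff_fst).mul (hζ.contDiff.comp contDiff_snd))
    (isCompact_Icc.prod isCompact_Icc) hbox fun z hz ↦ by
      by_contra hne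
      refine hz ⟨?_, ?_⟩ <;> by_contra h
      · exact hne (by rw [eq_zero_of_tsupport_subset hηs h, zero_mul])
      · exact hne (by rw [eq_zero_of_tsupport_subset hζs h, mul_zero])
  set T := -(𝒜 0 (∂_{e 0} (∂_{e 0} θ) - ∂_{e 1} (∂_{e 1} θ)))
  have hlim : Tendsto (fun i ↦ ∫ t, ∫ x, (η t * ζ x) * ‖ψ i t x‖ ^ 2) l (𝓝 T) := by
    have := ((hconv (∂_{e 0} (∂_{e 0} θ) - ∂_{e 1} (∂_{e 1} θ))).2 0).neg
    refine this.congr fun i ↦ ?_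
    rw [← (hs i).integral_norm_sq_eq (hΩ i) θ]
    rfl
  have hIi : ∀ i, Set.Icc (-(2 * r)) (2 * r) ⊆ (I i : Set ℝ) := fun i t ht ↦ by
    have : ((t, 0) : ℝ × ℝ) ∈ Ω := hbox ⟨ht, by constructor <;> simp <;> linarith⟩
    exact (hΩ i this).1
  set B := 1 / r + 2 * |M| with hB
  have hB0 : 0 ≤ B := by positivity
  have hT0 : 0 ≤ T := ge_of_tendsto' hlim fun i ↦ integral_nonneg fun t ↦ integral_nonneg fun x ↦
    mul_nonneg (mul_nonneg (hη0 _) (hζ0 _)) (sq_nonneg _)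
  set C := B * (T + 1)
  have hC : 0 ≤ C := by positivity
  -- The tested charge converges to `T`, hence is eventually at most `T + 1`. The resulting bound is
  -- uniform in `t` and independent of `φ`.
  have hev : ∀ᶠ i in l, ∀ t, |t| ≤ r → ∫ x in Set.Icc (-r) r, ‖ψ i t x‖ ^ 2 ≤ C := by
    filter_upwards [hlim.eventually_le_const (lt_add_one T)] with i hi t ht
    exact ((hs i).local_charge_le hr (hIi i) hη hζ hη0 hη1 hηs hζ0 hζ1 ht).trans
      (mul_le_mul_of_nonneg_left hi hB0)
  refine ⟨r, hr, hr1, C, hC, fun φ hφ ↦ ?_⟩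
  have hφt := isTest_of_testFunction φ
  have hP : 0 ≤ ∫ x, φ x ^ 2 := integral_nonneg fun _ ↦ sq_nonneg _
  have hbd : ∀ᶠ i in l, ∀ t, |t| ≤ r → ‖∫ x, φ x • ψ i t x‖ ^ 2 ≤ C * ∫ x, φ x ^ 2 := by
    filter_upwards [hev] with i hi t ht
    refine (norm_integral_smul_sq_le hφt hφ (ψ i t)).trans ?_
    rw [mul_comm]
    exact mul_le_mul_of_nonneg_right (hi t ht) hP
  have hφΩ : tsupport φ ⊆ initialSlice Ω := (tsupport_test_subset isClosed_Icc hφ).trans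
    fun x hx ↦ hbox ⟨by constructor <;> simp <;> linarith, by
      constructor <;> [linarith [hx.1]; linarith [hx.2]]⟩
  -- If the data converge, the bound at `t = 0` passes to the limit directly. If only the limit
  -- attains the data, the bound is used for averages over short times: the limit along the
  -- solutions is taken first, then that of the averaging scale.
  rcases hdata with hdata | hdata
  · refine le_of_tendsto ((hdata φ hφΩ).1.norm.pow 2) ?_
    filter_upwards [hbd] with i hi using hi 0 (by simpa using hr.le)
  · have hD : ∀ᶠ i in l, ∀ t, |t| ≤ r → ‖∫ x, φ x • ψ i t x‖ ≤ √(C * ∫ x, φ x ^ 2) := by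
      filter_upwards [hbd] with i hi t ht using Real.le_sqrt_of_sq_le (hi t ht)
    let τ : ContDiffBump (0 : ℝ) := ⟨r / 2, r, by linarith, by linarith⟩
    have hτ : IsTest Set.univ (τ.normed volume) :=
      ⟨τ.contDiff_normed, τ.hasCompactSupport_normed, Set.subset_univ _⟩
    have hτs : tsupport (τ.normed volume) ⊆ Set.Icc (-r) r := by
      rw [τ.tsupport_normed_eq, Real.closedBall_eq_Icc]
      simp [τ]
    set ε : ℕ → ℝ := fun n ↦ 1 / ((n : ℝ) + 1)
    have hε : ∀ n, 0 < ε n := fun n ↦ by positivity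
    have hε1 : ∀ n, ε n ≤ 1 := fun n ↦ by
      simp only [ε]
      rw [div_le_one (by positivity)]
      linarith [(Nat.cast_nonneg n : (0 : ℝ) ≤ n)]
    let θ' : ℕ → 𝓓(Ω, ℝ) := fun n ↦
      mkTest (fun z ↦ (ε n)⁻¹ * τ.normed volume (z.1 / ε n) * φ z.2)
      ((contDiff_const.mul (hτ.contDiff.comp (contDiff_fst.div_const _))).mul
        (hφt.contDiff.comp contDiff_snd))
      (isCompact_Icc.prod isCompact_Icc) hbox fun z hz ↦ by
        by_contra hne
        refine hz ⟨?_, ?_⟩ <;> by_contra h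
        · refine hne ?_
          rw [eq_zero_of_tsupport_subset hτs, mul_zero, zero_mul]
          intro h'
          have h2 : |z.1 / ε n| ≤ r := abs_le.2 h'
          rw [abs_div, abs_of_pos (hε n), div_le_iff₀ (hε n)] at h2
          have h3 : |z.1| ≤ 2 * r := by nlinarith [hε1 n]
          exact h (abs_le.1 h3)
        · refine hne ?_
          rw [hφ z.2 fun h' ↦ h ⟨by linarith [h'.1], by linarith [h'.2]⟩, mul_zero]
    have hlim' := hdata.1 φ hτ.toTestFunction ε θ' hφΩ τ.integral_normed hε
      tendsto_one_div_add_atTop_nhds_zero_nat fun n t x ↦ rfl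
    have hle : ∀ n, ‖Ψ (θ' n)‖ ≤ √(C * ∫ x, φ x ^ 2) := fun n ↦ by
      refine le_of_tendsto (hconv (θ' n)).1.norm ?_
      filter_upwards [hD] with i hi
      exact norm_integral_approx_le hτ τ.nonneg_normed τ.integral_normed hτs (hε n) (hε1 n) hi
    have := le_of_tendsto' hlim'.norm hle
    calc ‖d.ψ₀ φ‖ ^ 2 ≤ √(C * ∫ x, φ x ^ 2) ^ 2 := pow_le_pow_left₀ (norm_nonneg _) this 2
      _ = _ := Real.sq_sqrt (mul_nonneg hC hP)

/-! ### The singular datum is not square integrable near the origin -/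

theorem integral_one_div_add {ε a : ℝ} (hε : 0 < ε) (ha : 0 ≤ a) :
    ∫ x in (0 : ℝ)..a, 1 / (ε + x) = Real.log (1 + a / ε) := by
  rw [intervalIntegral.integral_comp_add_left (fun x ↦ 1 / x), integral_one_div_of_pos (by linarith)
    (by linarith)]
  rw [add_zero, add_div, div_self hε.ne']

theorem apply_spinorData_zero (x : ℝ) (k : Fin 2) :
    spinorData 0 x k = ((halfSingularity x + halfSingularity (-x) : ℝ) : ℂ) := by
  rw [spinorData_zero_eq]
  fin_cases k <;> simp

/-- A smooth minorant of `|x|^{-1/2}`, from which admissible test functions are built. The origin is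
excluded because the right-hand side has the default value `0` there. -/
theorem rpow_le_halfSingularity_add {ε x : ℝ} (hx : x ≠ 0) (hx1 : |x| ≤ 1) :
    (ε ^ 2 + x ^ 2) ^ (-(1 / 4) : ℝ) ≤ halfSingularity x + halfSingularity (-x) := by
  have key : ∀ y : ℝ, 0 < y → y ≤ 1 → (ε ^ 2 + y ^ 2) ^ (-(1 / 4) : ℝ) ≤ halfSingularity y := by
    intro y hy hy1
    have : halfSingularity y = (y ^ 2) ^ (-(1 / 4) : ℝ) := by
      rw [halfSingularity, Set.indicator_of_mem (show y ∈ Set.Ioc (0 : ℝ) 1 from ⟨hy, hy1⟩),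
        ← Real.rpow_natCast, ← Real.rpow_mul hy.le]
      norm_num
    rw [this]
    exact Real.rpow_le_rpow_of_nonpos (by positivity) (by nlinarith [sq_nonneg ε]) (by norm_num)
  rcases lt_or_gt_of_ne hx with h | h
  · have h1 := key (-x) (by linarith) (by rwa [abs_of_neg h] at hx1)
    rw [neg_sq] at h1
    linarith [halfSingularity_nonneg x]
  · have h1 := key x h (by rwa [abs_of_pos h] at hx1)
    linarith [halfSingularity_nonneg (-x)]

theorem one_div_add_le_rpow {ε x : ℝ} (hε : 0 < ε) (hx : 0 ≤ x) :
    1 / (ε + x) ≤ ((ε ^ 2 + x ^ 2) ^ (-(1 / 4) : ℝ)) ^ 2 := by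
  rw [← Real.rpow_mul_natCast (by positivity), show (-(1 / 4) * (2 : ℕ) : ℝ) = -(1 / 2) by norm_num,
    one_div, ← Real.rpow_neg_one]
  have : (ε + x) ^ (-1 : ℝ) = ((ε + x) ^ 2) ^ (-(1 / 2) : ℝ) := by
    rw [← Real.rpow_natCast, ← Real.rpow_mul (by positivity)]
    norm_num
  rw [this]
  exact Real.rpow_le_rpow_of_nonpos (by positivity) (by nlinarith) (by norm_num)

/-- The datum is tested against a cut-off regularisation `φ` of itself. Since `φ` lies below the
datum, the pairing is at least `N = ∫ φ²`, while local square integrability bounds its square by `C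
* N`. So `N ≤ C`, although `N` grows like `log (1/ε)`. -/
theorem not_hasLocalLimitSolution_badData (M : ℝ) : ¬ HasLocalLimitSolution M badData := by
  intro h
  obtain ⟨r, hr, hr1, C, hC, hbound⟩ := h.exists_norm_sq_le
  obtain ⟨f, hf, hf0, hf1, hfa, hfs⟩ := exists_cutoff (a := r / 2) (c := r) (by linarith)
    (by linarith)
  have key : ∀ ε : ℝ, 0 < ε → Real.log (1 + r / 2 / ε) ≤ C := by
    intro ε hε
    have hw : ContDiff ℝ ∞ fun x : ℝ ↦ (ε ^ 2 + x ^ 2) ^ (-(1 / 4) : ℝ) :=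
      ContDiff.rpow_const_of_ne (by fun_prop) fun x ↦ by positivity
    have hw0 : ∀ x : ℝ, 0 ≤ (ε ^ 2 + x ^ 2) ^ (-(1 / 4) : ℝ) := fun x ↦ by positivity
    set φ : ℝ → ℝ := (fun x : ℝ ↦ (ε ^ 2 + x ^ 2) ^ (-(1 / 4) : ℝ)) * f with hφdef
    have hφ : IsTest Set.univ φ :=
      ⟨hw.mul hf.contDiff, hf.hasCompactSupport.mul_left, Set.subset_univ _⟩
    have hφ0 : ∀ x, 0 ≤ φ x := fun x ↦ mul_nonneg (hw0 x) (hf0 x)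
    have hφz : ∀ x, x ∉ Set.Icc (-r) r → φ x = 0 := fun x hx ↦ by
      rw [hφdef, Pi.mul_apply, eq_zero_of_tsupport_subset hfs hx, mul_zero]
    have hφ2 : Integrable fun x ↦ φ x ^ 2 := by
      simpa only [pow_two] using! (hφ.mul hφ).integrable
    have h1 := hbound hφ.toTestFunction hφz
    have e1 : badData.ψ₀ hφ.toTestFunction = ∫ x, φ x • spinorData 0 x :=
      regular_apply integrable_spinorData_zero.locallyIntegrable _
    have hi : Integrable fun x ↦ φ x • spinorData 0 x := by
      obtain ⟨K, hK⟩ :=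
        hφ.contDiff.continuous.bounded_above_of_compact_support hφ.hasCompactSupport
      exact integrable_spinorData_zero.bdd_smul K hφ.contDiff.continuous.aestronglyMeasurable
        (ae_of_all _ hK)
    set k : ℝ → ℝ := fun x ↦ halfSingularity x + halfSingularity (-x)
    have hcomp : (∫ x, φ x • spinorData 0 x) 0 = ((∫ x, φ x * k x : ℝ) : ℂ) := by
      rw [← projCLM_apply, ← ContinuousLinearMap.integral_comp_comm _ hi, ← integral_complex_ofReal]
      refine integral_congr_ae (ae_of_all _ fun x ↦ ?_)
      simp only [map_smul, projCLM_apply, apply_spinorData_zero, k]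
      simp
      ring
    have hik : Integrable fun x ↦ φ x * k x := by
      have := ((projCLM 0).integrable_comp hi).re
      refine this.congr (ae_of_all _ fun x ↦ ?_)
      simp only [map_smul, projCLM_apply, apply_spinorData_zero, k]
      simp
      ring
    have hle : ∫ x, φ x ^ 2 ≤ ∫ x, φ x * k x := by
      refine integral_mono_ae hφ2 hik ?_
      have hne : ∀ᵐ x : ℝ, x ≠ 0 := by simp [ae_iff]
      filter_upwards [hne] with x hx
      rw [pow_two]
      by_cases hxr : x ∈ Set.Icc (-r) r
      · refine mul_le_mul_of_nonneg_left ?_ (hφ0 x)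
        calc φ x ≤ (ε ^ 2 + x ^ 2) ^ (-(1 / 4) : ℝ) * 1 :=
              mul_le_mul_of_nonneg_left (hf1 x) (hw0 x)
          _ ≤ k x := by
              rw [mul_one]
              exact rpow_le_halfSingularity_add hx ((abs_le.2 hxr).trans hr1)
      · rw [hφz x hxr]; simp
    set N := ∫ x, φ x ^ 2
    have hN0 : 0 ≤ N := integral_nonneg fun _ ↦ sq_nonneg _
    have h2 : N ^ 2 ≤ C * N := by
      calc N ^ 2 ≤ ‖(∫ x, φ x • spinorData 0 x) 0‖ ^ 2 := by
            refine pow_le_pow_left₀ hN0 ?_ 2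
            rw [hcomp, Complex.norm_real]
            exact hle.trans (le_abs_self _)
        _ ≤ ‖∫ x, φ x • spinorData 0 x‖ ^ 2 :=
            pow_le_pow_left₀ (norm_nonneg _) (PiLp.norm_apply_le _ 0) 2
        _ ≤ C * N := by rw [← e1]; exact h1
    have h3 : N ≤ C := by
      rcases hN0.eq_or_lt with h | h
      · rwa [← h]
      · rw [pow_two] at h2; exact le_of_mul_le_mul_right h2 h
    refine le_trans ?_ h3
    rw [← integral_one_div_add hε (by linarith), intervalIntegral.integral_of_le (by linarith)]
    calc ∫ x in Set.Ioc 0 (r / 2), 1 / (ε + x) ≤ ∫ x in Set.Ioc 0 (r / 2), φ x ^ 2 := by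
          refine setIntegral_mono_on ?_ hφ2.integrableOn measurableSet_Ioc fun x hx ↦ ?_
          · refine (ContinuousOn.integrableOn_Icc ?_).mono_set Set.Ioc_subset_Icc_self
            exact continuousOn_const.div (by fun_prop) fun x hx ↦ by linarith [hx.1]
          · have : φ x = (ε ^ 2 + x ^ 2) ^ (-(1 / 4) : ℝ) := by
              rw [hφdef, Pi.mul_apply, hfa x (by rw [abs_of_pos hx.1]; exact hx.2), mul_one]
            rw [this]
            exact one_div_add_le_rpow hε hx.1.le
      _ ≤ N := setIntegral_le_integral hφ2 (ae_of_all _ fun _ ↦ sq_nonneg _)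
  -- This `ε` makes the logarithm exceed `C + 1`.
  have h1 := key (r / 2 / (Real.exp (C + 1))) (by positivity)
  have h2 : r / 2 / (r / 2 / Real.exp (C + 1)) = Real.exp (C + 1) := by
    field_simp
  rw [h2] at h1
  have h3 : Real.log (Real.exp (C + 1)) ≤ Real.log (1 + Real.exp (C + 1)) :=
    Real.log_le_log (Real.exp_pos _) (by linarith)
  rw [Real.log_exp] at h3
  linarith

/-- Vanishing potentials belong to every subspace, so `D₀` and `D₁` may be arbitrary. -/
theorem badData_mem_dataSpace {S : Set 𝓓'((⊤ : Opens ℝ), Spinor)} (h : badData.ψ₀ ∈ S)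
    (D₀ D₁ : Submodule ℝ 𝓓'((⊤ : Opens ℝ), ℝ)) : badData ∈ dataSpace S D₀ D₁ :=
  ⟨h, fun _ ↦ ⟨D₀.zero_mem, D₁.zero_mem⟩⟩

end

end MaxwellDirac

namespace MaxwellDirac

noncomputable section

/-! ### Integrals of continuous functions against kernels -/

namespace IsKernel

variable {I : Set ℝ} {κ σ B : ℝ → ℝ → ℝ} {s t : ℝ}

theorem integrable_mul (h : IsKernel I κ) (ht : t ∈ I)
    (hB : ContinuousOn (fun z : ℝ × ℝ ↦ B z.1 z.2) (I ×ˢ Set.univ)) (hs : s ∈ I) :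
    Integrable fun y ↦ κ t y * B s y := by
  have hBs : Continuous (B s) :=
    continuousOn_univ.1 (hB.comp (f := fun y ↦ (s, y)) (by fun_prop) fun _ _ ↦ ⟨hs, trivial⟩)
  exact ((h.continuous ht).mul hBs).integrable_of_hasCompactSupport (h.hasCompactSupport ht).mul_right

theorem continuousOn_integral_mul (h : IsKernel I κ)
    (hB : ContinuousOn (fun z : ℝ × ℝ ↦ B z.1 z.2) (I ×ˢ Set.univ)) :
    ContinuousOn (fun t ↦ ∫ y, κ t y * B t y) I := by
  obtain ⟨K, hK, h0⟩ := h.exists_isCompact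
  exact continuousOn_integral_of_compact_support hK (h.continuousOn.mul hB)
    fun t y ht hy ↦ by rw [h0 t ht y hy, zero_mul]

/-- The derivative at `s` of `t ↦ ∫ κ t * B t`, where `B` is merely continuous and `κ` has the
difference quotient `σ`. -/
theorem hasDerivAt_integral_mul (h : IsKernel I κ) (hσ : IsKernel I σ) (hI : IsOpen I)
    (hB : ContinuousOn (fun z : ℝ × ℝ ↦ B z.1 z.2) (I ×ˢ Set.univ)) (hs : s ∈ I)
    (hquot : ∀ t y, κ t y - κ s y = (t - s) * σ t y) {d : ℝ}
    (hd : HasDerivAt (fun t ↦ ∫ y, κ s y * B t y) d s) :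
    HasDerivAt (fun t ↦ ∫ y, κ t y * B t y) (d + ∫ y, σ s y * B s y) s := by
  have hc : ContinuousAt (fun t ↦ ∫ y, σ t y * B t y) s :=
    (hσ.continuousOn_integral_mul hB).continuousAt (hI.mem_nhds hs)
  -- A product of `t - s` with a function continuous at `s` is differentiable there, so no
  -- derivative of `B` is required for this term.
  have h1 : HasDerivAt (fun t ↦ (t - s) * ∫ y, σ t y * B t y) (∫ y, σ s y * B s y) s := by
    rw [hasDerivAt_iff_tendsto_slope]
    refine (hc.tendsto.mono_left nhdsWithin_le_nhds).congr' ?_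
    filter_upwards [self_mem_nhdsWithin] with t ht
    have : t - s ≠ 0 := sub_ne_zero.2 ht
    simp only [slope_def_field, sub_self, zero_mul, sub_zero]
    field_simp
  refine (hd.add h1).congr_of_eventuallyEq ?_
  filter_upwards [hI.mem_nhds hs] with t ht
  simp only [Pi.add_apply]
  rw [← integral_const_mul, ← integral_add (h.integrable_mul hs hB ht)
    ((hσ.integrable_mul ht hB ht).const_mul _)]
  refine integral_congr_ae (ae_of_all _ fun y ↦ ?_)
  linear_combination B t y * hquot t y

theorem of_abs_le {L : ℝ} (h : ContinuousOn (fun z : ℝ × ℝ ↦ κ z.1 z.2) (I ×ˢ Set.univ))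
    (h0 : ∀ t ∈ I, ∀ y, L < |y| → κ t y = 0) : IsKernel I κ :=
  ⟨h, Metric.closedBall 0 L, isCompact_closedBall _ _, fun t ht y hy ↦ h0 t ht y (by
    simpa using hy)⟩

end IsKernel

/-! ### Solutions of the wave equation that vanish at a given time -/

/-- A smooth monotone function with values `0` on `(-∞, -h]` and `1` on `[h, ∞)`. -/
structure IsStep (h : ℝ) (R : ℝ → ℝ) : Prop where
  contDiff : ContDiff ℝ ∞ R
  monotone : Monotone R
  eq_zero : ∀ x ≤ -h, R x = 0
  eq_one : ∀ x, h ≤ x → R x = 1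

theorem exists_isStep {h : ℝ} (hh : 0 < h) : ∃ R, IsStep h R := by
  refine ⟨fun x ↦ Real.smoothTransition ((x + h) / (2 * h)),
    Real.smoothTransition.contDiff.comp (by fun_prop), fun x y hxy ↦
    Real.smoothTransition.monotone (by gcongr), fun x hx ↦ ?_, fun x hx ↦ ?_⟩
  · exact Real.smoothTransition.zero_of_nonpos
      (div_nonpos_of_nonpos_of_nonneg (by linarith) (by linarith))
  · exact Real.smoothTransition.one_of_one_le (by rw [le_div_iff₀ (by linarith)]; linarith)

/-- The solution of the wave equation that vanishes for `t = (b - a) / 2` and has there the velocity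
`-deriv R`, centred at `(a + b) / 2`. -/
def pulse (R : ℝ → ℝ) (a b t y : ℝ) : ℝ := (R (y - a - t) - R (y - b + t)) / 2

/-- The time derivative of `pulse`. -/
def pulseDeriv (R : ℝ → ℝ) (a b t y : ℝ) : ℝ := -(deriv R (y - a - t) + deriv R (y - b + t)) / 2

/-- The difference quotient in time of `pulse` at `s`. -/
def pulseSlope (R : ℝ → ℝ) (a b s t y : ℝ) : ℝ :=
  -((∫ u in (0 : ℝ)..1, deriv R (y - a - s - u * (t - s)))
    + ∫ u in (0 : ℝ)..1, deriv R (y - b + s + u * (t - s))) / 2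

namespace IsStep

variable {h : ℝ} {R : ℝ → ℝ}

theorem nonneg (hR : IsStep h R) (x : ℝ) : 0 ≤ R x := by
  rw [← hR.eq_zero (min x (-h)) (min_le_right _ _)]
  exact hR.monotone (min_le_left _ _)

theorem le_one (hR : IsStep h R) (x : ℝ) : R x ≤ 1 := by
  rw [← hR.eq_one (max x h) (le_max_right _ _)]
  exact hR.monotone (le_max_left _ _)

protected theorem hasDerivAt (hR : IsStep h R) (x : ℝ) : HasDerivAt R (deriv R x) x :=
  (hR.contDiff.differentiable (by simp) x).hasDerivAt

theorem contDiff_deriv (hR : IsStep h R) : ContDiff ℝ ∞ (deriv R) :=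
  (contDiff_infty_iff_deriv.1 hR.contDiff).2

theorem hasDerivAt_deriv (hR : IsStep h R) (x : ℝ) :
    HasDerivAt (deriv R) (deriv (deriv R) x) x :=
  (hR.contDiff_deriv.differentiable (by simp) x).hasDerivAt

theorem deriv_eq_zero (hR : IsStep h R) {x : ℝ} (hx : h < |x|) : deriv R x = 0 := by
  rcases lt_abs.1 hx with hx | hx
  · have : R =ᶠ[𝓝 x] fun _ ↦ 1 := by
      filter_upwards [lt_mem_nhds hx] with y hy using hR.eq_one y hy.le
    rw [this.deriv_eq, deriv_const]
  · have : R =ᶠ[𝓝 x] fun _ ↦ 0 := by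
      filter_upwards [gt_mem_nhds (show x < -h by linarith)] with y hy using hR.eq_zero y hy.le
    rw [this.deriv_eq, deriv_const]

theorem deriv_nonneg (hR : IsStep h R) (x : ℝ) : 0 ≤ deriv R x := hR.monotone.deriv_nonneg

theorem isTest_deriv (hR : IsStep h R) : IsTest Set.univ (deriv R) :=
  ⟨hR.contDiff_deriv, HasCompactSupport.intro (isCompact_closedBall 0 h) fun x hx ↦
    hR.deriv_eq_zero (by simpa using hx), Set.subset_univ _⟩

theorem integral_deriv (hR : IsStep h R) : ∫ x, deriv R x = 1 := by
  have h0 : Tendsto R atBot (𝓝 0) := by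
    refine tendsto_const_nhds.congr' ?_
    filter_upwards [eventually_le_atBot (-h)] with x hx using (hR.eq_zero x hx).symm
  have h1 : Tendsto R atTop (𝓝 1) := by
    refine tendsto_const_nhds.congr' ?_
    filter_upwards [eventually_ge_atTop h] with x hx using (hR.eq_one x hx).symm
  rw [integral_of_hasDerivAt_of_tendsto hR.hasDerivAt hR.isTest_deriv.integrable h0 h1, sub_zero]

/-- Hadamard's form of the difference quotient, which stays continuous where the increment vanishes.
-/
theorem sub_eq_mul_integral (hR : IsStep h R) (x k : ℝ) :
    R (x + k) - R x = k * ∫ u in (0 : ℝ)..1, deriv R (x + u * k) := by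
  have h1 := intervalIntegral.integral_eq_sub_of_hasDerivAt (a := 0) (b := 1)
    (f := fun u ↦ R (x + u * k)) (f' := fun u ↦ deriv R (x + u * k) * k)
    (fun u _ ↦ (hR.hasDerivAt (x + u * k)).comp u
      (by simpa using ((hasDerivAt_id u).mul_const k).const_add x))
    ((((hR.contDiff_deriv.continuous.comp (by fun_prop)).mul continuous_const)).intervalIntegrable
      _ _)
  rw [intervalIntegral.integral_mul_const] at h1
  simp only [one_mul, zero_mul, add_zero] at h1
  linarith

theorem pulse_sub_pulse (hR : IsStep h R) (a b s t y : ℝ) :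
    pulse R a b t y - pulse R a b s y = (t - s) * pulseSlope R a b s t y := by
  have h1 := hR.sub_eq_mul_integral (y - a - s) (-(t - s))
  have h2 := hR.sub_eq_mul_integral (y - b + s) (t - s)
  simp only [mul_neg, ← sub_eq_add_neg] at h1
  rw [show y - a - s - (t - s) = y - a - t by ring] at h1
  rw [show y - b + s + (t - s) = y - b + t by ring] at h2
  simp only [pulse, pulseSlope]
  linear_combination (h1 - h2) / 2

theorem pulseSlope_self (a b s y : ℝ) : pulseSlope R a b s s y = pulseDeriv R a b s y := by
  simp [pulseSlope, pulseDeriv]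

variable {U : Set ℝ} {a b : ℝ}

theorem isKernel_pulse (hR : IsStep h R) (hU : Bornology.IsBounded U) :
    IsKernel U (pulse R a b) := by
  have := hR.contDiff.continuous
  obtain ⟨T, hT⟩ := hU.exists_norm_le
  refine IsKernel.of_abs_le (L := |h| + |a| + |b| + T) (by unfold pulse; fun_prop)
    fun t ht y hy ↦ ?_
  have h1 := abs_le.1 (hT t ht)
  have := le_abs_self a; have := neg_abs_le a; have := le_abs_self b; have := neg_abs_le b
  have := le_abs_self h; have := abs_nonneg a; have := abs_nonneg b
  rcases lt_abs.1 hy with hy | hy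
  · rw [pulse, hR.eq_one _ (by linarith), hR.eq_one _ (by linarith)]; simp
  · rw [pulse, hR.eq_zero _ (by linarith), hR.eq_zero _ (by linarith)]; simp

theorem isKernel_pulseDeriv (hR : IsStep h R) (hU : Bornology.IsBounded U) :
    IsKernel U (pulseDeriv R a b) := by
  have := hR.contDiff_deriv.continuous
  obtain ⟨T, hT⟩ := hU.exists_norm_le
  refine IsKernel.of_abs_le (L := |h| + |a| + |b| + T) (by unfold pulseDeriv; fun_prop)
    fun t ht y hy ↦ ?_
  have h1 := abs_le.1 (hT t ht)
  have := le_abs_self a; have := neg_abs_le a; have := le_abs_self b; have := neg_abs_le b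
  have := le_abs_self h; have := abs_nonneg a; have := abs_nonneg b
  rcases lt_abs.1 hy with hy | hy
  · rw [pulseDeriv, hR.deriv_eq_zero (lt_abs.2 (Or.inl (by linarith))),
      hR.deriv_eq_zero (lt_abs.2 (Or.inl (by linarith)))]; simp
  · rw [pulseDeriv, hR.deriv_eq_zero (lt_abs.2 (Or.inr (by linarith))),
      hR.deriv_eq_zero (lt_abs.2 (Or.inr (by linarith)))]; simp

theorem isKernel_pulseSlope (hR : IsStep h R) (hU : Bornology.IsBounded U) {s : ℝ} (hs : s ∈ U) :
    IsKernel U (pulseSlope R a b s) := by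
  have hc := hR.contDiff_deriv.continuous
  obtain ⟨T, hT⟩ := hU.exists_norm_le
  -- Besides `|s| ≤ T`, the shift `u * (t - s)` contributes up to `2 * T`.
  refine IsKernel.of_abs_le (L := |h| + |a| + |b| + 3 * T) ?_ fun t ht y hy ↦ ?_
  · unfold pulseSlope
    refine Continuous.continuousOn ?_
    have c1 : Continuous fun z : ℝ × ℝ ↦
        ∫ u in (0 : ℝ)..1, deriv R (z.2 - a - s - u * (z.1 - s)) :=
      intervalIntegral.continuous_parametric_intervalIntegral_of_continuous' (by fun_prop) _ _
    have c2 : Continuous fun z : ℝ × ℝ ↦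
        ∫ u in (0 : ℝ)..1, deriv R (z.2 - b + s + u * (z.1 - s)) :=
      intervalIntegral.continuous_parametric_intervalIntegral_of_continuous' (by fun_prop) _ _
    fun_prop
  · have h1 := abs_le.1 (hT t ht)
    have h2 := abs_le.1 (hT s hs)
    have := le_abs_self a; have := neg_abs_le a; have := le_abs_self b; have := neg_abs_le b
    have := le_abs_self h; have := abs_nonneg a; have := abs_nonneg b
    have hu : ∀ u ∈ Set.uIcc (0 : ℝ) 1, |u * (t - s)| ≤ 2 * T := fun u hu ↦ by
      rw [Set.uIcc_of_le zero_le_one] at hu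
      rw [abs_mul, abs_of_nonneg hu.1]
      have h3 : |t - s| ≤ 2 * T := abs_le.2 ⟨by linarith, by linarith⟩
      nlinarith [abs_nonneg (t - s), hu.2]
    have z1 : ∀ u ∈ Set.uIcc (0 : ℝ) 1, deriv R (y - a - s - u * (t - s)) = 0 := fun u hu' ↦ by
      have h3 := abs_le.1 (hu u hu')
      rcases lt_abs.1 hy with hy | hy
      · exact hR.deriv_eq_zero (lt_abs.2 (Or.inl (by linarith)))
      · exact hR.deriv_eq_zero (lt_abs.2 (Or.inr (by linarith)))
    have z2 : ∀ u ∈ Set.uIcc (0 : ℝ) 1, deriv R (y - b + s + u * (t - s)) = 0 := fun u hu' ↦ by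
      have h3 := abs_le.1 (hu u hu')
      rcases lt_abs.1 hy with hy | hy
      · exact hR.deriv_eq_zero (lt_abs.2 (Or.inl (by linarith)))
      · exact hR.deriv_eq_zero (lt_abs.2 (Or.inr (by linarith)))
    simp [pulseSlope, intervalIntegral.integral_congr z1, intervalIntegral.integral_congr z2]

theorem pulse_nonneg (hR : IsStep h R) {t : ℝ} (ht : 2 * t ≤ b - a) (y : ℝ) :
    0 ≤ pulse R a b t y :=
  div_nonneg (sub_nonneg.2 (hR.monotone (by linarith))) zero_le_two

theorem two_mul_pulse_le_one (hR : IsStep h R) (t y : ℝ) : 2 * pulse R a b t y ≤ 1 := by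
  rw [pulse]
  linarith [hR.le_one (y - a - t), hR.nonneg (y - b + t)]

/-- Twice the pulse is a smoothed indicator of the cone between the rays from `a` and `b`; inside,
at distance `h` from the sides, both steps are saturated. -/
theorem two_mul_pulse_eq_one (hR : IsStep h R) {t y : ℝ} (h1 : a + t + h ≤ y)
    (h2 : y ≤ b - t - h) : 2 * pulse R a b t y = 1 := by
  rw [pulse, hR.eq_one _ (by linarith), hR.eq_zero _ (by linarith)]; norm_num

end IsStep

end

end MaxwellDirac

/-! ### d'Alembert's formula for `A 0 - A 1` in mollified form -/

namespace MaxwellDirac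

noncomputable section

section

variable {M : ℝ} {I : Opens ℝ} {ψ : ℝ → Lp Spinor 2 (volume : Measure ℝ)}
  {A : Fin 2 → ℝ → ℝ → ℝ} {b : Fin 2 → 𝓓'((⊤ : Opens ℝ), ℝ)}

theorem IsKernel.continuousOn_integral_mul_norm_sq_apply {U : Set ℝ} {κ : ℝ → ℝ → ℝ}
    (h : IsKernel U κ) (hU : IsOpen U) (hψ : ContinuousOn ψ U) (k : Fin 2) :
    ContinuousOn (fun t ↦ ∫ y, κ t y * ‖ψ t y k‖ ^ 2) U := by
  refine (h.continuousOn_integral_mul_norm_sq hU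
    (((projCLM k).compLpL 2 volume).continuous.comp_continuousOn hψ)).congr fun t _ ↦ ?_
  refine integral_congr_ae ?_
  filter_upwards [(projCLM k).coeFn_compLpL (ψ t)] with y hy
  simp only [Function.comp_apply, hy, projCLM_apply]

theorem IsKernel.integrable_mul_of_integrable {U : Set ℝ} {κ : ℝ → ℝ → ℝ} (h : IsKernel U κ)
    {t : ℝ} (ht : t ∈ U) {v : ℝ → ℝ} (hv : Integrable v) : Integrable fun y ↦ κ t y * v y := by
  obtain ⟨C, hC⟩ := (h.continuous ht).bounded_above_of_compact_support (h.hasCompactSupport ht)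
  exact hv.bdd_mul (h.continuous ht).aestronglyMeasurable (ae_of_all _ hC)

/-- The wave equations for `A_0 - A_1`, tested against `η(t)` times a solution of the wave
equation. -/
theorem IsChargeSolution.weak_wave (hs : IsChargeSolution M I ψ A b) {U : Set ℝ}
    (hU : IsOpen U) (hb : Bornology.IsBounded U) (hUI : U ⊆ I) {h a c : ℝ} {R η : ℝ → ℝ}
    (hR : IsStep h R) (hη : IsTest U η) :
    (∫ t, deriv (deriv η) t • ∫ y, pulse R a c t y * (A 0 t y - A 1 t y))
      + (2 : ℝ) • ∫ t, deriv η t • ∫ y, pulseDeriv R a c t y * (A 0 t y - A 1 t y)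
      = ∫ t, η t • -∫ y, 2 * pulse R a c t y * ‖ψ t y 0‖ ^ 2 := by
  have hψ : ContinuousOn ψ U := hs.continuous_spinor.mono hUI
  have hA : ∀ μ, ContinuousOn (fun z : ℝ × ℝ ↦ A μ z.1 z.2) (U ×ˢ Set.univ) := fun μ ↦
    (hs.continuous_potential μ).mono (Set.prod_mono hUI subset_rfl)
  have hΦ : IsKernel U (pulse R a c) := hR.isKernel_pulse hb
  have hΦ' : IsKernel U (pulseDeriv R a c) := hR.isKernel_pulseDeriv hb
  set p : Fin 2 → ℝ → ℝ := fun μ t ↦ ∫ y, pulse R a c t y * A μ t y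
  set r : Fin 2 → ℝ → ℝ := fun μ t ↦ ∫ y, pulseDeriv R a c t y * A μ t y
  have hp : ∀ μ, ContinuousOn (p μ) U := fun μ ↦ hΦ.continuousOn_integral_mul (hA μ)
  have hr : ∀ μ, ContinuousOn (r μ) U := fun μ ↦ hΦ'.continuousOn_integral_mul (hA μ)
  set n : ℝ → ℝ := fun t ↦ ∫ y, pulse R a c t y * ‖ψ t y‖ ^ 2
  set q : ℝ → ℝ := fun t ↦ ∫ y, pulse R a c t y * ‖ψ t y 0‖ ^ 2
  have hn : ContinuousOn n U := hΦ.continuousOn_integral_mul_norm_sq hU hψ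
  have hq : ContinuousOn q U := hΦ.continuousOn_integral_mul_norm_sq_apply hU hψ 0
  have hη0 : ∀ t ∉ U, η t = 0 := fun t ht ↦ hη.eq_zero ht
  have hη0' : ∀ t ∉ U, deriv η t = 0 := fun t ht ↦ hη.deriv.eq_zero ht
  have hη0'' : ∀ t ∉ U, deriv (deriv η) t = 0 := fun t ht ↦ hη.deriv.deriv.eq_zero ht
  obtain ⟨K, hK, hK0⟩ := hΦ.exists_isCompact
  let θ : 𝓓(slab I, ℝ) := mkTest (fun z ↦ η z.1 * pulse R a c z.1 z.2)
    ((hη.contDiff.comp contDiff_fst).mul (((hR.contDiff.comp (by fun_prop)).sub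
      (hR.contDiff.comp (by fun_prop))).div_const 2))
    (hη.hasCompactSupport.isCompact.prod hK)
    (fun z hz ↦ ⟨hUI (hη.tsupport_subset hz.1), trivial⟩) fun z hz ↦ by
    by_cases h1 : z.1 ∈ tsupport η
    · rw [hK0 z.1 (hη.tsupport_subset h1) z.2 fun h2 ↦ hz ⟨h1, h2⟩, mul_zero]
    · rw [image_eq_zero_of_notMem_tsupport h1, zero_mul]
  have hθ : ∀ t x, θ (t, x) = η t * pulse R a c t x := fun _ _ ↦ rfl
  have d1 : ∀ t x : ℝ, HasDerivAt (fun s ↦ x - a - s) (-1) t := fun t x ↦ by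
    simpa using (hasDerivAt_id t).const_sub (x - a)
  have d2 : ∀ t x : ℝ, HasDerivAt (fun s ↦ x - c + s) 1 t := fun t x ↦ by
    simpa using (hasDerivAt_id t).const_add (x - c)
  have d3 : ∀ t x : ℝ, HasDerivAt (fun y ↦ y - a - t) 1 x := fun t x ↦
    ((hasDerivAt_id x).sub_const a).sub_const t
  have d4 : ∀ t x : ℝ, HasDerivAt (fun y ↦ y - c + t) 1 x := fun t x ↦
    ((hasDerivAt_id x).sub_const c).add_const t
  set Q : ℝ → ℝ → ℝ := fun t x ↦
    (deriv (deriv R) (x - a - t) - deriv (deriv R) (x - c + t)) / 2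
  set P : ℝ → ℝ → ℝ := fun t x ↦ (deriv R (x - a - t) - deriv R (x - c + t)) / 2
  have hΦt : ∀ t x, HasDerivAt (fun s ↦ pulse R a c s x) (pulseDeriv R a c t x) t := fun t x ↦
    ((((hR.hasDerivAt (x - a - t)).comp t (d1 t x)).sub
      ((hR.hasDerivAt (x - c + t)).comp t (d2 t x))).div_const 2).congr_deriv
      (by simp only [pulseDeriv]; ring)
  have hΦtt : ∀ t x, HasDerivAt (fun s ↦ pulseDeriv R a c s x) (Q t x) t := fun t x ↦
    ((((hR.hasDerivAt_deriv (x - a - t)).comp t (d1 t x)).add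
      ((hR.hasDerivAt_deriv (x - c + t)).comp t (d2 t x))).neg.div_const 2).congr_deriv
      (by simp only [Q]; ring)
  have hΦx : ∀ t x, HasDerivAt (fun y ↦ pulse R a c t y) (P t x) x := fun t x ↦
    ((((hR.hasDerivAt (x - a - t)).comp x (d3 t x)).sub
      ((hR.hasDerivAt (x - c + t)).comp x (d4 t x))).div_const 2).congr_deriv
      (by simp only [P]; ring)
  have hΦxx : ∀ t x, HasDerivAt (fun y ↦ P t y) (Q t x) x := fun t x ↦ by
    have := (((hR.hasDerivAt_deriv (x - a - t)).comp x (d3 t x)).sub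
      ((hR.hasDerivAt_deriv (x - c + t)).comp x (d4 t x))).div_const 2
    simp only [mul_one] at this
    exact this
  have e0 : ∀ t x, (∂_{e 0} θ) (t, x)
      = deriv η t * pulse R a c t x + η t * pulseDeriv R a c t x := fun t x ↦
    lineDeriv_zero_eq (θ := θ) ((hη.hasDerivAt t).mul (hΦt t x))
  have e00 : ∀ t x, (∂_{e 0} (∂_{e 0} θ)) (t, x) = deriv (deriv η) t * pulse R a c t x
      + 2 * (deriv η t * pulseDeriv R a c t x) + η t * Q t x := fun t x ↦ by
    refine lineDeriv_zero_eq (θ := ∂_{e 0} θ) ?_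
    simp only [e0]
    exact (((hη.deriv.hasDerivAt t).mul (hΦt t x)).add
      ((hη.hasDerivAt t).mul (hΦtt t x))).congr_deriv (by ring)
  have e1 : ∀ t x, (∂_{e 1} θ) (t, x) = η t * P t x := fun t x ↦
    lineDeriv_one_eq (θ := θ) ((hΦx t x).const_mul (η t))
  have e11 : ∀ t x, (∂_{e 1} (∂_{e 1} θ)) (t, x) = η t * Q t x := fun t x ↦ by
    refine lineDeriv_one_eq (θ := ∂_{e 1} θ) ?_
    simp only [e1]
    exact (hΦxx t x).const_mul (η t)
  -- The second derivatives `Q` of the pulse cancel because it solves the wave equation; only terms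
  -- in which `η` is differentiated survive.
  have hleft : ∀ μ t, ∫ x, ((∂_{e 0} (∂_{e 0} θ)) (t, x) - (∂_{e 1} (∂_{e 1} θ)) (t, x)) * A μ t x
      = deriv (deriv η) t • p μ t + (2 : ℝ) • deriv η t • r μ t := fun μ t ↦ by
    simp only [e00, e11]
    by_cases ht : t ∈ U
    · have i1 := (hΦ.integrable_mul ht (hA μ) ht).const_mul (deriv (deriv η) t)
      have i2 := (hΦ'.integrable_mul ht (hA μ) ht).const_mul (2 * deriv η t)
      simp only [p, r, smul_eq_mul]
      rw [← mul_assoc 2, ← integral_const_mul, ← integral_const_mul, ← integral_add i1 i2]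
      congr 1; ext x; ring
    · simp [hη0 t ht, hη0' t ht, hη0'' t ht]
  have hright0 : ∀ t, ∫ x, θ (t, x) * current 0 (ψ t x) = η t • n t := fun t ↦ by
    simp only [hθ, current_zero, mul_assoc, n, smul_eq_mul]
    rw [integral_const_mul]
  have hright1 : ∀ t, ∫ x, θ (t, x) * current 1 (ψ t x) = η t • n t - (2 : ℝ) • η t • q t := by
    intro t
    by_cases ht : t ∈ U
    · have i1 := (hΦ.integrable_mul_of_integrable ht (integrable_norm_sq (ψ t))).const_mul (η t)
      have i2 := (hΦ.integrable_mul_of_integrable ht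
        (integrable_norm_sq_apply (ψ t) 0)).const_mul (2 * η t)
      simp only [n, q, smul_eq_mul]
      rw [← mul_assoc 2, ← integral_const_mul, ← integral_const_mul, ← integral_sub i1 i2]
      congr 1; ext x
      have h1 := current_sub_current (ψ t x)
      rw [current_zero] at h1
      rw [hθ]
      linear_combination (-(η t * pulse R a c t x)) * h1
    · simp [hη0 t ht, hθ]
  have h0 := hs.wave 0 θ
  have h1 := hs.wave 1 θ
  simp only [hleft, hright0, hright1] at h0 h1
  have ip := fun μ ↦ hη.deriv.deriv.integrable_smul hU (hp μ)
  have ir := fun μ ↦ hη.deriv.integrable_smul hU (hr μ)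
  have iq := hη.integrable_smul hU hq
  have i2r : ∀ μ, Integrable fun t ↦ (2 : ℝ) • deriv η t • r μ t := fun μ ↦
    (ir μ).smul (2 : ℝ)
  have i2q : Integrable fun t ↦ (2 : ℝ) • η t • q t := iq.smul (2 : ℝ)
  rw [integral_add (ip 0) (i2r 0), integral_smul] at h0
  rw [integral_add (ip 1) (i2r 1), integral_smul,
    integral_sub (hη.integrable_smul hU hn) i2q, integral_smul] at h1
  have hpp : ∀ t, deriv (deriv η) t • ∫ y, pulse R a c t y * (A 0 t y - A 1 t y)
      = deriv (deriv η) t • p 0 t - deriv (deriv η) t • p 1 t := fun t ↦ by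
    by_cases ht : t ∈ U
    · simp only [mul_sub]
      rw [integral_sub (hΦ.integrable_mul ht (hA 0) ht) (hΦ.integrable_mul ht (hA 1) ht), smul_sub]
    · simp [hη0'' t ht]
  have hrr : ∀ t, deriv η t • ∫ y, pulseDeriv R a c t y * (A 0 t y - A 1 t y)
      = deriv η t • r 0 t - deriv η t • r 1 t := fun t ↦ by
    by_cases ht : t ∈ U
    · simp only [mul_sub]
      rw [integral_sub (hΦ'.integrable_mul ht (hA 0) ht) (hΦ'.integrable_mul ht (hA 1) ht),
        smul_sub]
    · simp [hη0' t ht]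
  have hqq : ∀ t, η t • -∫ y, 2 * pulse R a c t y * ‖ψ t y 0‖ ^ 2
      = -((2 : ℝ) • η t • q t) := fun t ↦ by
    simp only [mul_assoc, q, smul_eq_mul]
    rw [integral_const_mul]; ring
  simp only [hpp, hrr, hqq]
  rw [integral_sub (ip 0) (ip 1), integral_sub (ir 0) (ir 1), integral_neg, integral_smul]
  simp only [smul_eq_mul] at h0 h1 ⊢
  linear_combination h0 - h1

/-- The value of `A_1 - A_0`, mollified by `deriv R`, for vanishing initial potentials. -/
theorem IsChargeSolution.integral_deriv_mul_eq (hs : IsChargeSolution M I ψ A 0)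
    (h0 : ∀ μ x, A μ 0 x = 0) {h : ℝ} {R : ℝ → ℝ} (hR : IsStep h R) {t : ℝ} (ht0 : 0 < t)
    (ht : t ∈ I) (x : ℝ) :
    ∫ y, deriv R (y - x) * -(A 0 t y - A 1 t y)
      = ∫ s in (0 : ℝ)..t, ∫ y, 2 * pulse R (x - t) (x + t) s y * ‖ψ s y 0‖ ^ 2 := by
  obtain ⟨l, m, hlm, hsub, hmem⟩ := exists_Icc_subset_of_isCompact I.isOpen hs.ordConnected
    ⟨t, ht⟩ isCompact_Icc (hs.ordConnected.out hs.zero_mem ht)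
  have hUI : Set.Ioo l m ⊆ I := Set.Ioo_subset_Icc_self.trans hsub
  set U := Set.Ioo l m
  have hU : IsOpen U := isOpen_Ioo
  have hUb : Bornology.IsBounded U := Metric.isBounded_Ioo l m
  have hUc : U.OrdConnected := Set.ordConnected_Ioo
  have h0U : 0 ∈ U := hmem (Set.left_mem_Icc.2 ht0.le)
  have htU : t ∈ U := hmem (Set.right_mem_Icc.2 ht0.le)
  have hψ : ContinuousOn ψ U := hs.continuous_spinor.mono hUI
  have hA : ∀ μ, ContinuousOn (fun z : ℝ × ℝ ↦ A μ z.1 z.2) (U ×ˢ Set.univ) := fun μ ↦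
    (hs.continuous_potential μ).mono (Set.prod_mono hUI subset_rfl)
  set B : ℝ → ℝ → ℝ := fun t y ↦ A 0 t y - A 1 t y
  have hB : ContinuousOn (fun z : ℝ × ℝ ↦ B z.1 z.2) (U ×ˢ Set.univ) := (hA 0).sub (hA 1)
  have hB0 : ∀ y, B 0 y = 0 := fun y ↦ by simp [B, h0]
  set a := x - t
  set c := x + t
  have hΦ : IsKernel U (pulse R a c) := hR.isKernel_pulse hUb
  have hΦ' : IsKernel U (pulseDeriv R a c) := hR.isKernel_pulseDeriv hUb
  have hq : ContinuousOn (fun s ↦ -∫ y, 2 * pulse R a c s y * ‖ψ s y 0‖ ^ 2) U := by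
    have := (hΦ.continuousOn_integral_mul_norm_sq_apply hU hψ 0).const_smul (-2 : ℝ)
    refine this.congr fun s _ ↦ ?_
    simp only [mul_assoc, Pi.smul_apply, smul_eq_mul]
    rw [integral_const_mul, neg_mul]
  obtain ⟨k, hk⟩ := exists_of_weak_second_deriv hU hUc (hΦ.continuousOn_integral_mul hB)
    (hΦ'.continuousOn_integral_mul hB) hq
    (fun η hη ↦ hs.weak_wave hU hUb hUI hR hη) h0U
  have hderiv : ∀ s ∈ U, ∀ d, HasDerivAt (fun t ↦ ∫ y, pulse R a c s y * B t y) d s →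
      HasDerivAt (fun t ↦ ∫ y, pulse R a c t y * B t y)
        (d + ∫ y, pulseDeriv R a c s y * B s y) s := fun s hsU d hd ↦ by
    have h1 := hΦ.hasDerivAt_integral_mul (hR.isKernel_pulseSlope hUb hsU) hU hB hsU
      (hR.pulse_sub_pulse a c s) hd
    simpa only [IsStep.pulseSlope_self] using h1
  -- At time zero the potentials and their velocities vanish, so every term in the derivative
  -- formula except `k` is zero.
  have hk0 : k = 0 := by
    have hΦ0 : IsTest Set.univ (pulse R a c 0) := ⟨((hR.contDiff.comp (by fun_prop)).sub
      (hR.contDiff.comp (by fun_prop))).div_const 2, hΦ.hasCompactSupport h0U, Set.subset_univ _⟩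
    have hv : ∀ μ, HasDerivAt (fun t ↦ ∫ y, pulse R a c 0 y * A μ t y) 0 0 := fun μ ↦
      hs.velocity μ hΦ0.toTestFunction
    have hd : HasDerivAt (fun t ↦ ∫ y, pulse R a c 0 y * B t y) 0 0 := by
      refine (((hv 0).sub (hv 1)).congr_deriv (sub_zero 0)).congr_of_eventuallyEq ?_
      filter_upwards [hU.mem_nhds h0U] with τ hτ
      simp only [B, mul_sub, Pi.sub_apply]
      exact integral_sub (hΦ.integrable_mul h0U (hA 0) hτ) (hΦ.integrable_mul h0U (hA 1) hτ)
    have h1 := (hk 0 h0U).unique (hderiv 0 h0U 0 hd)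
    change k + (2 : ℝ) • (∫ y, pulseDeriv R a c 0 y * B 0 y) + _ = _ at h1
    simpa [hB0] using h1
  have hΦt : ∀ y, pulse R a c t y = 0 := fun y ↦ by
    simp only [pulse, a, c]
    rw [show y - (x - t) - t = y - (x + t) + t by ring]; simp
  have hΦt' : ∀ y, pulseDeriv R a c t y = -deriv R (y - x) := fun y ↦ by
    simp only [pulseDeriv, a, c]
    rw [show y - (x - t) - t = y - x by ring, show y - (x + t) + t = y - x by ring]; ring
  -- At time `t` the pulse itself vanishes, so the derivative of its pairing is the pairing `r` with
  -- its velocity. The formula from the equation gives `2 * r` plus the source integral; comparison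
  -- determines `r`.
  have h2 := (hk t htU).unique (hderiv t htU 0 (by
    simp only [hΦt, zero_mul, integral_zero]; exact hasDerivAt_const t 0))
  simp only [hk0, hΦt', intervalIntegral.integral_neg, smul_eq_mul] at h2
  have e1 : ∀ y, deriv R (y - x) * -B t y = -deriv R (y - x) * B t y := fun y ↦ by ring
  change ∫ y, deriv R (y - x) * -B t y = _
  simp only [e1]
  change 0 + 2 * (∫ y, -deriv R (y - x) * B t y) + _ = _ at h2
  linarith

end

end

end MaxwellDirac

namespace MaxwellDirac

noncomputable section

/-! ### Logarithmic divergence of `A_0 - A_1` -/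

theorem IsStep.abs_integral_deriv_mul_sub_le {h δ x : ℝ} {R f : ℝ → ℝ} (hR : IsStep h R)
    (hf : Continuous f) (hδ : ∀ y, |y - x| ≤ h → |f y - f x| ≤ δ) :
    |(∫ y, deriv R (y - x) * f y) - f x| ≤ δ := by
  have hc : Continuous fun y ↦ deriv R (y - x) := hR.contDiff_deriv.continuous.comp (by fun_prop)
  have hs : HasCompactSupport fun y ↦ deriv R (y - x) :=
    HasCompactSupport.intro (isCompact_closedBall x h) fun y hy ↦ hR.deriv_eq_zero (by
      simpa [Real.dist_eq] using hy)
  have h1 : ∫ y, deriv R (y - x) = 1 := by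
    rw [integral_sub_right_eq_self (deriv R) x, hR.integral_deriv]
  have i1 : Integrable fun y ↦ deriv R (y - x) := hc.integrable_of_hasCompactSupport hs
  have i2 : Integrable fun y ↦ deriv R (y - x) * f y :=
    (hc.mul hf).integrable_of_hasCompactSupport hs.mul_right
  calc |(∫ y, deriv R (y - x) * f y) - f x|
      = |∫ y, deriv R (y - x) * (f y - f x)| := by
        simp only [mul_sub]
        rw [integral_sub i2 (i1.mul_const _), integral_mul_const, h1, one_mul]
    _ ≤ ∫ y, deriv R (y - x) * δ := by
        rw [← Real.norm_eq_abs]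
        refine norm_integral_le_of_norm_le (i1.mul_const δ) (ae_of_all _ fun y ↦ ?_)
        rw [norm_mul, Real.norm_of_nonneg (hR.deriv_nonneg _)]
        by_cases hy : |y - x| ≤ h
        · exact mul_le_mul_of_nonneg_left (hδ y hy) (hR.deriv_nonneg _)
        · rw [hR.deriv_eq_zero (not_le.1 hy)]; simp
    _ = δ := by rw [integral_mul_const, h1, one_mul]

/-! ### The charge of the regularised data -/

theorem norm_sq_spinorData_apply {ε : ℝ} (hε : 0 < ε) (x : ℝ) (k : Fin 2) :
    ‖spinorData ε x k‖ ^ 2 = (Set.Icc (-1 : ℝ) 1).indicator (fun x ↦ 1 / (ε + |x|)) x := by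
  have hp : 0 < ε + |x| := by positivity
  by_cases hx : x ∈ Set.Icc (-1 : ℝ) 1
  · have h1 : ((ε + |x|) ^ (-(1 / 2) : ℝ)) ^ 2 = 1 / (ε + |x|) := by
      rw [← Real.rpow_natCast, ← Real.rpow_mul hp.le,
        show (-(1 / 2) * (2 : ℕ) : ℝ) = -1 by norm_num, Real.rpow_neg_one, one_div]
    rw [Set.indicator_of_mem hx, ← h1, spinorData, Set.indicator_of_mem hx]
    have h2 : ((((ε + |x|) ^ (-(1 / 2) : ℝ) : ℝ) • !₂[(1 : ℂ), 1] : Spinor)) k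
        = (((ε + |x|) ^ (-(1 / 2) : ℝ) : ℝ) : ℂ) := by
      fin_cases k <;> simp
    rw [h2, Complex.norm_real, Real.norm_eq_abs, sq_abs]
  · rw [Set.indicator_of_notMem hx, spinorData, Set.indicator_of_notMem hx]; simp

theorem intervalIntegrable_one_div_add_abs {ε : ℝ} (hε : 0 < ε) (a b : ℝ) :
    IntervalIntegrable (fun x ↦ 1 / (ε + |x|)) volume a b :=
  (Continuous.div continuous_const (by fun_prop) fun x ↦ by positivity).intervalIntegrable _ _

theorem integral_one_div_add_abs {ε : ℝ} (hε : 0 < ε) :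
    ∫ x in (-1 : ℝ)..1, 1 / (ε + |x|) = 2 * Real.log (1 + 1 / ε) := by
  have h1 : ∫ x in (0 : ℝ)..1, 1 / (ε + |x|) = Real.log (1 + 1 / ε) := by
    rw [← integral_one_div_add hε zero_le_one]
    refine intervalIntegral.integral_congr fun x hx ↦ ?_
    rw [Set.uIcc_of_le zero_le_one] at hx
    simp only [abs_of_nonneg hx.1]
  have h2 : ∫ x in (-1 : ℝ)..0, 1 / (ε + |x|) = Real.log (1 + 1 / ε) := by
    have := intervalIntegral.integral_comp_neg (a := (-1 : ℝ)) (b := 0) fun x ↦ 1 / (ε + |x|)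
    simp only [abs_neg, neg_neg, neg_zero] at this
    rw [← h1, this]
  rw [← intervalIntegral.integral_add_adjacent_intervals (b := 0)
    (intervalIntegrable_one_div_add_abs hε _ _) (intervalIntegrable_one_div_add_abs hε _ _), h1, h2]
  ring

theorem integral_norm_sq_spinorData {ε : ℝ} (hε : 0 < ε) :
    ∫ x, ‖spinorData ε x‖ ^ 2 = 4 * Real.log (1 + 1 / ε) := by
  have h1 : ∀ x, ‖spinorData ε x‖ ^ 2
      = 2 * (Set.Icc (-1 : ℝ) 1).indicator (fun x ↦ 1 / (ε + |x|)) x := fun x ↦ by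
    rw [EuclideanSpace.norm_sq_eq, Fin.sum_univ_two, norm_sq_spinorData_apply hε,
      norm_sq_spinorData_apply hε]; ring
  simp only [h1]
  rw [integral_const_mul, integral_indicator measurableSet_Icc, integral_Icc_eq_integral_Ioc,
    ← intervalIntegral.integral_of_le (by norm_num), integral_one_div_add_abs hε]
  ring

/-- A smooth function with values in `[0, 1]`, equal to `1` on `[a, b]` and to `0` outside
`[a - r, b + r]`. -/
theorem exists_cutoff_Icc {a b r : ℝ} (hr : 0 < r) : ∃ f : ℝ → ℝ,
    IsTest Set.univ f ∧ (∀ x, 0 ≤ f x) ∧ (∀ x, f x ≤ 1) ∧ (∀ x ∈ Set.Icc a b, f x = 1) ∧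
    ∀ x, x ∉ Set.Icc (a - r) (b + r) → f x = 0 := by
  have h0 : ∀ x, x ∉ Set.Icc (a - r) (b + r) →
      Real.smoothTransition ((x - (a - r)) / r) * Real.smoothTransition ((b + r - x) / r) = 0 := by
    intro x hx
    rcases lt_or_ge x (a - r) with h | h
    · rw [Real.smoothTransition.zero_of_nonpos
        (div_nonpos_of_nonpos_of_nonneg (by linarith) hr.le), zero_mul]
    · have : b + r < x := by
        by_contra! h'
        exact hx ⟨h, h'⟩
      rw [Real.smoothTransition.zero_of_nonpos (x := (b + r - x) / r)
        (div_nonpos_of_nonpos_of_nonneg (by linarith) hr.le), mul_zero]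
  refine ⟨fun x ↦ Real.smoothTransition ((x - (a - r)) / r) *
    Real.smoothTransition ((b + r - x) / r), ⟨?_, HasCompactSupport.intro isCompact_Icc h0,
      Set.subset_univ _⟩, fun x ↦ ?_, fun x ↦ ?_, fun x hx ↦ ?_, h0⟩
  · exact (Real.smoothTransition.contDiff.comp (by fun_prop)).mul
      (Real.smoothTransition.contDiff.comp (by fun_prop))
  · exact mul_nonneg (Real.smoothTransition.nonneg _) (Real.smoothTransition.nonneg _)
  · exact mul_le_one₀ (Real.smoothTransition.le_one _) (Real.smoothTransition.nonneg _)
      (Real.smoothTransition.le_one _)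
  · beta_reduce
    rw [Real.smoothTransition.one_of_one_le (by rw [le_div_iff₀ hr]; linarith [hx.1]),
      Real.smoothTransition.one_of_one_le (by rw [le_div_iff₀ hr]; linarith [hx.2]), mul_one]

/-! ### Upper and lower bounds for the cone integral -/

section

variable {M : ℝ} {I : Opens ℝ} {ψ : ℝ → Lp Spinor 2 (volume : Measure ℝ)}
  {A : Fin 2 → ℝ → ℝ → ℝ}

theorem IsChargeSolution.integral_norm_sq (hs : IsChargeSolution M I ψ A 0) {s : ℝ} (h : s ∈ I) :
    ∫ y, ‖ψ s y‖ ^ 2 = ‖ψ 0‖ ^ 2 := by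
  rw [← norm_sq_eq_integral, hs.charge s h]

theorem norm_sq_apply_le (v : Spinor) (k : Fin 2) : ‖v k‖ ^ 2 ≤ ‖v‖ ^ 2 :=
  pow_le_pow_left₀ (norm_nonneg _) (PiLp.norm_apply_le v k) 2

/-- The cone integral of the charge density of the first component is at most the charge, times
the elapsed time. -/
theorem IsChargeSolution.integral_pulse_le (hs : IsChargeSolution M I ψ A 0) {h : ℝ} {R : ℝ → ℝ}
    (hR : IsStep h R) {t : ℝ} (ht0 : 0 < t) (ht : t ∈ I) (x : ℝ) :
    ∫ s in (0 : ℝ)..t, ∫ y, 2 * pulse R (x - t) (x + t) s y * ‖ψ s y 0‖ ^ 2 ≤ ‖ψ 0‖ ^ 2 * t := by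
  have h1 := intervalIntegral.norm_integral_le_of_norm_le_const (a := 0) (b := t) (C := ‖ψ 0‖ ^ 2)
    (f := fun s ↦ ∫ y, 2 * pulse R (x - t) (x + t) s y * ‖ψ s y 0‖ ^ 2) fun s hs' ↦ by
      rw [Set.uIoc_of_le ht0.le] at hs'
      have hsI : s ∈ I := hs.ordConnected.out hs.zero_mem ht ⟨hs'.1.le, hs'.2⟩
      have hp := hR.pulse_nonneg (a := x - t) (b := x + t) (t := s) (by linarith [hs'.2])
      rw [Real.norm_of_nonneg (integral_nonneg fun y ↦
        mul_nonneg (mul_nonneg zero_le_two (hp y)) (sq_nonneg _)), ← hs.integral_norm_sq hsI]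
      refine integral_mono_of_nonneg (ae_of_all _ fun y ↦
        mul_nonneg (mul_nonneg zero_le_two (hp y)) (sq_nonneg _)) (integrable_norm_sq _)
        (ae_of_all _ fun y ↦ ?_)
      exact (mul_le_of_le_one_left (sq_nonneg _) (hR.two_mul_pulse_le_one s y)).trans
        (norm_sq_apply_le _ 0)
  rw [sub_zero, abs_of_pos ht0] at h1
  exact (le_abs_self _).trans h1

/-- A lower bound for the energy of the first component in a neighbourhood of a characteristic
through the singularity. -/
theorem IsChargeSolution.log_sub_le_energy (hs : IsChargeSolution M I ψ A 0) {ε : ℝ} (hε : 0 < ε)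
    (hψ : (ψ 0 : ℝ → Spinor) =ᵐ[volume] spinorData ε) {l : ℝ} (hl : 0 < l) (hl1 : l ≤ 1)
    {f : ℝ → ℝ} (hf : IsTest Set.univ f) (hf0 : ∀ x, 0 ≤ f x) (hf1 : ∀ x, f x ≤ 1)
    (hfl : ∀ x ∈ Set.Icc 0 l, f x = 1) {s : ℝ} (hs0 : 0 ≤ s) (hsI : s ∈ I) :
    Real.log (1 + l / ε) - |M| * (‖ψ 0‖ ^ 2 * s) ≤ ∫ y, f (y - s) ^ 2 * ‖ψ s y 0‖ ^ 2 := by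
  have hfi : ∀ (τ : ℝ) {v : ℝ → ℝ}, Integrable v → Integrable fun x ↦ f (x - τ) ^ 2 * v x :=
    fun τ v hv ↦ IsTest.integrable_mul_of_le_one
      ((hf.contDiff.continuous.comp (by fun_prop)).pow 2) (fun _ ↦ sq_nonneg _)
      (fun x ↦ pow_le_one₀ (hf0 _) (hf1 _)) hv
  have h1 := hs.abs_energy_sub_le 0 hf hs0 hs.zero_mem hsI
  simp only [g, Matrix.cons_val_zero, one_mul] at h1
  have h2 : ∫ τ in (0 : ℝ)..s, ∫ x, f (x - τ) ^ 2 * ‖ψ τ x‖ ^ 2 ≤ ‖ψ 0‖ ^ 2 * s := by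
    have h3 := intervalIntegral.norm_integral_le_of_norm_le_const (a := 0) (b := s)
      (C := ‖ψ 0‖ ^ 2) (f := fun τ ↦ ∫ x, f (x - τ) ^ 2 * ‖ψ τ x‖ ^ 2) fun τ hτ ↦ by
        rw [Set.uIoc_of_le hs0] at hτ
        have hτI : τ ∈ I := hs.ordConnected.out hs.zero_mem hsI ⟨hτ.1.le, hτ.2⟩
        rw [Real.norm_of_nonneg (integral_nonneg fun y ↦ mul_nonneg (sq_nonneg _) (sq_nonneg _)),
          ← hs.integral_norm_sq hτI]
        exact integral_mono (hfi τ (integrable_norm_sq _)) (integrable_norm_sq _) fun y ↦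
          mul_le_of_le_one_left (sq_nonneg _) (pow_le_one₀ (hf0 _) (hf1 _))
    rw [sub_zero, abs_of_nonneg hs0] at h3
    exact (le_abs_self _).trans h3
  -- Only the part of the initial density on `(0, l]`, where the cutoff is `1`, is kept.
  have h4 : Real.log (1 + l / ε) ≤ ∫ x, f (x - 0) ^ 2 * ‖ψ 0 x 0‖ ^ 2 := by
    rw [← integral_one_div_add hε hl.le, intervalIntegral.integral_of_le hl.le,
      ← integral_indicator measurableSet_Ioc]
    refine integral_mono_of_nonneg (ae_of_all _ fun x ↦ Set.indicator_nonneg (fun x hx ↦ ?_) x)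
      (hfi 0 (integrable_norm_sq_apply (ψ 0) 0)) ?_
    · exact one_div_nonneg.2 (by linarith [hx.1])
    · filter_upwards [hψ] with x hx
      rw [hx, norm_sq_spinorData_apply hε, sub_zero]
      by_cases hxl : x ∈ Set.Ioc 0 l
      · rw [Set.indicator_of_mem hxl, Set.indicator_of_mem
          (show x ∈ Set.Icc (-1 : ℝ) 1 from ⟨by linarith [hxl.1], hxl.2.trans hl1⟩),
          hfl x ⟨hxl.1.le, hxl.2⟩, abs_of_pos hxl.1]
        simp
      · rw [Set.indicator_of_notMem hxl]
        exact mul_nonneg (sq_nonneg _) (Set.indicator_nonneg (fun x _ ↦ by positivity) x)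
  have h5 := (abs_le.1 h1).1
  have h6 := mul_le_mul_of_nonneg_left h2 (abs_nonneg M)
  linarith

/-- A lower bound for the cone integral of the charge density of the first component. -/
theorem IsChargeSolution.le_integral_pulse (hs : IsChargeSolution M I ψ A 0) {ε : ℝ} (hε : 0 < ε)
    (hψ : (ψ 0 : ℝ → Spinor) =ᵐ[volume] spinorData ε) {t x : ℝ} (ht : t ∈ I) (hxt : |x| < t)
    (ht1 : t < 1) {h : ℝ} (hh : h ≤ (t - x) / 2) (hh' : h ≤ (t + x) / 16) {R : ℝ → ℝ}
    (hR : IsStep h R) :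
    3 / 8 * (t + x) * (Real.log (1 + (t + x) / 8 / ε) - |M| * (‖ψ 0‖ ^ 2 * t))
      ≤ ∫ s in (0 : ℝ)..t, ∫ y, 2 * pulse R (x - t) (x + t) s y * ‖ψ s y 0‖ ^ 2 := by
  have hx := abs_lt.1 hxt
  have ht0 : 0 < t := (abs_nonneg x).trans_lt hxt
  have hI : Set.Icc 0 t ⊆ I := hs.ordConnected.out hs.zero_mem ht
  obtain ⟨f, hf, hf0, hf1, hfl, hfs⟩ := exists_cutoff_Icc (a := 0) (b := (t + x) / 8)
    (r := min ((t - x) / 2) ((t + x) / 16)) (lt_min (by linarith) (by linarith))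
  have hr1 := min_le_left ((t - x) / 2) ((t + x) / 16)
  have hr2 := min_le_right ((t - x) / 2) ((t + x) / 16)
  set F : ℝ → ℝ := fun s ↦ ∫ y, 2 * pulse R (x - t) (x + t) s y * ‖ψ s y 0‖ ^ 2
  have hF0 : ∀ s ≤ t, 0 ≤ F s := fun s hst ↦ integral_nonneg fun y ↦
    mul_nonneg (mul_nonneg zero_le_two (hR.pulse_nonneg (by linarith) y)) (sq_nonneg _)
  have hFc : ∀ s ∈ Set.Icc 0 t, ContinuousAt F s := fun s hst ↦ by
    obtain ⟨l, m, hlm, hsub, hmem⟩ := exists_Icc_subset_of_isCompact I.isOpen hs.ordConnected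
      ⟨t, ht⟩ isCompact_Icc hI
    have hUI : Set.Ioo l m ⊆ I := Set.Ioo_subset_Icc_self.trans hsub
    have h1 := ((hR.isKernel_pulse (a := x - t) (b := x + t) (Metric.isBounded_Ioo l m)
      ).continuousOn_integral_mul_norm_sq_apply isOpen_Ioo (hs.continuous_spinor.mono hUI)
        0).const_smul (2 : ℝ)
    have h2 := h1.continuousAt (isOpen_Ioo.mem_nhds (hmem hst))
    refine h2.congr (Eventually.of_forall fun τ ↦ ?_)
    simp only [F, mul_assoc, Pi.smul_apply, smul_eq_mul]
    rw [integral_const_mul]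
  have hFi : ∀ s ∈ Set.Icc 0 t, ∀ s' ∈ Set.Icc 0 t, IntervalIntegrable F volume s s' :=
    fun s h1 s' h2 ↦ ContinuousOn.intervalIntegrable fun τ hτ ↦
      (hFc τ (Set.ordConnected_Icc.uIcc_subset h1 h2 hτ)).continuousWithinAt
  -- With `z = t + x`, the strip at time `s` reaches to at most `s + z/8 + z/16`, and the saturated
  -- part of the pulse to at least `z - s - z/16`. The strip fits as long as `s ≤ 3 z / 8`; on the
  -- left it fits because both margins are at most `(t - x) / 2`.
  set σ := 3 / 8 * (t + x) with hσ
  have hσ0 : 0 ≤ σ := by linarith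
  have hσt : σ ≤ t := by linarith
  have hle : ∀ s ∈ Set.Icc 0 σ,
      Real.log (1 + (t + x) / 8 / ε) - |M| * (‖ψ 0‖ ^ 2 * t) ≤ F s := fun s hsσ ↦ by
    have hst : s ≤ t := hsσ.2.trans hσt
    have hsI : s ∈ I := hI ⟨hsσ.1, hst⟩
    have h1 := hs.log_sub_le_energy hε hψ (by linarith) (by linarith) hf hf0 hf1 hfl hsσ.1 hsI
    have h2 : |M| * (‖ψ 0‖ ^ 2 * s) ≤ |M| * (‖ψ 0‖ ^ 2 * t) := by gcongr
    have hp := hR.pulse_nonneg (a := x - t) (b := x + t) (t := s) (by linarith)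
    have h3 : ∫ y, f (y - s) ^ 2 * ‖ψ s y 0‖ ^ 2 ≤ F s := by
      refine integral_mono_of_nonneg (ae_of_all _ fun y ↦ mul_nonneg (sq_nonneg _) (sq_nonneg _))
        ?_ (ae_of_all _ fun y ↦ mul_le_mul_of_nonneg_right ?_ (sq_nonneg _))
      · simp only [mul_assoc]
        exact ((hR.isKernel_pulse (a := x - t) (b := x + t)
          (Metric.isBounded_Icc 0 t)).integrable_mul_of_integrable ⟨hsσ.1, hst⟩
            (integrable_norm_sq_apply (ψ s) 0)).const_mul 2
      · by_cases hy : y - s ∈ Set.Icc (0 - min ((t - x) / 2) ((t + x) / 16))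
          ((t + x) / 8 + min ((t - x) / 2) ((t + x) / 16))
        · have h5 := hsσ.2
          rw [hR.two_mul_pulse_eq_one (by linarith [hy.1]) (by linarith [hy.2])]
          exact pow_le_one₀ (hf0 _) (hf1 _)
        · rw [hfs _ hy]
          have := hp y
          simpa using this
    linarith
  have h6 := intervalIntegral.integral_mono_on hσ0 (by simp)
    (hFi 0 ⟨le_rfl, ht0.le⟩ σ ⟨hσ0, hσt⟩) hle
  rw [intervalIntegral.integral_const, smul_eq_mul, sub_zero] at h6
  refine h6.trans (intervalIntegral.integral_mono_interval le_rfl hσ0 hσt ?_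
    (hFi 0 ⟨le_rfl, ht0.le⟩ t ⟨ht0.le, le_rfl⟩))
  exact (ae_restrict_iff' measurableSet_Ioc).2 (ae_of_all _ fun s hs' ↦ hF0 s hs'.2)

/-- The bounds for the cone integral do not depend on the mollification width `h`, and the mollified
potential approaches its value at `x` by continuity. -/
theorem IsChargeSolution.potential_bounds (hs : IsChargeSolution M I ψ A 0) {ε : ℝ} (hε : 0 < ε)
    (hψ : (ψ 0 : ℝ → Spinor) =ᵐ[volume] spinorData ε) (h0 : ∀ μ x, A μ 0 x = 0) {t x : ℝ}
    (ht : t ∈ I) (hxt : |x| < t) (ht1 : t < 1) :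
    3 / 8 * (t + x) * (Real.log (1 + (t + x) / 8 / ε) - |M| * (‖ψ 0‖ ^ 2 * t))
        ≤ -(A 0 t x - A 1 t x) ∧ -(A 0 t x - A 1 t x) ≤ ‖ψ 0‖ ^ 2 * t := by
  have hx := abs_lt.1 hxt
  have ht0 : 0 < t := (abs_nonneg x).trans_lt hxt
  have hA : ∀ μ, Continuous (A μ t) := fun μ ↦ continuousOn_univ.1
    ((hs.continuous_potential μ).comp (f := fun y ↦ (t, y)) (by fun_prop) fun _ _ ↦ ⟨ht, trivial⟩)
  have hV : Continuous fun y ↦ -(A 0 t y - A 1 t y) := ((hA 0).sub (hA 1)).neg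
  have key : ∀ δ : ℝ, 0 < δ → ∃ w,
      3 / 8 * (t + x) * (Real.log (1 + (t + x) / 8 / ε) - |M| * (‖ψ 0‖ ^ 2 * t)) ≤ w ∧
      w ≤ ‖ψ 0‖ ^ 2 * t ∧ |w - -(A 0 t x - A 1 t x)| ≤ δ := by
    intro δ hδ
    obtain ⟨r, hr, hball⟩ := Metric.continuousAt_iff.1 (hV.continuousAt (x := x)) δ hδ
    set h := min (r / 2) (min ((t - x) / 2) ((t + x) / 16))
    have hh : 0 < h := lt_min (by linarith) (lt_min (by linarith) (by linarith))
    obtain ⟨R, hR⟩ := exists_isStep hh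
    have h1 : h ≤ r / 2 := min_le_left _ _
    have h2 : h ≤ (t - x) / 2 := (min_le_right _ _).trans (min_le_left _ _)
    have h3 : h ≤ (t + x) / 16 := (min_le_right _ _).trans (min_le_right _ _)
    refine ⟨_, hs.le_integral_pulse hε hψ ht hxt ht1 h2 h3 hR,
      hs.integral_pulse_le hR ht0 ht x, ?_⟩
    rw [← hs.integral_deriv_mul_eq h0 hR ht0 ht x]
    refine hR.abs_integral_deriv_mul_sub_le hV fun y hy ↦ (hball ?_).le
    rw [Real.dist_eq]
    linarith
  constructor
  · refine le_of_forall_pos_le_add fun δ hδ ↦ ?_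
    obtain ⟨w, h1, -, h3⟩ := key δ hδ
    linarith [(abs_le.1 h3).2]
  · refine le_of_forall_pos_le_add fun δ hδ ↦ ?_
    obtain ⟨w, -, h2, h3⟩ := key δ hδ
    linarith [(abs_le.1 h3).1]

end

theorem exists_log_bounds (M : ℝ) : ∃ δ > 0, ∃ C : ℝ, ∀ ε : ℝ, 0 < ε → ε < 1 →
    ∀ (I : Opens ℝ) (ψ : ℝ → Lp Spinor 2 (volume : Measure ℝ)) (A : Fin 2 → ℝ → ℝ → ℝ),
      IsChargeSolution M I ψ A 0 → (ψ 0 : ℝ → Spinor) =ᵐ[volume] spinorData ε →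
      (∀ μ x, A μ 0 x = 0) →
      ∀ t ∈ I, ∀ x : ℝ, |x| < t → t < δ →
        (t + x) / 4 * Real.log (1 / ε) - C ≤ -(A 0 t x - A 1 t x) ∧
        -(A 0 t x - A 1 t x) ≤ C * (1 + Real.log (1 / ε)) := by
  have hM := abs_nonneg M
  -- With charge at most `4 * (1 + L)` and `|M| * t ≤ 1/12`, the mass term costs at most `(1 + L) /
  -- 3`. The remaining `2/3` of the logarithm times `3/8` is the claimed `1/4`.
  refine ⟨1 / (12 * (|M| + 1)), by positivity, 4, fun ε hε hε1 I ψ A hs hψ h0 t ht x hxt htδ ↦ ?_⟩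
  have hx := abs_lt.1 hxt
  have ht0 : 0 < t := (abs_nonneg x).trans_lt hxt
  have hMt : |M| * t ≤ 1 / 12 ∧ t ≤ 1 / 12 := by
    rw [lt_div_iff₀ (by positivity)] at htδ
    constructor <;> nlinarith
  obtain ⟨hlow, hup⟩ := hs.potential_bounds hε hψ h0 ht hxt (by linarith)
  set L := Real.log (1 / ε) with hL
  have hL0 : 0 ≤ L := Real.log_nonneg (by rw [le_div_iff₀ hε]; linarith)
  have hN : ‖ψ 0‖ ^ 2 = 4 * Real.log (1 + 1 / ε) := by
    rw [norm_sq_eq_integral, ← integral_norm_sq_spinorData hε]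
    refine integral_congr_ae ?_
    filter_upwards [hψ] with y hy
    rw [hy]
  have hNL : ‖ψ 0‖ ^ 2 ≤ 4 * (1 + L) := by
    have h1 : Real.log (1 + 1 / ε) ≤ Real.log (2 * (1 / ε)) := by
      refine Real.log_le_log (by positivity) ?_
      have : 1 ≤ 1 / ε := by rw [le_div_iff₀ hε]; linarith
      linarith
    rw [Real.log_mul two_ne_zero (by positivity)] at h1
    have h2 : Real.log 2 ≤ 1 := by
      have := Real.log_le_sub_one_of_pos (x := 2) (by norm_num)
      linarith
    rw [hN]
    linarith
  have hN0 : 0 ≤ ‖ψ 0‖ ^ 2 := sq_nonneg _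
  constructor
  · refine le_trans ?_ hlow
    set z := t + x
    have hz : 0 < z := by simp only [z]; linarith
    have hz1 : z ≤ 1 := by simp only [z]; linarith
    have h1 : L + Real.log (z / 8) ≤ Real.log (1 + z / 8 / ε) := by
      rw [hL, ← Real.log_mul (by positivity) (by positivity)]
      refine Real.log_le_log (by positivity) ?_
      rw [one_div_mul_eq_div]
      linarith
    -- The loss from the shrinking width `z / 8` is absorbed by the prefactor: `3/8 * z * (8 / z) =
    -- 3`. Together with `z / 8` this stays below the constant `4`.
    have h2 : -(8 / z) ≤ Real.log (z / 8) := by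
      have := Real.log_le_sub_one_of_pos (x := 8 / z) (by positivity)
      rw [← inv_div, Real.log_inv] at this
      rw [← inv_div]
      linarith
    have h3 : |M| * (‖ψ 0‖ ^ 2 * t) ≤ (1 + L) / 3 := by nlinarith
    have h4 : 3 / 8 * z * (2 / 3 * L - 1 / 3 - 8 / z) ≤
        3 / 8 * z * (Real.log (1 + z / 8 / ε) - |M| * (‖ψ 0‖ ^ 2 * t)) := by
      refine mul_le_mul_of_nonneg_left ?_ (by positivity)
      linarith
    refine le_trans ?_ h4
    have h5 : 3 / 8 * z * (2 / 3 * L - 1 / 3 - 8 / z) = z / 4 * L - z / 8 - 3 := by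
      field_simp
      ring
    rw [h5]
    linarith
  · refine hup.trans ?_
    nlinarith

end

end MaxwellDirac

/-! ### The theorem -/

open MaxwellDirac in
theorem theorem2 (M : ℝ) :
    -- ill-posedness in `H^s × D₀ × D₁`, `s < 0`
    (∀ s : ℝ, s < 0 → ∀ D₀ D₁ : Submodule ℝ 𝓓'((⊤ : Opens ℝ), ℝ),
      IsIllPosed M (dataSpace (Hs s) D₀ D₁)) ∧
    -- ill-posedness in `L^p × D₀ × D₁`, `1 ≤ p < 2`
    (∀ p : ℝ≥0∞, 1 ≤ p → p < 2 → ∀ D₀ D₁ : Submodule ℝ 𝓓'((⊤ : Opens ℝ), ℝ),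
      IsIllPosed M (dataSpace (LpSpinor p) D₀ D₁)) ∧
    -- the explicit data belong to all of these spaces and admit no local solution
    ((∀ s : ℝ, s < 0 → badData.ψ₀ ∈ Hs s) ∧
      (∀ p : ℝ≥0∞, 1 ≤ p → p < 2 → badData.ψ₀ ∈ LpSpinor p) ∧
      ¬ HasLocalLimitSolution M badData) ∧
    -- logarithmic divergence of `A_- = A_0 - A_1` in the region `t > |x|`
    (∃ δ > 0, ∃ C : ℝ, ∀ ε : ℝ, 0 < ε → ε < 1 →
      ∀ (I : Opens ℝ) (ψ : ℝ → Lp Spinor 2 (volume : Measure ℝ)) (A : Fin 2 → ℝ → ℝ → ℝ),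
        IsChargeSolution M I ψ A 0 → (ψ 0 : ℝ → Spinor) =ᵐ[volume] spinorData ε →
        (∀ μ x, A μ 0 x = 0) →
        ∀ t ∈ I, ∀ x : ℝ, |x| < t → t < δ →
          (t + x) / 4 * Real.log (1 / ε) - C ≤ -(A 0 t x - A 1 t x) ∧
          -(A 0 t x - A 1 t x) ≤ C * (1 + Real.log (1 / ε))) := by
  refine ⟨fun s hs D₀ D₁ ↦ ⟨badData, badData_mem_dataSpace (badData_mem_Hs hs) D₀ D₁,
      not_hasLocalLimitSolution_badData M⟩,
    fun p hp hp' D₀ D₁ ↦ ⟨badData, badData_mem_dataSpace (badData_mem_LpSpinor hp hp') D₀ D₁,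
      not_hasLocalLimitSolution_badData M⟩,
    ⟨fun s hs ↦ badData_mem_Hs hs, fun p hp hp' ↦ badData_mem_LpSpinor hp hp',
      not_hasLocalLimitSolution_badData M⟩, exists_log_bounds M⟩
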